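/- **Setting.** Fix $\delta>0$, $\beta>0$, and a complete probability space $(\Omega,\mathcal F,\mathbb P)$ carrying a random variable $\tilde v\in\{0,1\}$ with $\mathbb P(\tilde v=0)\in(0,1)$ and processes $Z^B,Z^S$ on $[0,1]$ such that $Z^B/\delta$ and $Z^S/\delta$ are independent Poisson processes with intensity $\beta$, jointly independent of $\tilde v$. Put $Z=Z^B-Z^S$. The space also carries a random variable that is uniform on $[0,1]$ and independent of $(\tilde v,Z^B,Z^S)$. A *strategy* $(X^B,X^S;\mathcal F^I)$ is *admissible* if: $\mathcal F^I$ satisfies the usual conditions and $\mathcal F^I_t=\sigma(\tilde v,\mathcal F^Z_t,\mathcal H_t)$ for a filtration $\mathcal H$ independent of $(\tilde v,\mathcal F^Z)$; $X^B,X^S$ are $\mathcal F^I$-adapted increasing point processes with jump size $\delta$, null at $0$, with $\mathbb E X^B_1,\mathbb E X^S_1<\infty$; their $\mathcal F^I$-dual predictable projections are absolutely continuous in time; and $X^B,X^S$ a.s. have no common jumps. Put $Y=Z+X^B-X^S$. Write $X^B=X^{B,B}+X^{B,T}+X^{B,S}$, where $X^{B,T}$ (resp. $X^{B,S}$) collects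 the jumps of $X^B$ at jump times of $Z^B$ (resp. $Z^S$) and $X^{B,B}$ the others; write $X^S=X^{S,S}+X^{S,T}+X^{S,B}$, where $X^{S,T}$ (resp. $X^{S,B}$) collects the jumps of $X^S$ at jump times of $Z^S$ (resp. $Z^B$) and $X^{S,S}$ the others. Under a pricing rule $p$ the profit is $$\begin{aligned}\Pi=&\int_0^1(\tilde v-p(Y_{t-}+\delta,t))\,dX^{B,B}_t+\int_0^1(\tilde v-p(Y_{t-}+2\delta,t))\,dX^{B,T}_t+\int_0^1(\tilde v-p(Y_{t-},t))\,dX^{B,S}_t\\&-\int_0^1(\tilde v-p(Y_{t-}-\delta,t))\,dX^{S,S}_t-\int_0^1(\tilde v-p(Y_{t-}-2\delta,t))\,dX^{S,T}_t-\int_0^1(\tilde v-p(Y_{t-},t))\,dX^{S,B}_t.\end{aligned}$$ An admissible strategy is *optimal when* $\tilde v=x$ ($x\in\{0,1\}$) if it maximises $\mathbb E[\Pi\mid\tilde v=x]$ over all admissible strategies. If the $X^{i,j}$ have $\mathcal F^I$-intensities $\delta\theta^{i,j}$ (nonnegative predictable processes such that $X^{i,j}-\delta\int_0^\cdot\theta^{i,j}_u\,du$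 is an $\mathcal F^I$-martingale), let $J(x,y,t)$ be the conditional expectation given $\{Y_t=y,\ \tilde v=x\}$ of the expression obtained from $\Pi$ by replacing $\tilde v$ by $x$, $\int_0^1$ by $\int_t^1$ and $dX^{i,j}_u$ by $\delta\theta^{i,j}_u\,du$. For $t<1$ the *value function* $V(x,y,t)$ is the supremum of $J(x,y,t)$ over all admissible strategies with intensities for which $\mathbb P(Y_t=y,\tilde v=x)>0$, and $V(x,y,1)=\lim_{t\uparrow1}V(x,y,t)$. For $t=0$ the demand process is started from $y$, that is, $Y=y+Z+X^B-X^S$; for $0<t<1$ the demand process may be started from any fixed point of $\delta\mathbb Z$, in particular from $0$, and the assertion below holds for each of them. Fix $z\in\delta\mathbb Z$, let $P^z(y)=\mathbf 1_{\{y\ge z\}}$, and let $p^z(y,t)=\mathbb E[P^z(Z_1)\mid Z_t=y]$, that is, $p^z(y,t)=\mathbb P(y+Z_1-Z_t\ge z)$. With the convention $\sum_{j=m}^n\alpha_j=-\sum_{j=n}^m\alpha_j$ for $m>n$, put for $y\in\delta\mathbb Z$ $$H(y,1)=\delta\sum_{j=y/\delta}^{(z-\delta)/\delta}\bigl(1-P^z(\delta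 j+\delta)\bigr),\qquad L(y,1)=\delta\sum_{j=z/\delta}^{y/\delta}P^z(\delta j-\delta),$$ $$H(y,t)=H(y,1)+\delta\beta\int_t^1\bigl(p^z(y+\delta,u)-p^z(y,u)\bigr)du,\qquad L(y,t)=L(y,1)+\delta\beta\int_t^1\bigl(p^z(y,u)-p^z(y-\delta,u)\bigr)du.$$ **Proposition.** Suppose that the market maker uses the pricing rule $p^z$. 1. When $\tilde v=1$, an admissible strategy is optimal if and only if, almost surely on $\{\tilde v=1\}$, $Y_1\ge z-\delta$ and $X^{S,S}=X^{S,T}=X^{S,B}=0$. 2. When $\tilde v=0$, an admissible strategy is optimal if and only if, almost surely on $\{\tilde v=0\}$, $Y_1<z+\delta$ and $X^{B,B}=X^{B,T}=X^{B,S}=0$. 3. $V(1,y,t)=H(y,t)$ and $V(0,y,t)=L(y,t)$ for all $(y,t)\in\delta\mathbb Z\times[0,1]$. Moreover, for an admissible strategy with intensities that satisfies the condition in 1 (resp. 2), $J(1,y,t)=H(y,t)$ (resp. $J(0,y,t)=L(y,t)$) for all $y\in\delta\mathbb Z$ and $t\in[0,1)$ such that $\{Y_t=y,\tilde v=1\}$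 (resp. $\{Y_t=y,\tilde v=0\}$) has positive probability. -/

import Mathlib

open MeasureTheory ProbabilityTheory Filter Set
open scoped Topology

namespace GlostenMilgrom

/-! Time is `unitInterval`, i.e. the closed interval `[0, 1]`, with Lebesgue measure. -/

/-! ## Jumps and point processes -/

/-- The jump `x_s - x_{s-}` of a path at time `s` (it is `0` at `s = 0`). -/
noncomputable def jump (x : unitInterval → ℝ) (s : unitInterval) : ℝ :=
  x s - Function.leftLim x s

/-- The path of an increasing point process with jump size `δ`, null at time `0`: `δ` times a
right-continuous counting path that is finite on `[0, 1]` and jumps by one unit at a time. -/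
def IsPointPath (δ : ℝ) (x : unitInterval → ℝ) : Prop :=
  ∃ n : unitInterval → ℕ, n 0 = 0 ∧ Monotone n ∧
    (∀ t, ContinuousWithinAt n (Ici t) t) ∧
    (∀ t, n t ≤ Function.leftLim n t + 1) ∧
    ∀ t, x t = δ * n t

/-- The integral `∫_{(0,1]} f dx` of `f` against a pure jump path `x` with finitely many jumps. -/
noncomputable def jumpIntegral (f x : unitInterval → ℝ) : ℝ :=
  ∑ᶠ s : unitInterval, f s * jump x s

section Processes

variable {Ω : Type*} [mΩ : MeasurableSpace Ω]

/-- A Poisson process with constant intensity `β` on the time interval `[0, 1]`. -/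
structure IsPoissonProcess (N : unitInterval → Ω → ℝ) (β : ℝ) (μ : Measure Ω) : Prop where
  measurable : ∀ t, Measurable (N t)
  path : ∀ ω, IsPointPath 1 (fun t => N t ω)
  indep : HasIndepIncrements N μ
  law : ∀ s t : unitInterval, s ≤ t →
    HasLaw (fun ω => N t ω - N s ω)
      ((poissonMeasure (Real.toNNReal (β * ((t : ℝ) - (s : ℝ))))).map (Nat.cast : ℕ → ℝ)) μ

/-- The sigma-algebra generated by the process `x` up to time `t`. -/
abbrev history (x : unitInterval → Ω → ℝ) (t : unitInterval) : MeasurableSpace Ω :=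
  ⨆ s : unitInterval, ⨆ _ : s ≤ t, MeasurableSpace.comap (x s) inferInstance

/-- The usual conditions: right-continuity, and all null sets are known at time `0`. -/
structure UsualConditions (ℱ : Filtration unitInterval mΩ) (μ : Measure Ω) : Prop where
  rightContinuous : ℱ.IsRightContinuous
  complete : ∀ s : Set Ω, μ s = 0 → MeasurableSet[ℱ 0] s

/-- `A` is the dual predictable projection (the predictable compensator) of the integrable
increasing process `x`. -/
structure IsCompensator (ℱ : Filtration unitInterval mΩ) (μ : Measure Ω)
    (x A : unitInterval → Ω → ℝ) : Prop where
  predictable : IsStronglyPredictable ℱ A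
  path : ∀ᵐ ω ∂μ, A 0 ω = 0 ∧ Monotone (fun t => A t ω) ∧
    ∀ t, ContinuousWithinAt (fun s => A s ω) (Ici t) t
  martingale : Martingale (fun t ω => x t ω - A t ω) ℱ μ

/-- The dual predictable projection of `x` is an absolutely continuous function of time. -/
def HasAbsContCompensator (ℱ : Filtration unitInterval mΩ) (μ : Measure Ω)
    (x : unitInterval → Ω → ℝ) : Prop :=
  ∃ A : unitInterval → Ω → ℝ, IsCompensator ℱ μ x A ∧
    ∀ᵐ ω ∂μ, AbsolutelyContinuousOnInterval
      (fun r : ℝ => A (Set.projIcc 0 1 zero_le_one r) ω) 0 1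

/-- The process `x` has intensity `δ θ`: `θ` is nonnegative, predictable, integrable along paths,
and `x - δ ∫ θ du` is a martingale. -/
structure IsIntensity (ℱ : Filtration unitInterval mΩ) (μ : Measure Ω) (δ : ℝ)
    (x θ : unitInterval → Ω → ℝ) : Prop where
  predictable : IsStronglyPredictable ℱ θ
  nonneg : ∀ t ω, 0 ≤ θ t ω
  integrable : ∀ᵐ ω ∂μ, Integrable (fun u => θ u ω) volume
  martingale : Martingale (fun t ω => x t ω - δ * ∫ u in Iic t, θ u ω) ℱ μ

/-! ## The market -/

/-- The exogenous data of the market: order size `δ`, fundamental value `v ∈ {0, 1}` that is really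
random, cumulative noise buy and sell orders `ZB`, `ZS` such that `ZB / δ` and `ZS / δ` are
independent Poisson processes with intensity `β`, jointly independent of `v`. -/
structure Market (Ω : Type*) [MeasurableSpace Ω] (μ : Measure Ω) where
  δ : ℝ
  β : ℝ
  v : Ω → ℝ
  ZB : unitInterval → Ω → ℝ
  ZS : unitInterval → Ω → ℝ
  δ_pos : 0 < δ
  β_pos : 0 < β
  v_measurable : Measurable v
  v_values : ∀ ω, v ω = 0 ∨ v ω = 1
  v_random : 0 < μ {ω | v ω = 0} ∧ μ {ω | v ω = 0} < 1
  ZB_poisson : IsPoissonProcess (fun t ω => ZB t ω / δ) β μ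
  ZS_poisson : IsPoissonProcess (fun t ω => ZS t ω / δ) β μ
  noise_indep : IndepFun (fun ω t => ZB t ω) (fun ω t => ZS t ω) μ
  v_indep : IndepFun v (fun ω => ((fun t => ZB t ω), (fun t => ZS t ω))) μ

/-- The strategy `(X^B, X^S; F^I)` of the insider: cumulative buy orders, cumulative sell orders,
and the filtration of the insider. -/
structure Strategy (Ω : Type*) [mΩ : MeasurableSpace Ω] where
  XB : unitInterval → Ω → ℝ
  XS : unitInterval → Ω → ℝ
  FI : Filtration unitInterval mΩ

/-- The six kinds of insider orders `X^{i,j}`. The first letter says whether the insider buys (`B`)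
or sells (`S`). The second letter, for a buy order: `B` arrives alone, `T` arrives together with a
noise buy order, `S` cancels a noise sell order. For a sell order: `S` arrives alone, `T` arrives
together with a noise sell order, `B` cancels a noise buy order. -/
inductive OrderKind
  | BB | BT | BS | SS | ST | SB

namespace Market

variable {μ : Measure Ω} (M : Market Ω μ)

/-- The net order flow of the noise traders. -/
def Z (t : unitInterval) (ω : Ω) : ℝ := M.ZB t ω - M.ZS t ω

/-- The total demand `Y = y₀ + Z + X^B - X^S`. In the market `y₀ = 0`; another initial demand `y₀`
is needed only to speak of the state `Y_0 = y` in the value function. -/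
def Y (S : Strategy Ω) (y₀ : ℝ) (t : unitInterval) (ω : Ω) : ℝ :=
  y₀ + M.Z t ω + S.XB t ω - S.XS t ω

/-- Admissible strategies. -/
structure Admissible (S : Strategy Ω) : Prop where
  usual : UsualConditions S.FI μ
  information : ∃ ℋ : Filtration unitInterval mΩ,
    Indep (ℋ 1) (MeasurableSpace.comap M.v inferInstance ⊔ history M.Z 1) μ ∧
    ∀ t, (S.FI t : MeasurableSpace Ω) =
      MeasurableSpace.comap M.v inferInstance ⊔ history M.Z t ⊔ ℋ t
  buy_adapted : Adapted S.FI S.XB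
  sell_adapted : Adapted S.FI S.XS
  buy_path : ∀ ω, IsPointPath M.δ (fun t => S.XB t ω)
  sell_path : ∀ ω, IsPointPath M.δ (fun t => S.XS t ω)
  buy_integrable : Integrable (S.XB 1) μ
  sell_integrable : Integrable (S.XS 1) μ
  buy_compensator : HasAbsContCompensator S.FI μ S.XB
  sell_compensator : HasAbsContCompensator S.FI μ S.XS
  /-- The insider never places two opposite orders at the same time. -/
  no_opposite : ∀ᵐ ω ∂μ, ∀ s : unitInterval,
    jump (fun t => S.XB t ω) s = 0 ∨ jump (fun t => S.XS t ω) s = 0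

open Classical in
/-- The jump at time `s` of the component `X^{i,j}` of the insider's orders. -/
noncomputable def compJump (S : Strategy Ω) (c : OrderKind) (s : unitInterval) (ω : Ω) : ℝ :=
  let b := jump (fun t => M.ZB t ω) s
  let a := jump (fun t => M.ZS t ω) s
  match c with
  | .BB => if b = 0 ∧ a = 0 then jump (fun t => S.XB t ω) s else 0
  | .BT => if b ≠ 0 then jump (fun t => S.XB t ω) s else 0
  | .BS => if a ≠ 0 then jump (fun t => S.XB t ω) s else 0
  | .SS => if b = 0 ∧ a = 0 then jump (fun t => S.XS t ω) s else 0
  | .ST => if a ≠ 0 then jump (fun t => S.XS t ω) s else 0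
  | .SB => if b ≠ 0 then jump (fun t => S.XS t ω) s else 0

/-- The component `X^{i,j}` of the insider's orders: the sum of its jumps up to time `t`. -/
noncomputable def comp (S : Strategy Ω) (c : OrderKind) (t : unitInterval) (ω : Ω) : ℝ :=
  ∑ᶠ s : Iic t, M.compJump S c s ω

/-- The gain per share of an order of kind `c` executed at time `u`, for the fundamental value `x`
and the pricing rule `p`, when the total demand just before `u` is `y`: `x - p` at the demand after
the order for buy orders, and the opposite for sell orders. -/
def unitGain (p : ℝ → unitInterval → ℝ) (x : ℝ) (c : OrderKind) (y : ℝ) (u : unitInterval) : ℝ :=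
  match c with
  | .BB => x - p (y + M.δ) u
  | .BT => x - p (y + 2 * M.δ) u
  | .BS => x - p y u
  | .SS => -(x - p (y - M.δ) u)
  | .ST => -(x - p (y - 2 * M.δ) u)
  | .SB => -(x - p y u)

/-- The total demand `Y_{u-}` just before time `u`. -/
noncomputable def Yleft (S : Strategy Ω) (y₀ : ℝ) (u : unitInterval) (ω : Ω) : ℝ :=
  Function.leftLim (fun t => M.Y S y₀ t ω) u

/-- The integral, over `(0, 1]`, of the gains from the orders of kind `c`. -/
noncomputable def gainFrom (p : ℝ → unitInterval → ℝ) (S : Strategy Ω) (c : OrderKind) (ω : Ω) :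
    ℝ :=
  jumpIntegral (fun u => M.unitGain p (M.v ω) c (M.Yleft S 0 u ω) u) (fun t => M.comp S c t ω)

/-- The profit of the insider at time `1` under the pricing rule `p`. -/
noncomputable def profit (p : ℝ → unitInterval → ℝ) (S : Strategy Ω) (ω : Ω) : ℝ :=
  M.gainFrom p S .BB ω + M.gainFrom p S .BT ω + M.gainFrom p S .BS ω +
    M.gainFrom p S .SS ω + M.gainFrom p S .ST ω + M.gainFrom p S .SB ω

/-- The expected profit given `v = x`. -/
noncomputable def expectedProfit (p : ℝ → unitInterval → ℝ) (x : ℝ) (S : Strategy Ω) : ℝ :=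
  ∫ ω, M.profit p S ω ∂(cond μ {ω | M.v ω = x})

/-- `S` is an optimal strategy for the insider of type `x`: it is admissible and maximises the
expected profit given `v = x` among all admissible strategies. -/
def IsOptimal (p : ℝ → unitInterval → ℝ) (x : ℝ) (S : Strategy Ω) : Prop :=
  M.Admissible S ∧
    ∀ S' : Strategy Ω, M.Admissible S' → M.expectedProfit p x S' ≤ M.expectedProfit p x S

/-! ## The value function -/

/-- `θ` is the family of intensities `θ^{i,j}` of the components `X^{i,j}` of `S`, the order size
being normalised to one. -/
def HasIntensities (S : Strategy Ω) (θ : OrderKind → unitInterval → Ω → ℝ) : Prop :=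
  ∀ c, IsIntensity S.FI μ M.δ (M.comp S c) (θ c)

/-- The event that `Y_t = y` and `v = x`. -/
def state (S : Strategy Ω) (y₀ : ℝ) (x y : ℝ) (t : unitInterval) : Set Ω :=
  {ω | M.Y S y₀ t ω = y ∧ M.v ω = x}

/-- The expected profit on `(t, 1]` of the insider of type `x` given `Y_t = y` and `v = x`, written
with the intensities of her orders. -/
noncomputable def remainingProfit (p : ℝ → unitInterval → ℝ) (S : Strategy Ω)
    (θ : OrderKind → unitInterval → Ω → ℝ) (y₀ x y : ℝ) (t : unitInterval) : ℝ :=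
  let g : OrderKind → unitInterval → Ω → ℝ :=
    fun c u ω => M.unitGain p x c (M.Yleft S y₀ u ω) u * θ c u ω
  M.δ * ∫ ω, ((∫ u in Ioc t 1, g .BB u ω) + (∫ u in Ioc t 1, g .BT u ω) +
      (∫ u in Ioc t 1, g .BS u ω) + (∫ u in Ioc t 1, g .SS u ω) +
      (∫ u in Ioc t 1, g .ST u ω) + (∫ u in Ioc t 1, g .SB u ω))
    ∂(cond μ (M.state S y₀ x y t))

/-- All values of `remainingProfit` that admissible strategies reaching the state `(y, t)` with
positive probability can produce. -/
def remainingProfits (p : ℝ → unitInterval → ℝ) (y₀ x y : ℝ) (t : unitInterval) : Set ℝ :=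
  {J | ∃ (S : Strategy Ω) (θ : OrderKind → unitInterval → Ω → ℝ),
    M.Admissible S ∧ M.HasIntensities S θ ∧ μ (M.state S y₀ x y t) ≠ 0 ∧
    J = M.remainingProfit p S θ y₀ x y t}

/-- `V k t` is the value function of the insider of type `x` at `(y, t) = (δ k, t)`: for `t < 1` it
is the supremum of the expected remaining profits, and at `t = 1` it is the left limit. For
`0 < t < 1` the initial demand `δ k₀` may be any point of the lattice, in particular `0`; for
`t = 0` it has to be `y` itself. -/
def IsValueFunction (p : ℝ → unitInterval → ℝ) (x : ℝ) (V : ℤ → unitInterval → ℝ) : Prop :=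
  ∀ k : ℤ,
    (∀ (k₀ : ℤ) (t : unitInterval), t < 1 → (t = 0 → k₀ = k) →
      IsLUB (M.remainingProfits p (M.δ * k₀) x (M.δ * k) t) (V k t)) ∧
    Tendsto (V k) (𝓝[<] 1) (𝓝 (V k 1))

/-! ## The pricing rule `p^z` and the functions `H` and `L` -/

/-- The terminal function `P^z`. -/
noncomputable def P (z y : ℝ) : ℝ := if y < z then 0 else 1

/-- `p^z(y, t) = E[P^z(Z_1) | Z_t = y]`, read, as always for a Markov process, through the transition
probabilities of `Z`: the process started from `y` at time `t` is at `y + (Z_1 - Z_t)` at time `1`.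
(This is meaningful for every `y`, even if `Z_t = y` has probability zero.) -/
noncomputable def pz (z y : ℝ) (t : unitInterval) : ℝ :=
  ∫ ω, P z (y + (M.Z 1 ω - M.Z t ω)) ∂μ

/-- `∑_{j=m}^n α_j`, with the convention `∑_{j=m}^n α_j = - ∑_{j=n}^m α_j` whenever `m > n`. -/
noncomputable def signedSum (m n : ℤ) (α : ℤ → ℝ) : ℝ :=
  if m ≤ n then ∑ j ∈ Finset.Icc m n, α j else -∑ j ∈ Finset.Icc n m, α j

/-- `H(y, t)` at `y = δ k`, for the threshold `z = δ m`. -/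
noncomputable def H (m k : ℤ) (t : unitInterval) : ℝ :=
  M.δ * signedSum k (m - 1) (fun j => 1 - P (M.δ * m) (M.δ * j + M.δ)) +
    M.δ * M.β * ∫ u in Ioc t 1,
      (M.pz (M.δ * m) (M.δ * k + M.δ) u - M.pz (M.δ * m) (M.δ * k) u)

/-- `L(y, t)` at `y = δ k`, for the threshold `z = δ m`. -/
noncomputable def L (m k : ℤ) (t : unitInterval) : ℝ :=
  M.δ * signedSum m k (fun j => P (M.δ * m) (M.δ * j - M.δ)) +
    M.δ * M.β * ∫ u in Ioc t 1,
      (M.pz (M.δ * m) (M.δ * k) u - M.pz (M.δ * m) (M.δ * k - M.δ) u)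

/-! ## The two conditions -/

/-- On `v = 1`, almost surely `Y_1 ≥ z - δ` and all sell components vanish. -/
def HighCondition (z : ℝ) (S : Strategy Ω) : Prop :=
  ∀ᵐ ω ∂μ, M.v ω = 1 → z - M.δ ≤ M.Y S 0 1 ω ∧
    ∀ t, M.comp S .SS t ω = 0 ∧ M.comp S .ST t ω = 0 ∧ M.comp S .SB t ω = 0

/-- On `v = 0`, almost surely `Y_1 < z + δ` and all buy components vanish. -/
def LowCondition (z : ℝ) (S : Strategy Ω) : Prop :=
  ∀ᵐ ω ∂μ, M.v ω = 0 → M.Y S 0 1 ω < z + M.δ ∧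
    ∀ t, M.comp S .BB t ω = 0 ∧ M.comp S .BT t ω = 0 ∧ M.comp S .BS t ω = 0

end Market

end Processes

end GlostenMilgrom

namespace GlostenMilgrom
/-- Independence of coordinates taken from two independent pairs of independent variables. -/
lemma indep_pairs {Ω : Type*} [MeasurableSpace Ω] {μ : Measure Ω} [IsZeroOrProbabilityMeasure μ] {a b c d : Ω → ℝ}
    (ha : Measurable a) (hb : Measurable b) (hc : Measurable c) (hd : Measurable d)
    (hab : IndepFun a b μ) (hcd : IndepFun c d μ)
    (h : IndepFun (fun ω => (a ω, b ω)) (fun ω => (c ω, d ω)) μ) :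
    IndepFun (fun ω => (a ω, c ω)) (fun ω => (b ω, d ω)) μ := by
  have key : ∀ f : Ω → ℝ × ℝ, MeasurableSpace.comap f inferInstance =
      MeasurableSpace.generateFrom ((fun s => f ⁻¹' s) '' (image2 (· ×ˢ ·)
        { s : Set ℝ | MeasurableSet s } { t : Set ℝ | MeasurableSet t })) := by
    intro f
    rw [← generateFrom_prod, MeasurableSpace.comap_generateFrom]
  have hpi : ∀ f : Ω → ℝ × ℝ, IsPiSystem ((fun s => f ⁻¹' s) '' (image2 (· ×ˢ ·)
        { s : Set ℝ | MeasurableSet s } { t : Set ℝ | MeasurableSet t })) := by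
    intro f
    exact isPiSystem_prod.comap f
  refine IndepSets.indep (ha.prodMk hc).comap_le (hb.prodMk hd).comap_le (hpi _) (hpi _) (key _) (key _) ?_
  rw [IndepSets_iff]
  rintro _ _ ⟨_, ⟨s, hs, s', hs', rfl⟩, rfl⟩ ⟨_, ⟨t, ht, t', ht', rfl⟩, rfl⟩
  simp only [mem_ofPred_eq] at hs hs' ht ht'
  have h1 := h.measure_inter_preimage_eq_mul (s ×ˢ t) (s' ×ˢ t') (hs.prod ht) (hs'.prod ht')
  have h2 := h.measure_inter_preimage_eq_mul (s ×ˢ univ) (s' ×ˢ univ) (hs.prod .univ) (hs'.prod .univ)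
  have h3 := h.measure_inter_preimage_eq_mul (univ ×ˢ t) (univ ×ˢ t') (MeasurableSet.univ.prod ht) (MeasurableSet.univ.prod ht')
  have h4 := hab.measure_inter_preimage_eq_mul s t hs ht
  have h5 := hcd.measure_inter_preimage_eq_mul s' t' hs' ht'
  simp only [mk_preimage_prod, preimage_univ, inter_univ, univ_inter] at h1 h2 h3 h4 h5 ⊢
  rw [show a ⁻¹' s ∩ c ⁻¹' s' ∩ (b ⁻¹' t ∩ d ⁻¹' t') = a ⁻¹' s ∩ b ⁻¹' t ∩ (c ⁻¹' s' ∩ d ⁻¹' t') by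
    ext; simp; tauto, h1, h2, h3, h4, h5]
  ring

namespace Market
variable {Ω : Type*} [mΩ : MeasurableSpace Ω] {μ : Measure Ω} (M : Market Ω μ)

/-- Wherever the event `Z_t = y` has positive probability, `p^z(y, t)` is the elementary conditional
expectation of `P^z(Z_1)` given that event. -/
lemma pz_eq_cond [IsProbabilityMeasure μ] (z y : ℝ) (t : unitInterval)
    (h : μ {ω | M.Z t ω = y} ≠ 0) :
    ∫ ω, P z (M.Z 1 ω) ∂(cond μ {ω | M.Z t ω = y}) = M.pz z y t := by
  have mB : ∀ t, Measurable (M.ZB t) := fun t => by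
    simpa [div_mul_cancel₀, M.δ_pos.ne'] using (M.ZB_poisson.measurable t).mul_const M.δ
  have mS : ∀ t, Measurable (M.ZS t) := fun t => by
    simpa [div_mul_cancel₀, M.δ_pos.ne'] using (M.ZS_poisson.measurable t).mul_const M.δ
  have iB : IndepFun (M.ZB t) (fun ω => M.ZB 1 ω - M.ZB t ω) μ := by
    have := M.ZB_poisson.indep.indepFun_eval_sub (r := 0) (s := t) (t := 1) t.2.1 t.2.2
      (.of_forall fun ω => by
        obtain ⟨n, h0, -, -, -, h1⟩ := M.ZB_poisson.path ω
        simp [h1 0, h0])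
    have := this.comp (measurable_id.const_mul M.δ) (measurable_id.const_mul M.δ)
    convert this using 1 <;> funext ω <;> simp <;> field_simp [M.δ_pos.ne']
  have iS : IndepFun (M.ZS t) (fun ω => M.ZS 1 ω - M.ZS t ω) μ := by
    have := M.ZS_poisson.indep.indepFun_eval_sub (r := 0) (s := t) (t := 1) t.2.1 t.2.2
      (.of_forall fun ω => by
        obtain ⟨n, h0, -, -, -, h1⟩ := M.ZS_poisson.path ω
        simp [h1 0, h0])
    have := this.comp (measurable_id.const_mul M.δ) (measurable_id.const_mul M.δ)
    convert this using 1 <;> funext ω <;> simp <;> field_simp [M.δ_pos.ne']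
  have m1 : Measurable (fun x : unitInterval → ℝ => (x t, x 1 - x t)) := by fun_prop
  have i4 := indep_pairs (mB t) ((mB 1).sub (mB t)) (mS t) ((mS 1).sub (mS t)) iB iS
    (M.noise_indep.comp m1 m1)
  have m2 : Measurable (fun x : ℝ × ℝ => x.1 - x.2) := by fun_prop
  have i2 := i4.comp m2 m2
  have mP : Measurable (P z) := Measurable.ite measurableSet_Iio measurable_const measurable_const
  have m3 : Measurable (Set.indicator {y} (fun _ : ℝ => (1 : ℝ))) :=
    measurable_const.indicator (measurableSet_singleton y)
  have i5 := i2.comp (φ := fun x => Set.indicator {y} (fun _ => (1 : ℝ)) x)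
    (ψ := fun x => P z (y + x)) m3
    (mP.comp (measurable_const.add measurable_id))
  have mZ : MeasurableSet {ω | M.Z t ω = y} := ((mB t).sub (mS t)) (measurableSet_singleton y)
  have e := i5.integral_fun_mul_eq_mul_integral
    (Measurable.aestronglyMeasurable (m3.comp
      (m2.comp ((mB t).prodMk (mS t)))))
    (Measurable.aestronglyMeasurable ((mP.comp (measurable_const.add measurable_id)).comp
      (m2.comp (((mB 1).sub (mB t)).prodMk ((mS 1).sub (mS t))))))
  have l : ∫ ω, P z (M.Z 1 ω) ∂(cond μ {ω | M.Z t ω = y}) =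
      (μ.real {ω | M.Z t ω = y})⁻¹ * ∫ ω in {ω | M.Z t ω = y}, P z (M.Z 1 ω) ∂μ := by
    rw [ProbabilityTheory.cond, integral_smul_measure]; simp [Measure.real]
  rw [l, ← integral_indicator mZ, inv_mul_eq_iff_eq_mul₀ (by simpa [Measure.real, ENNReal.toReal_eq_zero_iff] using h)]
  have q1 : ∫ ω, ((fun x => Set.indicator {y} (fun _ => (1 : ℝ)) x) ∘ ((fun x : ℝ × ℝ => x.1 - x.2) ∘ fun ω => (M.ZB t ω, M.ZS t ω))) ω ∂μ = μ.real {ω | M.Z t ω = y} := by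
    rw [← integral_indicator_one mZ]; rfl
  rw [q1] at e
  convert e using 1
  · congr 1; funext ω
    by_cases hω : M.Z t ω = y
    · have : M.ZB t ω - M.ZS t ω = y := hω
      simp [this, Z]; congr 1; linarith
    · have : ¬ M.ZB t ω - M.ZS t ω = y := hω
      simp [hω, this]
  · congr 1
    unfold pz; congr 1; funext ω; simp [Z]; congr 1; ring
end Market
end GlostenMilgrom

/-!
The insider of type `1` gains `1 - p` on each lot she buys, and under `p^z` the quantity
`δ (1 - p^z(y + δ, t))` is exactly the amount by which one lot lowers the *expected shortfall*
`h(y, t) = E[(z - δ - y - (Z_1 - Z_t))^+]` of the terminal demand below `z - δ` (`shortfall`,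
`shortfall_add_sub`). Without insider orders `h(Y_t, t)` is a martingale (`shortfall_eq_integral`),
so its expected change is due to her orders alone. A sale pays her only the price `p^z(Y_s, s)`,
whereas the shortfall accounts for it at the price `p^z(Y_s + δ, s)` at which the lot would be bought
back. Hence the verification identity (`Admissible.setIntegral_gain`)

  expected gains after `t` = `E[h(Y_t, t)] - E[h(Y_1, 1)] - E[loss from sales]`

on every event known at time `t`. It needs no stochastic calculus: `[t, 1]` is cut into a regular
grid, the insider's filtration at a grid point is independent of the later noise increments, and in
a fine grid a cell contains at most one insider order, so that the sums over the cells converge by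
dominated convergence. Both losses are nonnegative, and `h(y, 1) = (z - δ - y)^+`. The loss from a
sale before time `1` is strictly positive because the price strictly increases with the demand
(`pz_lt_pz_add`), and orders at time `1` are excluded because the compensator is absolutely
continuous (`Admissible.one_notMem_sellTimes`). So the bound `h(0, 0)` is attained exactly under the
condition `Y_1 ≥ z - δ` and no sales (`Admissible.expectedProfit_one_eq_iff`).

The function `h` is `H` on the lattice (`H_eq_shortfall`): both agree at time `1`, and a Poisson
estimate of second order shows that `∂h/∂t = -β (h(y + δ, t) + h(y - δ, t) - 2 h(y, t))`, which is
`-δ β` times a difference of prices. The expression `J` with intensities satisfies the same identity,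
since each order component minus its integrated intensity is a martingale
(`Admissible.setIntegral_kindSum`, `Admissible.remainingProfit_one`).

It remains to see that the bound is a supremum, for optimality and for the value function. For this
it is enough to come arbitrarily close, by buying many lots after time `t` and never selling. The uniform random variable supplies independent exponential clocks
(`exists_isClockFamily`); on a grid of `[t, 1]` one clock runs in each cell, and the insider buys
when it rings (`clockStrategy`). The rate of a clock until it rings is the intensity of her orders,
and the sigma-algebras of the completed observations are right-continuous because every observation
is eventually constant to the right of each time. Almost surely no clock rings at the time of a noise
order, so all these orders arrive alone. With fast clocks the terminal shortfall tends to zero in mean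
(`exists_small_shortfall`).

The type `0` is the type `1` of the reflected market in which `v` is replaced by `1 - v`, buying and
selling are exchanged, and demand changes sign (`Market.reflect`): there the threshold is `δ - z`,
the price at `-y` is one minus the price at `y` (`reflectedPrices_pz`), and the function `H` at `-y`
is `L` at `y` (`L_eq_reflect_H`).
-/

namespace GlostenMilgrom

/-! ### Counting paths and their jumps -/

/-- The number of points of `J` in `[0, t]`. -/
noncomputable def count (J : Finset unitInterval) (t : unitInterval) : ℝ :=
  ((J.filter (· ≤ t)).card : ℝ)

/-- The number of points of `J` in `[0, t)`. -/
noncomputable def countLeft (J : Finset unitInterval) (t : unitInterval) : ℝ :=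
  ((J.filter (· < t)).card : ℝ)

lemma count_eq_sum (J : Finset unitInterval) (t : unitInterval) :
    count J t = ∑ s ∈ J, if s ≤ t then 1 else 0 := by
  simp [count]

lemma countLeft_eq_sum (J : Finset unitInterval) (t : unitInterval) :
    countLeft J t = ∑ s ∈ J, if s < t then 1 else 0 := by
  simp [countLeft]

lemma count_eq_countLeft_add (J : Finset unitInterval) (t : unitInterval) :
    count J t = countLeft J t + if t ∈ J then 1 else 0 := by
  rw [count_eq_sum, countLeft_eq_sum, ← Finset.sum_ite_eq J t (fun _ => (1 : ℝ)),
    ← Finset.sum_add_distrib]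
  refine Finset.sum_congr rfl fun s _ => ?_
  rcases lt_trichotomy s t with h | h | h
  · simp [h, h.le, h.ne']
  · simp [h]
  · simp [h.not_ge, h.not_gt, h.ne]

lemma count_mono (J : Finset unitInterval) : Monotone (count J) := by
  intro s t hst
  simp only [count]
  exact_mod_cast Finset.card_le_card
    (Finset.monotone_filter_right J fun a _ (ha : a ≤ s) => ha.trans hst)

lemma count_nonneg (J : Finset unitInterval) (t : unitInterval) : 0 ≤ count J t :=
  Nat.cast_nonneg _

lemma count_one (J : Finset unitInterval) : count J 1 = J.card := by
  simp [count, Finset.filter_true_of_mem fun s _ => unitInterval.le_one' (t := s)]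

lemma count_eventuallyEq_right (J : Finset unitInterval) (s : unitInterval) :
    ∀ᶠ t in 𝓝[≥] s, count J t = count J s := by
  have h : ∀ᶠ t in 𝓝[≥] s, ∀ j ∈ J, (j ≤ t ↔ j ≤ s) := by
    rw [Filter.eventually_all_finset]
    intro j _
    rcases le_or_gt j s with hj | hj
    · filter_upwards [self_mem_nhdsWithin] with t ht
      exact ⟨fun _ => hj, fun _ => hj.trans ht⟩
    · filter_upwards [mem_nhdsWithin_of_mem_nhds (Iio_mem_nhds hj)] with t ht
      exact ⟨fun h => absurd h (not_le.2 ht), fun h => absurd h (not_le.2 hj)⟩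
  filter_upwards [h] with t ht
  rw [count, count, Finset.filter_congr ht]

lemma count_eventuallyEq_left (J : Finset unitInterval) (s : unitInterval) :
    ∀ᶠ t in 𝓝[<] s, count J t = countLeft J s := by
  have h : ∀ᶠ t in 𝓝[<] s, ∀ j ∈ J, (j ≤ t ↔ j < s) := by
    rw [Filter.eventually_all_finset]
    intro j _
    rcases lt_or_ge j s with hj | hj
    · filter_upwards [mem_nhdsWithin_of_mem_nhds (Ioi_mem_nhds hj)] with t ht
      exact ⟨fun _ => hj, fun _ => le_of_lt ht⟩
    · filter_upwards [self_mem_nhdsWithin] with t (ht : t < s)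
      exact ⟨fun h => absurd (ht.trans_le hj) (not_lt.2 h), fun h => absurd h (not_lt.2 hj)⟩
  filter_upwards [h] with t ht
  rw [count, countLeft, Finset.filter_congr ht]

lemma nhdsLT_neBot_of_pos {s : unitInterval} (hs : 0 < s) : (𝓝[<] s).NeBot :=
  nhdsLT_neBot_of_exists_lt ⟨0, hs⟩

/-- The left limit of a path that is eventually constant to the left of `s > 0`. -/
lemma leftLim_eq_of_eventually {x : unitInterval → ℝ} {s : unitInterval} (hs : 0 < s) {l : ℝ}
    (h : ∀ᶠ t in 𝓝[<] s, x t = l) : Function.leftLim x s = l := by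
  have := nhdsLT_neBot_of_pos hs
  exact leftLim_eq_of_tendsto (tendsto_const_nhds.congr' (h.mono fun t ht => ht.symm))

lemma leftLim_zero (x : unitInterval → ℝ) : Function.leftLim x 0 = x 0 :=
  leftLim_eq_of_isBot fun _ => unitInterval.nonneg'

lemma jump_count (δ : ℝ) {J : Finset unitInterval} (hJ : 0 ∉ J) (s : unitInterval) :
    jump (fun t => δ * count J t) s = if s ∈ J then δ else 0 := by
  rcases (unitInterval.nonneg' (t := s)).eq_or_lt with h | h
  · subst h; simp [jump, leftLim_zero, hJ]
  · rw [jump, leftLim_eq_of_eventually (l := δ * countLeft J s) h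
      ((count_eventuallyEq_left J s).mono fun t ht => by rw [ht]), count_eq_countLeft_add]
    split_ifs <;> ring

lemma jumpIntegral_count (δ : ℝ) {J : Finset unitInterval} (hJ : 0 ∉ J)
    (f : unitInterval → ℝ) :
    jumpIntegral f (fun t => δ * count J t) = ∑ s ∈ J, f s * δ := by
  simp only [jumpIntegral, jump_count δ hJ]
  rw [finsum_eq_sum_of_support_subset (s := J)]
  · exact Finset.sum_congr rfl fun s hs => by simp [hs]
  · intro s hs
    by_contra h
    simp only [Finset.mem_coe] at h
    simp [h] at hs

/-- A point path is `δ` times the counting function of a finite set of jump times. -/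
lemma IsPointPath.exists_count {δ : ℝ} {x : unitInterval → ℝ} (hx : IsPointPath δ x) :
    ∃ J : Finset unitInterval, 0 ∉ J ∧ ∀ t, x t = δ * count J t := by
  obtain ⟨n, h0, hmono, hrc, hjump, hxn⟩ := hx
  -- `τ k` is the first time at which the counting path reaches `k`
  let τ : ℕ → unitInterval := fun k => sInf {t | k ≤ n t}
  have hglb : ∀ k, IsGLB {t | k ≤ n t} (τ k) := fun k => isGLB_sInf _
  have hτ : ∀ k, k ≤ n 1 → k ≤ n (τ k) := by
    intro k hk
    by_contra hlt
    have h1 : ∀ᶠ t in 𝓝[≥] (τ k), n t < k := by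
      have := hrc (τ k)
      exact this.eventually (Iio_mem_nhds (not_le.1 hlt))
    obtain ⟨t, ht1, ht2⟩ := (((hglb k).frequently_mem ⟨1, hk⟩).and_eventually h1).exists
    exact absurd ht2 (not_lt.2 ht1)
  have hiff : ∀ k, k ≤ n 1 → ∀ t, τ k ≤ t ↔ k ≤ n t := fun k hk t =>
    ⟨fun h => (hτ k hk).trans (hmono h), fun h => (hglb k).1 h⟩
  have hpos : ∀ k, 1 ≤ k → k ≤ n 1 → 0 < τ k := by
    intro k hk1 hk
    refine lt_of_le_of_ne unitInterval.nonneg' fun h => ?_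
    have := hτ k hk
    rw [← h, h0] at this
    omega
  have hle : ∀ k, 1 ≤ k → k ≤ n 1 → n (τ k) ≤ k := by
    intro k hk1 hk
    have hne := nhdsLT_neBot_of_pos (hpos k hk1 hk)
    have hl : Function.leftLim n (τ k) ≤ k - 1 := by
      refine le_of_tendsto (hmono.tendsto_leftLim (τ k)) ?_
      filter_upwards [self_mem_nhdsWithin] with t (ht : t < τ k)
      have : ¬ k ≤ n t := fun h => absurd ((hiff k hk t).2 h) (not_le.2 ht)
      omega
    have := hjump (τ k)
    omega
  have hinj : Set.InjOn τ (Finset.Icc 1 (n 1) : Finset ℕ) := by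
    intro k hk l hl hkl
    simp only [Finset.coe_Icc, Set.mem_Icc] at hk hl
    have a := le_antisymm (hle k hk.1 hk.2) (hτ k hk.2)
    have b := le_antisymm (hle l hl.1 hl.2) (hτ l hl.2)
    rw [← a, ← b, hkl]
  refine ⟨(Finset.Icc 1 (n 1)).image τ, ?_, fun t => ?_⟩
  · simp only [Finset.mem_image, Finset.mem_Icc, not_exists, not_and]
    intro k hk h
    exact (hpos k hk.1 hk.2).ne' h
  · rw [hxn, count, Finset.filter_image, Finset.card_image_of_injOn
      (hinj.mono (by intro k hk; simp at hk ⊢; tauto))]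
    have : (Finset.Icc 1 (n 1)).filter (fun k => τ k ≤ t) = Finset.Icc 1 (n t) := by
      ext k
      simp only [Finset.mem_filter, Finset.mem_Icc]
      constructor
      · rintro ⟨⟨a, b⟩, c⟩
        exact ⟨a, (hiff k b t).1 c⟩
      · rintro ⟨a, b⟩
        have hk : k ≤ n 1 := b.trans (hmono unitInterval.le_one')
        exact ⟨⟨a, hk⟩, (hiff k hk t).2 b⟩
    rw [this]
    simp

lemma isPointPath_count (δ : ℝ) {J : Finset unitInterval} (hJ : 0 ∉ J) :
    IsPointPath δ (fun t => δ * count J t) := by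
  refine ⟨fun t => (J.filter (· ≤ t)).card, ?_, ?_, ?_, ?_, fun t => rfl⟩
  · rw [Finset.card_eq_zero, Finset.filter_eq_empty_iff]
    intro s hs h
    exact hJ (le_antisymm h unitInterval.nonneg' ▸ hs)
  · intro s t hst
    have := count_mono J hst
    simp only [count, Nat.cast_le] at this
    exact this
  · intro s
    refine tendsto_const_nhds.congr' ?_
    filter_upwards [count_eventuallyEq_right J s] with t ht
    simp only [count, Nat.cast_inj] at ht
    exact ht.symm
  · intro s
    rcases (unitInterval.nonneg' (t := s)).eq_or_lt with h | h
    · subst h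
      rw [leftLim_eq_of_isBot fun t => unitInterval.nonneg']
      exact Nat.le_succ _
    · have := nhdsLT_neBot_of_pos h
      have e : Function.leftLim (fun t => (J.filter (· ≤ t)).card) s = (J.filter (· < s)).card := by
        refine leftLim_eq_of_tendsto (tendsto_const_nhds.congr' ?_)
        filter_upwards [count_eventuallyEq_left J s] with t ht
        simp only [count, countLeft, Nat.cast_inj] at ht
        exact ht.symm
      rw [e]
      have := count_eq_countLeft_add J s
      simp only [count, countLeft] at this
      split_ifs at this
      · exact le_of_eq (by exact_mod_cast this)
      · have : (J.filter (· ≤ s)).card = (J.filter (· < s)).card := by simpa using this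
        exact this.le.trans (Nat.le_succ _)

/-! ### Grids of times -/

/-- The `i`-th point of the regular grid that cuts `[t₀, 1]` into `n + 1` intervals. -/
noncomputable def grid (t₀ : unitInterval) (n i : ℕ) : unitInterval :=
  Set.projIcc 0 1 zero_le_one ((t₀ : ℝ) + (1 - t₀) * (i / (n + 1)))

lemma grid_zero (t₀ : unitInterval) (n : ℕ) : grid t₀ n 0 = t₀ := by
  simp [grid]

lemma grid_mono (t₀ : unitInterval) (n : ℕ) : Monotone (grid t₀ n) := by
  intro i j hij
  refine Set.monotone_projIcc _ ?_
  have : (0 : ℝ) ≤ 1 - t₀ := sub_nonneg.2 t₀.2.2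
  have hij' : (i : ℝ) ≤ j := by exact_mod_cast hij
  gcongr

lemma coe_grid (t₀ : unitInterval) {n i : ℕ} (hi : i ≤ n + 1) :
    (grid t₀ n i : ℝ) = t₀ + (1 - t₀) * (i / (n + 1)) := by
  have h0 : (0 : ℝ) ≤ 1 - t₀ := sub_nonneg.2 t₀.2.2
  have h1 : (i : ℝ) / (n + 1) ≤ 1 := by
    rw [div_le_one (by positivity)]; exact_mod_cast hi
  have h2 : (0 : ℝ) ≤ (i : ℝ) / (n + 1) := by positivity
  have h3 := t₀.2.1
  rw [grid, Set.projIcc_of_mem _ (show _ ∈ Set.Icc (0 : ℝ) 1 from ⟨by positivity, by nlinarith⟩)]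

lemma grid_last (t₀ : unitInterval) (n : ℕ) : grid t₀ n (n + 1) = 1 := by
  apply Subtype.ext
  rw [coe_grid t₀ le_rfl]
  push_cast
  rw [div_self (by positivity)]
  simp

lemma grid_succ_sub (t₀ : unitInterval) {n i : ℕ} (hi : i < n + 1) :
    (grid t₀ n (i + 1) : ℝ) - grid t₀ n i ≤ 1 / (n + 1) := by
  rw [coe_grid t₀ (by omega), coe_grid t₀ (by omega)]
  have h0 := t₀.2.1
  have : (0 : ℝ) ≤ 1 / ((n : ℝ) + 1) := by positivity
  push_cast
  have e : (t₀ : ℝ) + (1 - t₀) * (((i : ℝ) + 1) / (n + 1)) - (t₀ + (1 - t₀) * (i / (n + 1)))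
      = (1 - t₀) * (1 / (n + 1)) := by ring
  rw [e]
  nlinarith

lemma exists_grid_cell {t₀ u : unitInterval} (hu : t₀ < u) (n : ℕ) :
    ∃ i < n + 1, grid t₀ n i < u ∧ u ≤ grid t₀ n (i + 1) := by
  have hex : ∃ j, u ≤ grid t₀ n j := ⟨n + 1, by rw [grid_last]; exact unitInterval.le_one'⟩
  classical
  have h1 := Nat.find_spec hex
  have h2 : Nat.find hex ≤ n + 1 :=
    Nat.find_min' hex (by rw [grid_last]; exact unitInterval.le_one')
  have h3 : Nat.find hex ≠ 0 := by
    intro h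
    rw [h, grid_zero] at h1
    exact absurd hu (not_lt.2 h1)
  obtain ⟨i, hi⟩ := Nat.exists_eq_succ_of_ne_zero h3
  refine ⟨i, by omega, not_le.1 (Nat.find_min hex (by omega)), ?_⟩
  rw [hi] at h1
  exact h1

/-- The step function on `(t₀, 1]` with the value `w i` on the `i`-th cell of the grid. -/
noncomputable def gridStep (t₀ : unitInterval) (n : ℕ) (w : ℕ → ℝ) (u : unitInterval) : ℝ :=
  ∑ i ∈ Finset.range (n + 1), (Ioc (grid t₀ n i) (grid t₀ n (i + 1))).indicator (fun _ => w i) u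

lemma gridStep_of_cell {t₀ u : unitInterval} {n i : ℕ} (w : ℕ → ℝ) (hi : i < n + 1)
    (h1 : grid t₀ n i < u) (h2 : u ≤ grid t₀ n (i + 1)) : gridStep t₀ n w u = w i := by
  rw [gridStep, Finset.sum_eq_single i]
  · rw [Set.indicator_of_mem (show u ∈ Ioc _ _ from ⟨h1, h2⟩)]
  · intro j _ hj
    rw [Set.indicator_of_notMem]
    rintro ⟨h3, h4⟩
    rcases lt_or_gt_of_ne hj with h | h
    · exact absurd (h1.trans_le (h4.trans (grid_mono t₀ n h))) (lt_irrefl _)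
    · exact absurd (h3.trans_le (h2.trans (grid_mono t₀ n h))) (lt_irrefl _)
  · intro h
    exact absurd (Finset.mem_range.2 hi) h

lemma gridStep_of_le {t₀ u : unitInterval} (n : ℕ) (w : ℕ → ℝ) (hu : u ≤ t₀) :
    gridStep t₀ n w u = 0 := by
  refine Finset.sum_eq_zero fun i _ => Set.indicator_of_notMem ?_ _
  intro h'
  have h := h'.1
  have := grid_mono t₀ n (Nat.zero_le i)
  rw [grid_zero] at this
  exact absurd (h.trans_le hu) (not_lt.2 this)

lemma abs_gridStep_le {t₀ : unitInterval} {n : ℕ} {w : ℕ → ℝ} {C : ℝ} (hC : 0 ≤ C)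
    (hw : ∀ i, |w i| ≤ C) (u : unitInterval) : |gridStep t₀ n w u| ≤ C := by
  rcases le_or_gt u t₀ with h | h
  · simpa [gridStep_of_le n w h] using hC
  · obtain ⟨i, hi, h1, h2⟩ := exists_grid_cell h n
    rw [gridStep_of_cell w hi h1 h2]
    exact hw i

/-- A neighbourhood in `[0, 1]` contains all points that are closer than some `1 / (n + 1)`. -/
lemma eventually_forall_dist_lt {u : unitInterval} {s : Set unitInterval} (hs : s ∈ 𝓝 u) :
    ∀ᶠ n : ℕ in atTop, ∀ t : unitInterval, |(t : ℝ) - u| ≤ 1 / ((n : ℝ) + 1) → t ∈ s := by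
  obtain ⟨ε, hε, hball⟩ := Metric.mem_nhds_iff.1 hs
  filter_upwards [(tendsto_one_div_add_atTop_nhds_zero_nat (𝕜 := ℝ)).eventually_lt_const hε]
    with n hn t ht
  refine hball ?_
  rw [Metric.mem_ball, Subtype.dist_eq, Real.dist_eq]
  exact ht.trans_lt hn

lemma tendsto_gridStep_right {t₀ u : unitInterval} (hu : t₀ < u) {f : unitInterval → ℝ} {l : ℝ}
    (hf : Tendsto f (𝓝[≥] u) (𝓝 l)) :
    Tendsto (fun n => gridStep t₀ n (fun i => f (grid t₀ n (i + 1))) u) atTop (𝓝 l) := by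
  refine tendsto_def.2 fun s hs => ?_
  obtain ⟨v, hv, hvs⟩ := mem_nhdsWithin_iff_exists_mem_nhds_inter.1 (hf hs)
  filter_upwards [eventually_forall_dist_lt hv] with n hn
  obtain ⟨i, hi, h1, h2⟩ := exists_grid_cell hu n
  rw [Set.mem_preimage, gridStep_of_cell _ hi h1 h2]
  refine hvs ⟨hn _ ?_, h2⟩
  have h1' : (grid t₀ n i : ℝ) < u := h1
  have h2' : (u : ℝ) ≤ grid t₀ n (i + 1) := h2
  rw [abs_of_nonneg (by linarith)]
  linarith [grid_succ_sub t₀ hi]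

lemma tendsto_gridStep_left {t₀ u : unitInterval} (hu : t₀ < u) {f : unitInterval → ℝ} {l : ℝ}
    (hf : Tendsto f (𝓝[<] u) (𝓝 l)) :
    Tendsto (fun n => gridStep t₀ n (fun i => f (grid t₀ n i)) u) atTop (𝓝 l) := by
  refine tendsto_def.2 fun s hs => ?_
  obtain ⟨v, hv, hvs⟩ := mem_nhdsWithin_iff_exists_mem_nhds_inter.1 (hf hs)
  filter_upwards [eventually_forall_dist_lt hv] with n hn
  obtain ⟨i, hi, h1, h2⟩ := exists_grid_cell hu n
  rw [Set.mem_preimage, gridStep_of_cell _ hi h1 h2]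
  refine hvs ⟨hn _ ?_, h1⟩
  have h1' : (grid t₀ n i : ℝ) < u := h1
  have h2' : (u : ℝ) ≤ grid t₀ n (i + 1) := h2
  rw [abs_of_nonpos (by linarith)]
  linarith [grid_succ_sub t₀ hi]

lemma count_sub_count (J : Finset unitInterval) {a b : unitInterval} (hab : a ≤ b) :
    count J b - count J a = ∑ s ∈ J, (Ioc a b).indicator (fun _ => (1 : ℝ)) s := by
  rw [count_eq_sum, count_eq_sum, ← Finset.sum_sub_distrib]
  refine Finset.sum_congr rfl fun s _ => ?_
  by_cases h1 : s ≤ a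
  · simp [h1, h1.trans hab, h1.not_gt]
  · simp [h1, Set.indicator_apply, not_le.1 h1]

lemma sum_grid_mul_count_sub (t₀ : unitInterval) (n : ℕ) (w : ℕ → ℝ) (J : Finset unitInterval) :
    ∑ i ∈ Finset.range (n + 1), w i * (count J (grid t₀ n (i + 1)) - count J (grid t₀ n i)) =
      ∑ s ∈ J, gridStep t₀ n w s := by
  simp only [gridStep]
  rw [Finset.sum_comm]
  refine Finset.sum_congr rfl fun i _ => ?_
  rw [count_sub_count J (grid_mono t₀ n i.le_succ), Finset.mul_sum]
  refine Finset.sum_congr rfl fun s _ => ?_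
  simp [Set.indicator_apply]

/-- Right-endpoint sums against a counting path converge to the sum over its jumps. -/
lemma tendsto_sum_grid_right (t₀ : unitInterval) (J : Finset unitInterval)
    {f g : unitInterval → ℝ} (hf : ∀ s ∈ J, t₀ < s → Tendsto f (𝓝[≥] s) (𝓝 (g s))) :
    Tendsto (fun n => ∑ i ∈ Finset.range (n + 1), f (grid t₀ n (i + 1)) *
      (count J (grid t₀ n (i + 1)) - count J (grid t₀ n i))) atTop
      (𝓝 (∑ s ∈ J with t₀ < s, g s)) := by
  simp only [sum_grid_mul_count_sub t₀ _ (fun i => f (grid t₀ _ (i + 1)))]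
  rw [Finset.sum_filter]
  refine tendsto_finsetSum _ fun s hs => ?_
  split_ifs with h
  · exact tendsto_gridStep_right h (hf s hs h)
  · simp [gridStep_of_le _ _ (not_lt.1 h)]

/-- Left-endpoint sums against a counting path converge to the sum over its jumps. -/
lemma tendsto_sum_grid_left (t₀ : unitInterval) (J : Finset unitInterval)
    {f g : unitInterval → ℝ} (hf : ∀ s ∈ J, t₀ < s → Tendsto f (𝓝[<] s) (𝓝 (g s))) :
    Tendsto (fun n => ∑ i ∈ Finset.range (n + 1), f (grid t₀ n i) *
      (count J (grid t₀ n (i + 1)) - count J (grid t₀ n i))) atTop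
      (𝓝 (∑ s ∈ J with t₀ < s, g s)) := by
  simp only [sum_grid_mul_count_sub t₀ _ (fun i => f (grid t₀ _ i))]
  rw [Finset.sum_filter]
  refine tendsto_finsetSum _ fun s hs => ?_
  split_ifs with h
  · exact tendsto_gridStep_left h (hf s hs h)
  · simp [gridStep_of_le _ _ (not_lt.1 h)]

lemma sum_grid_telescope (t₀ : unitInterval) (n : ℕ) (x : unitInterval → ℝ) :
    ∑ i ∈ Finset.range (n + 1), (x (grid t₀ n (i + 1)) - x (grid t₀ n i)) = x 1 - x t₀ := by
  rw [Finset.sum_range_sub (fun i => x (grid t₀ n i)), grid_last, grid_zero]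

/-- Left-endpoint sums against an absolutely continuous path converge to the integral. -/
lemma tendsto_sum_grid_integral (t₀ : unitInterval) {f g θ : unitInterval → ℝ} {C : ℝ}
    (hfC : ∀ s, |f s| ≤ C) (hθ : Integrable θ volume)
    (hf : ∀ s, t₀ < s → Tendsto f (𝓝[<] s) (𝓝 (g s))) :
    Tendsto (fun n => ∑ i ∈ Finset.range (n + 1), f (grid t₀ n i) *
      ∫ u in Ioc (grid t₀ n i) (grid t₀ n (i + 1)), θ u) atTop
      (𝓝 (∫ u in Ioc t₀ 1, g u * θ u)) := by
  have hC : 0 ≤ C := (abs_nonneg _).trans (hfC 0)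
  have e : ∀ n, ∑ i ∈ Finset.range (n + 1), f (grid t₀ n i) *
      ∫ u in Ioc (grid t₀ n i) (grid t₀ n (i + 1)), θ u =
      ∫ u in Ioc t₀ 1, gridStep t₀ n (fun i => f (grid t₀ n i)) u * θ u := by
    intro n
    simp only [gridStep, Finset.sum_mul]
    rw [integral_finsetSum]
    · refine Finset.sum_congr rfl fun i hi => ?_
      have hi : i < n + 1 := Finset.mem_range.1 hi
      rw [← integral_const_mul, ← integral_indicator measurableSet_Ioc,
        ← integral_indicator measurableSet_Ioc]
      refine integral_congr_ae (ae_of_all _ fun u => ?_)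
      have hsub : Ioc (grid t₀ n i) (grid t₀ n (i + 1)) ⊆ Ioc t₀ 1 := by
        refine Ioc_subset_Ioc ?_ unitInterval.le_one'
        have := grid_mono t₀ n (Nat.zero_le i)
        rwa [grid_zero] at this
      by_cases h : u ∈ Ioc (grid t₀ n i) (grid t₀ n (i + 1))
      · simp [h, hsub h]
      · rw [Set.indicator_of_notMem h]
        by_cases h' : u ∈ Ioc t₀ 1
        · rw [Set.indicator_of_mem h', Set.indicator_of_notMem h, zero_mul]
        · rw [Set.indicator_of_notMem h']
    · intro i _
      refine (hθ.const_mul (f (grid t₀ n i))).restrict.indicator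
        (measurableSet_Ioc (a := grid t₀ n i) (b := grid t₀ n (i + 1))) |>.congr
        (ae_of_all _ fun u => ?_)
      simp [Set.indicator_apply]
  simp only [e]
  refine tendsto_integral_of_dominated_convergence (fun u => C * |θ u|) ?_ ?_ ?_ ?_
  · intro n
    refine AEStronglyMeasurable.mul (Measurable.aestronglyMeasurable ?_) hθ.1.restrict
    unfold gridStep
    exact Finset.measurable_fun_sum _ fun i _ => measurable_const.indicator measurableSet_Ioc
  · exact (hθ.abs.const_mul C).restrict
  · intro n
    refine ae_of_all _ fun u => ?_
    rw [Real.norm_eq_abs, abs_mul]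
    exact mul_le_mul_of_nonneg_right (abs_gridStep_le hC (fun i => hfC _) u) (abs_nonneg _)
  · filter_upwards [ae_restrict_mem measurableSet_Ioc] with u hu
    exact (tendsto_gridStep_left hu.1 (hf u hu.1)).mul_const _

lemma _root_.MeasureTheory.Integrable.fun_sub {α : Type*} {_ : MeasurableSpace α} {μ : Measure α}
    {f g : α → ℝ} (hf : Integrable f μ) (hg : Integrable g μ) :
    Integrable (fun x => f x - g x) μ :=
  hf.sub hg

/-! ### Poisson moments and the generator estimate -/

lemma hasSum_poisson_id (r : NNReal) :
    HasSum (fun n : ℕ => Real.exp (-r) * (r : ℝ) ^ n / n.factorial * n) r := by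
  rw [← hasSum_nat_add_iff' 1]
  have := (hasSum_one_poissonMeasure r).mul_left (r : ℝ)
  simp only [Finset.sum_range_one, Nat.cast_zero, mul_zero, sub_zero]
  rw [mul_one] at this
  refine this.congr_fun ?_
  intro n
  rw [Nat.factorial_succ]
  push_cast
  have : (n.factorial : ℝ) ≠ 0 := by positivity
  have : (n : ℝ) + 1 ≠ 0 := by positivity
  field_simp
  ring

lemma hasSum_poisson_descFactorial_two (r : NNReal) :
    HasSum (fun n : ℕ => Real.exp (-r) * (r : ℝ) ^ n / n.factorial * (n * (n - 1))) (r ^ 2) := by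
  rw [← hasSum_nat_add_iff' 1]
  have := (hasSum_poisson_id r).mul_left (r : ℝ)
  simp only [Finset.sum_range_one, Nat.cast_zero, zero_mul, mul_zero, sub_zero]
  rw [← pow_two] at this
  refine this.congr_fun ?_
  intro n
  rw [Nat.factorial_succ]
  push_cast
  have : (n.factorial : ℝ) ≠ 0 := by positivity
  have : (n : ℝ) + 1 ≠ 0 := by positivity
  field_simp
  ring

lemma integrable_poisson_id (r : NNReal) :
    Integrable (fun n : ℕ => (n : ℝ)) (poissonMeasure r) := by
  rw [integrable_poissonMeasure_iff]
  simpa using (hasSum_poisson_id r).summable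

lemma integral_poisson_id (r : NNReal) : ∫ n : ℕ, (n : ℝ) ∂(poissonMeasure r) = r := by
  rw [integral_poissonMeasure]
  exact (hasSum_poisson_id r).tsum_eq

lemma integrable_poisson_descFactorial_two (r : NNReal) :
    Integrable (fun n : ℕ => (n : ℝ) * (n - 1)) (poissonMeasure r) := by
  rw [integrable_poissonMeasure_iff]
  refine (hasSum_poisson_descFactorial_two r).summable.congr fun n => ?_
  rcases n with _ | n
  · simp
  · rw [Real.norm_of_nonneg]
    push_cast
    have : (0 : ℝ) ≤ n := n.cast_nonneg
    have : (n : ℝ) + 1 - 1 = n := by ring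
    rw [this]
    positivity

lemma integral_poisson_descFactorial_two (r : NNReal) :
    ∫ n : ℕ, (n : ℝ) * (n - 1) ∂(poissonMeasure r) = r ^ 2 := by
  rw [integral_poissonMeasure]
  exact (hasSum_poisson_descFactorial_two r).tsum_eq

lemma integrable_poisson_of_le {r : NNReal} {G : ℕ → ℝ} {C : ℝ}
    (hG : ∀ n : ℕ, |G n - G 0| ≤ C * n) : Integrable G (poissonMeasure r) := by
  refine (((integrable_poisson_id r).const_mul C).add (integrable_const |G 0|)).mono'
    .of_discrete (ae_of_all _ fun n => ?_)
  have := abs_sub_abs_le_abs_sub (G n) (G 0)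
  simp only [Real.norm_eq_abs, Pi.add_apply]
  linarith [hG n]

/-- A Poisson variable with small mean `r` takes the value `1` with probability about `r`, and
larger values with probability of order `r ^ 2`. -/
lemma abs_integral_poisson_sub_le {r : NNReal} {G : ℕ → ℝ} {C : ℝ}
    (hG : ∀ n : ℕ, |G n - G 0| ≤ C * n) :
    |∫ n, G n ∂(poissonMeasure r) - G 0 - r * (G 1 - G 0)| ≤ 2 * C * r ^ 2 := by
  have hC : 0 ≤ C := by simpa using (abs_nonneg _).trans (hG 1)
  have hGi := integrable_poisson_of_le (r := r) hG
  have e : ∫ n, G n ∂(poissonMeasure r) - G 0 - r * (G 1 - G 0) =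
      ∫ n : ℕ, (G n - G 0 - n * (G 1 - G 0)) ∂(poissonMeasure r) := by
    rw [integral_sub (hGi.fun_sub (integrable_const _)) ((integrable_poisson_id r).mul_const _),
      integral_sub hGi (integrable_const _), integral_mul_const, integral_poisson_id]
    simp
  rw [e]
  refine (abs_integral_le_integral_abs).trans ?_
  rw [← integral_poisson_descFactorial_two r, ← integral_const_mul]
  refine integral_mono ((hGi.sub (integrable_const _)).sub
    ((integrable_poisson_id r).mul_const _)).abs
    ((integrable_poisson_descFactorial_two r).const_mul _) fun n => ?_
  rcases n with _ | _ | n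
  · simp
  · simp
  · have h1 := hG (n + 1 + 1)
    have h2 := hG 1
    push_cast at h1 h2 ⊢
    have hn : (0 : ℝ) ≤ n := n.cast_nonneg
    calc |G (n + 1 + 1) - G 0 - ((n : ℝ) + 1 + 1) * (G 1 - G 0)|
        ≤ |G (n + 1 + 1) - G 0| + |((n : ℝ) + 1 + 1) * (G 1 - G 0)| := abs_sub _ _
      _ ≤ C * ((n : ℝ) + 1 + 1) + ((n : ℝ) + 1 + 1) * (C * 1) := by
          rw [abs_mul, abs_of_nonneg (by positivity : (0 : ℝ) ≤ (n : ℝ) + 1 + 1)]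
          gcongr
      _ ≤ 2 * C * (((n : ℝ) + 1 + 1) * ((n : ℝ) + 1 + 1 - 1)) := by
          nlinarith [mul_nonneg hC hn, mul_nonneg (mul_nonneg hC hn) hn]

/-- The generator of the difference of two independent Poisson processes, with an error term. -/
lemma abs_integral_skellam_sub_le {r : NNReal} {δ K : ℝ} (hδ : 0 ≤ δ) {φ : ℝ → ℝ}
    (hφ : ∀ x y, |φ x - φ y| ≤ K * |x - y|) :
    |∫ p : ℕ × ℕ, φ (δ * p.1 - δ * p.2) ∂((poissonMeasure r).prod (poissonMeasure r))
      - φ 0 - r * (φ δ + φ (-δ) - 2 * φ 0)| ≤ 6 * (K * δ) * r ^ 2 := by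
  have hK : 0 ≤ K := by simpa using (abs_nonneg _).trans (hφ 1 0)
  have hr : (0 : ℝ) ≤ r := r.2
  -- the function of the first variable, the second one being frozen
  have h1 : ∀ b : ℕ, ∀ n : ℕ, |φ (δ * n - δ * b) - φ (δ * (0 : ℕ) - δ * b)| ≤ K * δ * n := by
    intro b n
    refine (hφ _ _).trans (le_of_eq ?_)
    rw [show δ * (n : ℝ) - δ * b - (δ * ((0 : ℕ) : ℝ) - δ * b) = δ * n by push_cast; ring,
      abs_of_nonneg (by positivity)]
    ring
  have h2 : ∀ n : ℕ, |φ (-(δ * n)) - φ (-(δ * (0 : ℕ)))| ≤ K * δ * n := by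
    intro n
    refine (hφ _ _).trans (le_of_eq ?_)
    rw [show -(δ * (n : ℝ)) - (-(δ * ((0 : ℕ) : ℝ))) = -(δ * n) by push_cast; ring, abs_neg,
      abs_of_nonneg (by positivity)]
    ring
  have h3 : ∀ n : ℕ, |φ (δ - δ * n) - φ (δ - δ * (0 : ℕ))| ≤ K * δ * n := by
    intro n
    refine (hφ _ _).trans (le_of_eq ?_)
    rw [show δ - δ * (n : ℝ) - (δ - δ * ((0 : ℕ) : ℝ)) = -(δ * n) by push_cast; ring, abs_neg,
      abs_of_nonneg (by positivity)]
    ring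
  have i2 := integrable_poisson_of_le (r := r) h2
  have i3 := integrable_poisson_of_le (r := r) h3
  have iid := integrable_poisson_id r
  have hint : Integrable (fun p : ℕ × ℕ => φ (δ * p.1 - δ * p.2))
      ((poissonMeasure r).prod (poissonMeasure r)) := by
    refine ((((iid.comp_fst (poissonMeasure r)).add (iid.comp_snd (poissonMeasure r))).const_mul
      (K * δ)).add (integrable_const |φ 0|)).mono' .of_discrete (ae_of_all _ fun p => ?_)
    have a := abs_sub_abs_le_abs_sub (φ (δ * p.1 - δ * p.2)) (φ 0)
    have b := hφ (δ * p.1 - δ * p.2) 0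
    have c : |δ * (p.1 : ℝ) - δ * p.2 - 0| ≤ δ * p.1 + δ * p.2 := by
      rw [sub_zero]
      refine (abs_sub _ _).trans (le_of_eq ?_)
      rw [abs_of_nonneg (by positivity), abs_of_nonneg (by positivity)]
    have d := mul_le_mul_of_nonneg_left c hK
    simp only [Real.norm_eq_abs, Pi.add_apply]
    nlinarith
  rw [integral_prod_symm _ hint]
  have iF : Integrable (fun b : ℕ => ∫ a : ℕ, φ (δ * a - δ * b) ∂(poissonMeasure r))
      (poissonMeasure r) := hint.integral_prod_right
  set ψ : ℕ → ℝ := fun b => φ (-(δ * b)) + r * (φ (δ - δ * b) - φ (-(δ * b))) with hψ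
  have iψ : Integrable ψ (poissonMeasure r) := i2.add ((i3.sub i2).const_mul _)
  have e1 : |∫ b : ℕ, ∫ a : ℕ, φ (δ * a - δ * b) ∂(poissonMeasure r) ∂(poissonMeasure r)
      - ∫ b, ψ b ∂(poissonMeasure r)| ≤ 2 * (K * δ) * r ^ 2 := by
    rw [← integral_sub iF iψ]
    refine (abs_integral_le_integral_abs).trans ?_
    refine (integral_mono (iF.sub iψ).abs (integrable_const (2 * (K * δ) * (r : ℝ) ^ 2))
      fun b => ?_).trans (by simp)
    have := abs_integral_poisson_sub_le (r := r) (h1 b)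
    refine le_trans (le_of_eq ?_) this
    simp only [hψ, Pi.sub_apply]
    push_cast
    congr 1
    rw [show δ * 0 - δ * (b : ℝ) = -(δ * b) by ring, mul_one]
    ring
  have e2 : |∫ b : ℕ, φ (-(δ * b)) ∂(poissonMeasure r) - φ 0 - r * (φ (-δ) - φ 0)| ≤
      2 * (K * δ) * r ^ 2 := by
    have := abs_integral_poisson_sub_le (r := r) h2
    simpa using this
  have e3 : |∫ b : ℕ, (φ (δ - δ * b) - φ (-(δ * b))) ∂(poissonMeasure r) - (φ δ - φ 0)| ≤
      2 * (K * δ) * r := by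
    have : ∫ b : ℕ, (φ (δ - δ * b) - φ (-(δ * b))) ∂(poissonMeasure r) - (φ δ - φ 0) =
        ∫ b : ℕ, ((φ (δ - δ * b) - φ (-(δ * b))) - (φ δ - φ 0)) ∂(poissonMeasure r) := by
      rw [integral_sub (i3.fun_sub i2) (integrable_const _)]; simp
    rw [this]
    refine (abs_integral_le_integral_abs).trans ?_
    rw [← integral_poisson_id r, ← integral_const_mul]
    refine integral_mono ((i3.sub i2).sub (integrable_const _)).abs (iid.const_mul _) fun b => ?_
    have a := h2 b
    have c := h3 b
    simp only [Nat.cast_zero, mul_zero, neg_zero, sub_zero] at a c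
    calc |φ (δ - δ * b) - φ (-(δ * b)) - (φ δ - φ 0)|
        = |(φ (δ - δ * b) - φ δ) - (φ (-(δ * b)) - φ 0)| := by congr 1; ring
      _ ≤ |φ (δ - δ * b) - φ δ| + |φ (-(δ * b)) - φ 0| := abs_sub _ _
      _ ≤ 2 * (K * δ) * b := by linarith
  have e4 : ∫ b, ψ b ∂(poissonMeasure r) = ∫ b : ℕ, φ (-(δ * b)) ∂(poissonMeasure r) +
      r * ∫ b : ℕ, (φ (δ - δ * b) - φ (-(δ * b))) ∂(poissonMeasure r) := by
    rw [hψ, integral_add i2 ((i3.fun_sub i2).const_mul _), integral_const_mul]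
  rw [e4] at e1
  have e3' := mul_le_mul_of_nonneg_left e3 hr
  rw [abs_le] at e1 e2 ⊢
  rw [← abs_of_nonneg hr, ← abs_mul, abs_of_nonneg hr, abs_le] at e3'
  constructor <;> nlinarith [e1.1, e1.2, e2.1, e2.2, e3'.1, e3'.2]

/-- Integrating a function of two independent random variables: freeze the first one. -/
lemma integral_of_indepFun {Ω α γ : Type*} [MeasurableSpace Ω] [MeasurableSpace α]
    [MeasurableSpace γ] {μ : Measure Ω} [IsProbabilityMeasure μ] {X : Ω → α} {Y : Ω → γ}
    (hX : Measurable X) (hY : Measurable Y) (h : IndepFun X Y μ) {F : α × γ → ℝ}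
    (hF : Measurable F) (hint : Integrable (fun ω => F (X ω, Y ω)) μ) :
    ∫ ω, F (X ω, Y ω) ∂μ = ∫ ω, ∫ ω', F (X ω, Y ω') ∂μ ∂μ := by
  have hmap := (indepFun_iff_map_prod_eq_prod_map_map hX.aemeasurable hY.aemeasurable).1 h
  have : IsProbabilityMeasure (μ.map X) := Measure.isProbabilityMeasure_map hX.aemeasurable
  have : IsProbabilityMeasure (μ.map Y) := Measure.isProbabilityMeasure_map hY.aemeasurable
  have hint' : Integrable F ((μ.map X).prod (μ.map Y)) := by
    rw [← hmap, integrable_map_measure hF.aestronglyMeasurable (hX.prodMk hY).aemeasurable]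
    exact hint
  calc ∫ ω, F (X ω, Y ω) ∂μ = ∫ p, F p ∂(μ.map fun ω => (X ω, Y ω)) :=
        (integral_map (hX.prodMk hY).aemeasurable hF.aestronglyMeasurable).symm
    _ = ∫ x, ∫ y, F (x, y) ∂(μ.map Y) ∂(μ.map X) := by rw [hmap, integral_prod _ hint']
    _ = ∫ ω, ∫ y, F (X ω, y) ∂(μ.map Y) ∂μ := by
        rw [integral_map hX.aemeasurable
          (hF.stronglyMeasurable.integral_prod_right' (ν := μ.map Y)).aestronglyMeasurable]
    _ = _ := by
        refine integral_congr_ae (ae_of_all _ fun ω => ?_)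
        exact integral_map hY.aemeasurable
          (hF.comp measurable_prodMk_left).aestronglyMeasurable

namespace Market

variable {Ω : Type*} [mΩ : MeasurableSpace Ω] {μ : Measure Ω} (M : Market Ω μ)

/-! ### The law of the noise increments -/

lemma measurable_ZB (t : unitInterval) : Measurable (M.ZB t) := by
  simpa [div_mul_cancel₀, M.δ_pos.ne'] using (M.ZB_poisson.measurable t).mul_const M.δ

lemma measurable_ZS (t : unitInterval) : Measurable (M.ZS t) := by
  simpa [div_mul_cancel₀, M.δ_pos.ne'] using (M.ZS_poisson.measurable t).mul_const M.δ

lemma measurable_Z (t : unitInterval) : Measurable (M.Z t) :=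
  (M.measurable_ZB t).sub (M.measurable_ZS t)

lemma exists_count_ZB (ω : Ω) : ∃ J : Finset unitInterval, 0 ∉ J ∧
    ∀ t, M.ZB t ω = M.δ * count J t := by
  obtain ⟨J, h0, h⟩ := (M.ZB_poisson.path ω).exists_count
  refine ⟨J, h0, fun t => ?_⟩
  have := h t
  rw [one_mul, div_eq_iff M.δ_pos.ne'] at this
  rw [this, mul_comm]

lemma exists_count_ZS (ω : Ω) : ∃ J : Finset unitInterval, 0 ∉ J ∧
    ∀ t, M.ZS t ω = M.δ * count J t := by
  obtain ⟨J, h0, h⟩ := (M.ZS_poisson.path ω).exists_count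
  refine ⟨J, h0, fun t => ?_⟩
  have := h t
  rw [one_mul, div_eq_iff M.δ_pos.ne'] at this
  rw [this, mul_comm]

lemma exists_int_Z (t : unitInterval) (ω : Ω) : ∃ j : ℤ, M.Z t ω = M.δ * j := by
  obtain ⟨J, -, hJ⟩ := M.exists_count_ZB ω
  obtain ⟨J', -, hJ'⟩ := M.exists_count_ZS ω
  refine ⟨((J.filter (· ≤ t)).card : ℤ) - (J'.filter (· ≤ t)).card, ?_⟩
  rw [Z, hJ, hJ', count, count]
  push_cast
  ring

lemma Z_zero (ω : Ω) : M.Z 0 ω = 0 := by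
  obtain ⟨J, h, hJ⟩ := M.exists_count_ZB ω
  obtain ⟨J', h', hJ'⟩ := M.exists_count_ZS ω
  have key : ∀ J : Finset unitInterval, 0 ∉ J → count J 0 = 0 := by
    intro J hJ
    simp only [count, Nat.cast_eq_zero, Finset.card_eq_zero, Finset.filter_eq_empty_iff]
    intro s hs hs0
    exact hJ (le_antisymm hs0 unitInterval.nonneg' ▸ hs)
  rw [Z, hJ, hJ', key J h, key J' h']
  ring

/-- The mean number of noise orders of each sign in `(s, t]`. -/
noncomputable def rate (s t : unitInterval) : NNReal := Real.toNNReal (M.β * ((t : ℝ) - s))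

lemma coe_rate {s t : unitInterval} (hst : s ≤ t) : (M.rate s t : ℝ) = M.β * ((t : ℝ) - s) :=
  Real.coe_toNNReal _ (mul_nonneg M.β_pos.le (sub_nonneg.2 hst))

lemma map_incr (s t : unitInterval) (hst : s ≤ t) [IsProbabilityMeasure μ] :
    μ.map (fun ω => ((M.ZB t ω - M.ZB s ω) / M.δ, (M.ZS t ω - M.ZS s ω) / M.δ)) =
      ((poissonMeasure (M.rate s t)).prod (poissonMeasure (M.rate s t))).map
        (Prod.map Nat.cast Nat.cast) := by
  have hB : HasLaw (fun ω => (M.ZB t ω - M.ZB s ω) / M.δ)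
      ((poissonMeasure (M.rate s t)).map (Nat.cast : ℕ → ℝ)) μ := by
    have := M.ZB_poisson.law s t hst
    simpa only [← sub_div, rate] using this
  have hS : HasLaw (fun ω => (M.ZS t ω - M.ZS s ω) / M.δ)
      ((poissonMeasure (M.rate s t)).map (Nat.cast : ℕ → ℝ)) μ := by
    have := M.ZS_poisson.law s t hst
    simpa only [← sub_div, rate] using this
  have hm : Measurable (fun x : unitInterval → ℝ => (x t - x s) / M.δ) := by fun_prop
  have hind : IndepFun (fun ω => (M.ZB t ω - M.ZB s ω) / M.δ)
      (fun ω => (M.ZS t ω - M.ZS s ω) / M.δ) μ := M.noise_indep.comp hm hm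
  rw [(indepFun_iff_map_prod_eq_prod_map_map hB.aemeasurable hS.aemeasurable).1 hind,
    hB.map_eq, hS.map_eq, Measure.map_prod_map _ _ .of_discrete .of_discrete]

/-- The law of `Z_t - Z_s`. -/
lemma map_Z_sub {s t : unitInterval} (hst : s ≤ t) [IsProbabilityMeasure μ] :
    μ.map (fun ω => M.Z t ω - M.Z s ω) =
      ((poissonMeasure (M.rate s t)).prod (poissonMeasure (M.rate s t))).map
        (fun p : ℕ × ℕ => M.δ * p.1 - M.δ * p.2) := by
  have h := congrArg (Measure.map (fun p : ℝ × ℝ => M.δ * p.1 - M.δ * p.2)) (M.map_incr s t hst)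
  have hf : Measurable (fun p : ℝ × ℝ => M.δ * p.1 - M.δ * p.2) := by fun_prop
  have hB := (((M.measurable_ZB t).fun_sub (M.measurable_ZB s)).div_const M.δ)
  have hS := (((M.measurable_ZS t).fun_sub (M.measurable_ZS s)).div_const M.δ)
  rw [Measure.map_map hf (hB.prodMk hS), Measure.map_map hf .of_discrete] at h
  have hδ := M.δ_pos.ne'
  convert h using 2
  · funext ω
    simp only [Function.comp, Z]
    field_simp
    ring
  · rfl

lemma integral_Z_sub {s t : unitInterval} (hst : s ≤ t) [IsProbabilityMeasure μ] {φ : ℝ → ℝ}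
    (hφ : Measurable φ) :
    ∫ ω, φ (M.Z t ω - M.Z s ω) ∂μ = ∫ p : ℕ × ℕ, φ (M.δ * p.1 - M.δ * p.2)
      ∂((poissonMeasure (M.rate s t)).prod (poissonMeasure (M.rate s t))) := by
  rw [← integral_map (φ := fun ω => M.Z t ω - M.Z s ω)
    ((M.measurable_Z t).sub (M.measurable_Z s)).aemeasurable hφ.aestronglyMeasurable,
    M.map_Z_sub hst, integral_map .of_discrete hφ.aestronglyMeasurable]

lemma integrable_Z_sub_and_integral_abs_le {s t : unitInterval} (hst : s ≤ t)
    [IsProbabilityMeasure μ] :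
    Integrable (fun ω => M.Z t ω - M.Z s ω) μ ∧
      ∫ ω, |M.Z t ω - M.Z s ω| ∂μ ≤ 2 * M.δ * (M.β * ((t : ℝ) - s)) := by
  have hm : Measurable (fun ω => M.Z t ω - M.Z s ω) := (M.measurable_Z t).sub (M.measurable_Z s)
  have iid := integrable_poisson_id (M.rate s t)
  have i1 := (iid.comp_fst (poissonMeasure (M.rate s t))).const_mul M.δ
  have i2 := (iid.comp_snd (poissonMeasure (M.rate s t))).const_mul M.δ
  constructor
  · have : Integrable (fun x : ℝ => x) (μ.map fun ω => M.Z t ω - M.Z s ω) := by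
      rw [M.map_Z_sub hst, integrable_map_measure (by fun_prop) .of_discrete]
      exact i1.sub i2
    rw [integrable_map_measure (by fun_prop) hm.aemeasurable] at this
    exact this
  · rw [M.integral_Z_sub hst (φ := fun x => |x|) (by fun_prop)]
    refine (integral_mono (i1.sub i2).abs (i1.add i2) fun p => ?_).trans ?_
    · refine (abs_sub _ _).trans (le_of_eq ?_)
      have := M.δ_pos.le
      rw [abs_of_nonneg (by positivity), abs_of_nonneg (by positivity)]
      rfl
    · rw [integral_add' i1 i2, integral_const_mul, integral_const_mul,
        integral_fun_fst (μ := poissonMeasure (M.rate s t)) (f := fun n : ℕ => (n : ℝ)),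
        integral_fun_snd (μ := poissonMeasure (M.rate s t)) (f := fun n : ℕ => (n : ℝ)),
        integral_poisson_id, M.coe_rate hst]
      simp
      linarith

lemma integrable_Z_sub [IsProbabilityMeasure μ] (s t : unitInterval) :
    Integrable (fun ω => M.Z t ω - M.Z s ω) μ := by
  rcases le_total s t with h | h
  · exact (M.integrable_Z_sub_and_integral_abs_le h).1
  · simpa using (M.integrable_Z_sub_and_integral_abs_le h).1.fun_neg

lemma integral_abs_Z_sub_le [IsProbabilityMeasure μ] (s t : unitInterval) :
    ∫ ω, |M.Z t ω - M.Z s ω| ∂μ ≤ 2 * M.δ * M.β * |(t : ℝ) - s| := by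
  rcases le_total s t with h | h
  · rw [abs_of_nonneg (show (0 : ℝ) ≤ (t : ℝ) - s from sub_nonneg.2 h)]
    linarith [(M.integrable_Z_sub_and_integral_abs_le h).2]
  · rw [abs_sub_comm (t : ℝ), abs_of_nonneg (show (0 : ℝ) ≤ (s : ℝ) - t from sub_nonneg.2 h)]
    simp only [abs_sub_comm (M.Z t _)]
    linarith [(M.integrable_Z_sub_and_integral_abs_le h).2]

lemma integrable_Z [IsProbabilityMeasure μ] (t : unitInterval) : Integrable (M.Z t) μ := by
  simpa [M.Z_zero] using M.integrable_Z_sub 0 t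

/-- Every lattice increment of the noise over an interval of positive length has positive
probability. -/
lemma measure_Z_sub_eq_pos [IsProbabilityMeasure μ] {s t : unitInterval} (hst : s < t) (j : ℤ) :
    0 < μ {ω | M.Z t ω - M.Z s ω = M.δ * j} := by
  have hr : 0 < M.rate s t := by
    rw [rate, Real.toNNReal_pos]
    exact mul_pos M.β_pos (sub_pos.2 hst)
  have hm : Measurable (fun ω => M.Z t ω - M.Z s ω) := (M.measurable_Z t).sub (M.measurable_Z s)
  have h1 : μ {ω | M.Z t ω - M.Z s ω = M.δ * j} =
      μ.map (fun ω => M.Z t ω - M.Z s ω) {M.δ * j} := by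
    rw [Measure.map_apply hm (measurableSet_singleton _)]; rfl
  rw [h1, M.map_Z_sub hst.le, Measure.map_apply .of_discrete (measurableSet_singleton _)]
  refine lt_of_lt_of_le ?_ (measure_mono
    (s := ({j.toNat} : Set ℕ) ×ˢ ({(-j).toNat} : Set ℕ)) ?_)
  · rw [Measure.prod_prod]
    have key : ∀ n : ℕ, 0 < poissonMeasure (M.rate s t) {n} := fun n => by
      have := poissonMeasure_real_singleton_pos n hr
      exact (measureReal_ne_zero_iff (by finiteness)).1 this.ne' |>.bot_lt
    exact ENNReal.mul_pos (key _).ne' (key _).ne'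
  · rintro ⟨a, b⟩ ⟨ha, hb⟩
    simp only [mem_singleton_iff] at ha hb
    simp only [mem_preimage, mem_singleton_iff, ha, hb]
    rw [← mul_sub]
    congr 1
    have : ((j.toNat : ℤ) : ℝ) - (((-j).toNat : ℤ) : ℝ) = j := by
      rw [← Int.cast_sub, Int.toNat_sub_toNat_neg]
    exact_mod_cast this

/-- The generator of the noise, with an error term. -/
lemma abs_integral_comp_Z_sub_le [IsProbabilityMeasure μ] {s t : unitInterval} (hst : s ≤ t)
    {φ : ℝ → ℝ} {K : ℝ} (hm : Measurable φ) (hφ : ∀ x y, |φ x - φ y| ≤ K * |x - y|) :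
    |∫ ω, φ (M.Z t ω - M.Z s ω) ∂μ - φ 0 -
      M.β * ((t : ℝ) - s) * (φ M.δ + φ (-M.δ) - 2 * φ 0)| ≤
      6 * (K * M.δ) * (M.β * ((t : ℝ) - s)) ^ 2 := by
  rw [M.integral_Z_sub hst hm, ← M.coe_rate hst]
  exact abs_integral_skellam_sub_le M.δ_pos.le hφ

end Market

/-! ### Independence of the past and the noise increments -/

section Independence

variable {Ω : Type*}

lemma isPiSystem_image2_inter (a c : MeasurableSpace Ω) :
    IsPiSystem (image2 (· ∩ ·) {s | MeasurableSet[a] s} {s | MeasurableSet[c] s}) := by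
  rintro _ ⟨A, hA, C, hC, rfl⟩ _ ⟨A', hA', C', hC', rfl⟩ _
  exact ⟨A ∩ A', MeasurableSet.inter (m := a) hA hA', C ∩ C',
    MeasurableSet.inter (m := c) hC hC', by ext; simp; tauto⟩

lemma sup_eq_generateFrom_image2_inter (a c : MeasurableSpace Ω) :
    a ⊔ c = MeasurableSpace.generateFrom
      (image2 (· ∩ ·) {s | MeasurableSet[a] s} {s | MeasurableSet[c] s}) := by
  refine le_antisymm (sup_le ?_ ?_) (MeasurableSpace.generateFrom_le ?_)
  · intro A hA
    exact MeasurableSpace.measurableSet_generateFrom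
      ⟨A, hA, univ, MeasurableSet.univ (m := c), inter_univ A⟩
  · intro C hC
    exact MeasurableSpace.measurableSet_generateFrom
      ⟨univ, MeasurableSet.univ (m := a), C, hC, univ_inter C⟩
  · rintro _ ⟨A, hA, C, hC, rfl⟩
    exact MeasurableSet.inter (m := a ⊔ c) ((le_sup_left : a ≤ a ⊔ c) A hA)
      ((le_sup_right : c ≤ a ⊔ c) C hC)

lemma history_mono (x : unitInterval → Ω → ℝ) : Monotone (history x) := by
  intro s t hst
  exact iSup₂_le fun r hr => le_iSup₂_of_le r (hr.trans hst) le_rfl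

lemma comap_le_history (x : unitInterval → Ω → ℝ) {s t : unitInterval} (hst : s ≤ t) :
    MeasurableSpace.comap (x s) inferInstance ≤ history x t :=
  le_iSup₂_of_le s hst le_rfl

lemma history_le_comap_path (x : unitInterval → Ω → ℝ) (t : unitInterval) :
    history x t ≤ MeasurableSpace.comap (fun ω t => x t ω) inferInstance := by
  refine iSup₂_le fun r _ => ?_
  have : x r = (fun p : unitInterval → ℝ => p r) ∘ (fun ω t => x t ω) := rfl
  rw [this, ← MeasurableSpace.comap_comp]
  exact MeasurableSpace.comap_mono (measurable_pi_apply r).comap_le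

lemma measurable_history (x : unitInterval → Ω → ℝ) {s t : unitInterval} (hst : s ≤ t) :
    Measurable[history x t] (x s) :=
  measurable_iff_comap_le.2 (comap_le_history x hst)

variable [mΩ : MeasurableSpace Ω] {μ : Measure Ω}

/-- Regrouping independent sigma-algebras. -/
lemma Indep.sup_sup [IsProbabilityMeasure μ] {a b c d : MeasurableSpace Ω}
    (ha : a ≤ mΩ) (hb : b ≤ mΩ) (hc : c ≤ mΩ) (hd : d ≤ mΩ)
    (hab : Indep a b μ) (hcd : Indep c d μ) (h : Indep (a ⊔ b) (c ⊔ d) μ) :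
    Indep (a ⊔ c) (b ⊔ d) μ := by
  refine IndepSets.indep (sup_le ha hc) (sup_le hb hd) (isPiSystem_image2_inter a c)
    (isPiSystem_image2_inter b d) (sup_eq_generateFrom_image2_inter a c)
    (sup_eq_generateFrom_image2_inter b d) ?_
  rw [IndepSets_iff]
  rintro _ _ ⟨A, hA, C, hC, rfl⟩ ⟨B, hB, D, hD, rfl⟩
  simp only [mem_ofPred_eq] at hA hB hC hD
  rw [Indep_iff] at hab hcd h
  have hA' : MeasurableSet[a ⊔ b] A := (le_sup_left : a ≤ a ⊔ b) A hA
  have hB' : MeasurableSet[a ⊔ b] B := (le_sup_right : b ≤ a ⊔ b) B hB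
  have hC' : MeasurableSet[c ⊔ d] C := (le_sup_left : c ≤ c ⊔ d) C hC
  have hD' : MeasurableSet[c ⊔ d] D := (le_sup_right : d ≤ c ⊔ d) D hD
  rw [show A ∩ C ∩ (B ∩ D) = A ∩ B ∩ (C ∩ D) by ext; simp; tauto,
    h _ _ (MeasurableSet.inter (m := a ⊔ b) hA' hB') (MeasurableSet.inter (m := c ⊔ d) hC' hD'),
    h _ _ hA' hC', h _ _ hB' hD', hab _ _ hA hB, hcd _ _ hC hD]
  ring

lemma Indep.sup_left [IsProbabilityMeasure μ] {a b c : MeasurableSpace Ω}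
    (ha : a ≤ mΩ) (hb : b ≤ mΩ) (hc : c ≤ mΩ)
    (h : Indep a (b ⊔ c) μ) (hbc : Indep b c μ) : Indep (a ⊔ b) c μ := by
  have := Indep.sup_sup (mΩ := mΩ) ha bot_le hb hc (@indep_bot_right Ω a mΩ μ _) hbc
    (by simpa using h)
  simpa using this

lemma history_le {x : unitInterval → Ω → ℝ} (hx : ∀ t, Measurable (x t)) (t : unitInterval) :
    history x t ≤ mΩ :=
  iSup₂_le fun s _ => (hx s).comap_le

/-- For a process with independent increments, the whole past is independent of the future
increments. -/
lemma indep_history_incr [IsProbabilityMeasure μ] {N : unitInterval → Ω → ℝ}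
    (hN : ∀ t, Measurable (N t)) (h0 : ∀ ω, N 0 ω = 0) (hind : HasIndepIncrements N μ)
    {s t : unitInterval} (hst : s ≤ t) :
    Indep (history N s) (MeasurableSpace.comap (fun ω => N t ω - N s ω) inferInstance) μ := by
  classical
  have hle : ∀ F : Finset unitInterval, (⨆ r ∈ F, ⨆ _ : r ≤ s,
      MeasurableSpace.comap (N r) inferInstance) ≤ mΩ := fun F =>
    iSup₂_le fun r _ => iSup_le fun _ => (hN r).comap_le
  have key : ∀ F : Finset unitInterval, Indep (⨆ r ∈ F, ⨆ _ : r ≤ s,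
      MeasurableSpace.comap (N r) inferInstance)
      (MeasurableSpace.comap (fun ω => N t ω - N s ω) inferInstance) μ := by
    intro F
    set G : Finset unitInterval := insert 0 (insert s (F.filter (· ≤ s))) with hG
    have hGs : ∀ r ∈ G, r ≤ s := by
      intro r hr
      simp only [hG, Finset.mem_insert, Finset.mem_filter] at hr
      rcases hr with rfl | rfl | hr
      · exact unitInterval.nonneg'
      · exact le_rfl
      · exact hr.2
    obtain ⟨k, hk⟩ : ∃ k, G.card = k + 1 :=
      Nat.exists_eq_succ_of_ne_zero (Finset.card_ne_zero_of_mem (Finset.mem_insert_self _ _))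
    -- the points of `G` in increasing order, followed by `t`
    let τ : ℕ → unitInterval := fun i => if h : i < k + 1 then G.orderEmbOfFin hk ⟨i, h⟩ else t
    have hτmem : ∀ i, i < k + 1 → τ i ∈ G := fun i hi => by
      simp only [τ, hi, dif_pos]; exact Finset.orderEmbOfFin_mem _ _ _
    have hτmono : Monotone τ := by
      intro i j hij
      by_cases hj : j < k + 1
      · have hi : i < k + 1 := by omega
        simp only [τ, hi, hj, dif_pos]
        exact (G.orderEmbOfFin hk).monotone hij
      · by_cases hi : i < k + 1
        · simp only [τ, hj, dif_neg, not_false_eq_true]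
          exact (hGs _ (hτmem i hi)).trans hst
        · simp only [τ, hi, hj, dif_neg, not_false_eq_true, le_refl]
    have hsurj : ∀ r ∈ G, ∃ i, i < k + 1 ∧ τ i = r := by
      intro r hr
      have : r ∈ Set.range (G.orderEmbOfFin hk) := by
        rw [Finset.range_orderEmbOfFin]; exact hr
      obtain ⟨i, hi⟩ := this
      exact ⟨i, i.2, by simp only [τ, i.2, dif_pos]; exact hi⟩
    have hτ0 : τ 0 = 0 := by
      obtain ⟨i, hi, hi0⟩ := hsurj 0 (Finset.mem_insert_self _ _)
      exact le_antisymm (hi0 ▸ hτmono (Nat.zero_le i)) unitInterval.nonneg'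
    have hτk : τ k = s := by
      obtain ⟨i, hi, his⟩ := hsurj s (by simp [hG])
      exact le_antisymm (hGs _ (hτmem k (by omega))) (his ▸ hτmono (by omega))
    have hτk1 : τ (k + 1) = t := by simp [τ]
    have hinc := hind.nat hτmono
    have hm : ∀ i, Measurable fun ω => N (τ (i + 1)) ω - N (τ i) ω := fun i =>
      (hN _).fun_sub (hN _)
    have hI := hinc.indepFun_finset (Finset.range k) {k} (by simp) hm
    rw [IndepFun_iff_Indep] at hI
    refine indep_of_indep_of_le hI ?_ ?_
    · refine iSup₂_le fun r hr => iSup_le fun hrs => ?_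
      obtain ⟨j, hj, rfl⟩ := hsurj r (by simp [hG, hr, hrs])
      have e : N (τ j) = (fun x : Finset.range k → ℝ =>
          ∑ i : Finset.range k, if (i : ℕ) < j then x i else 0) ∘
          (fun ω (i : Finset.range k) => N (τ (i + 1)) ω - N (τ i) ω) := by
        funext ω
        simp only [Function.comp]
        rw [Finset.sum_coe_sort (Finset.range k)
          (fun i => if i < j then N (τ (i + 1)) ω - N (τ i) ω else 0), ← Finset.sum_filter]
        have : (Finset.range k).filter (· < j) = Finset.range j := by
          ext i; simp only [Finset.mem_filter, Finset.mem_range]; omega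
        rw [this, Finset.sum_range_sub (fun i => N (τ i) ω), hτ0, h0, sub_zero]
      rw [e, ← MeasurableSpace.comap_comp]
      refine MeasurableSpace.comap_mono (Measurable.comap_le ?_)
      refine Finset.measurable_fun_sum _ fun i _ => ?_
      split_ifs <;> fun_prop
    · have e : (fun ω => N t ω - N s ω) = (fun x : ({k} : Finset ℕ) → ℝ => x ⟨k, by simp⟩) ∘
          (fun ω (i : ({k} : Finset ℕ)) => N (τ (i + 1)) ω - N (τ i) ω) := by
        funext ω
        simp [hτk, hτk1]
      rw [e, ← MeasurableSpace.comap_comp]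
      exact MeasurableSpace.comap_mono (Measurable.comap_le (by fun_prop))
  have hsup : history N s = ⨆ F : Finset unitInterval, ⨆ r ∈ F, ⨆ _ : r ≤ s,
      MeasurableSpace.comap (N r) inferInstance := by
    refine le_antisymm (iSup₂_le fun r hr => ?_) (iSup_le fun F => iSup₂_le fun r _ =>
      iSup_le fun hr => comap_le_history N hr)
    exact le_iSup_of_le {r} (le_iSup₂_of_le r (Finset.mem_singleton_self r)
      (le_iSup_of_le hr le_rfl))
  rw [hsup]
  refine indep_iSup_of_directed_le key hle ((hN t).sub (hN s)).comap_le ?_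
  intro F G
  refine ⟨F ∪ G, ?_, ?_⟩
  · exact biSup_mono fun r hr => Finset.mem_union_left _ hr
  · exact biSup_mono fun r hr => Finset.mem_union_right _ hr

end Independence

namespace Market

variable {Ω : Type*} [mΩ : MeasurableSpace Ω] {μ : Measure Ω} (M : Market Ω μ)

lemma comap_v_le : MeasurableSpace.comap M.v inferInstance ≤ mΩ := M.v_measurable.comap_le

lemma history_Z_le (t : unitInterval) : history M.Z t ≤ history M.ZB t ⊔ history M.ZS t := by
  refine iSup₂_le fun r hr => ?_
  rw [← measurable_iff_comap_le]
  exact Measurable.fun_sub ((measurable_history M.ZB hr).mono le_sup_left le_rfl)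
    ((measurable_history M.ZS hr).mono le_sup_right le_rfl)

lemma comap_sub_le_history {Ω : Type*} (x : unitInterval → Ω → ℝ) {s t : unitInterval}
    (hst : s ≤ t) : MeasurableSpace.comap (fun ω => x t ω - x s ω) inferInstance ≤ history x t :=
  measurable_iff_comap_le.1
    ((measurable_history x le_rfl).fun_sub (measurable_history x hst))

lemma indep_v_history [IsProbabilityMeasure μ] (t : unitInterval) :
    Indep (MeasurableSpace.comap M.v inferInstance) (history M.ZB t ⊔ history M.ZS t) μ := by
  have h := (IndepFun_iff_Indep _ _ _).1 M.v_indep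
  refine indep_of_indep_of_le_right h (sup_le ?_ ?_)
  · refine (history_le_comap_path M.ZB t).trans ?_
    rw [← measurable_iff_comap_le]
    exact measurable_fst.comp (comap_measurable _)
  · refine (history_le_comap_path M.ZS t).trans ?_
    rw [← measurable_iff_comap_le]
    exact measurable_snd.comp (comap_measurable _)

lemma indep_history_noise [IsProbabilityMeasure μ] (s t : unitInterval) :
    Indep (history M.ZB s) (history M.ZS t) μ :=
  indep_of_indep_of_le ((IndepFun_iff_Indep _ _ _).1 M.noise_indep)
    (history_le_comap_path M.ZB s) (history_le_comap_path M.ZS t)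

lemma ZB_zero (ω : Ω) : M.ZB 0 ω = 0 := by
  obtain ⟨n, h0, -, -, -, h1⟩ := M.ZB_poisson.path ω
  have := h1 0
  simpa [h0, M.δ_pos.ne'] using this

lemma ZS_zero (ω : Ω) : M.ZS 0 ω = 0 := by
  obtain ⟨n, h0, -, -, -, h1⟩ := M.ZS_poisson.path ω
  have := h1 0
  simpa [h0, M.δ_pos.ne'] using this

lemma hasIndepIncrements_ZB : HasIndepIncrements M.ZB μ := by
  have := M.ZB_poisson.indep.smul M.δ
  simpa [mul_div_cancel₀, M.δ_pos.ne'] using this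

lemma hasIndepIncrements_ZS : HasIndepIncrements M.ZS μ := by
  have := M.ZS_poisson.indep.smul M.δ
  simpa [mul_div_cancel₀, M.δ_pos.ne'] using this

lemma indep_past_incr [IsProbabilityMeasure μ] {s t : unitInterval} (hst : s ≤ t) :
    Indep (MeasurableSpace.comap M.v inferInstance ⊔ (history M.ZB s ⊔ history M.ZS s))
      (MeasurableSpace.comap (fun ω => M.ZB t ω - M.ZB s ω) inferInstance ⊔
        MeasurableSpace.comap (fun ω => M.ZS t ω - M.ZS s ω) inferInstance) μ := by
  have mB := history_le M.measurable_ZB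
  have mS := history_le M.measurable_ZS
  have iB := indep_history_incr M.measurable_ZB M.ZB_zero M.hasIndepIncrements_ZB hst
  have iS := indep_history_incr M.measurable_ZS M.ZS_zero M.hasIndepIncrements_ZS hst
  have lB := comap_sub_le_history M.ZB hst
  have lS := comap_sub_le_history M.ZS hst
  have h1 := Indep.sup_sup (mB s) (lB.trans (mB t)) (mS s) (lS.trans (mS t)) iB iS
    (indep_of_indep_of_le (M.indep_history_noise t t)
      (sup_le (history_mono _ hst) lB) (sup_le (history_mono _ hst) lS))
  refine Indep.sup_left M.comap_v_le (sup_le (mB s) (mS s))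
    (sup_le (lB.trans (mB t)) (lS.trans (mS t))) ?_ h1
  refine indep_of_indep_of_le_right (M.indep_v_history t) (sup_le (sup_le_sup
    (history_mono _ hst) (history_mono _ hst)) (sup_le_sup lB lS))

lemma indep_v_history_Z_incr [IsProbabilityMeasure μ] {s t : unitInterval} (hst : s ≤ t) :
    Indep (MeasurableSpace.comap M.v inferInstance ⊔ history M.Z s)
      (MeasurableSpace.comap (fun ω => M.Z t ω - M.Z s ω) inferInstance) μ := by
  refine indep_of_indep_of_le (M.indep_past_incr hst) (sup_le_sup_left (M.history_Z_le s) _) ?_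
  rw [← measurable_iff_comap_le]
  have e : (fun ω => M.Z t ω - M.Z s ω) =
      fun ω => (M.ZB t ω - M.ZB s ω) - (M.ZS t ω - M.ZS s ω) := by
    funext ω; simp only [Z]; ring
  rw [e]
  exact Measurable.fun_sub ((comap_measurable _).mono le_sup_left le_rfl)
    ((comap_measurable _).mono le_sup_right le_rfl)

/-- The noise increments after `s` are independent of what the insider knows at time `s`. -/
lemma Admissible.indep_incr [IsProbabilityMeasure μ] {M : Market Ω μ} {S : Strategy Ω}
    (hS : M.Admissible S) {s t : unitInterval} (hst : s ≤ t) :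
    Indep (S.FI s : MeasurableSpace Ω)
      (MeasurableSpace.comap (fun ω => M.Z t ω - M.Z s ω) inferInstance) μ := by
  obtain ⟨ℋ, hℋ, hFI⟩ := hS.information
  have mZ := history_le M.measurable_Z
  have lZ := comap_sub_le_history M.Z hst
  rw [hFI, sup_comm]
  refine Indep.sup_left (ℋ.le s) (sup_le M.comap_v_le (mZ s)) (lZ.trans (mZ t)) ?_
    (M.indep_v_history_Z_incr hst)
  refine indep_of_indep_of_le hℋ (ℋ.mono unitInterval.le_one') (sup_le (sup_le_sup_left
    (history_mono _ unitInterval.le_one') _) ?_)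
  exact (lZ.trans (history_mono _ unitInterval.le_one')).trans le_sup_right

lemma indepFun_Z_sub [IsProbabilityMeasure μ] {s t u : unitInterval} (hst : s ≤ t) (htu : t ≤ u) :
    IndepFun (fun ω => M.Z t ω - M.Z s ω) (fun ω => M.Z u ω - M.Z t ω) μ := by
  rw [IndepFun_iff_Indep]
  exact indep_of_indep_of_le_left (M.indep_v_history_Z_incr htu)
    ((comap_sub_le_history M.Z hst).trans le_sup_right)

/-! ### The expected shortfall -/

/-- `E[(z - δ - y - (Z_1 - Z_t))^+]` for the threshold `z = δ m`: the expected shortfall below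
`z - δ` of the terminal demand if the insider stops trading in the state `(y, t)`. -/
noncomputable def shortfall (m : ℤ) (y : ℝ) (t : unitInterval) : ℝ :=
  ∫ ω, max (M.δ * (m - 1) - y - (M.Z 1 ω - M.Z t ω)) 0 ∂μ

lemma integrable_shortfall [IsProbabilityMeasure μ] (m : ℤ) (y : ℝ) (t : unitInterval) :
    Integrable (fun ω => max (M.δ * (m - 1) - y - (M.Z 1 ω - M.Z t ω)) 0) μ :=
  ((integrable_const _).fun_sub (M.integrable_Z_sub t 1)).pos_part

lemma shortfall_nonneg (m : ℤ) (y : ℝ) (t : unitInterval) : 0 ≤ M.shortfall m y t :=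
  integral_nonneg fun _ => le_max_right _ _

lemma shortfall_one (m : ℤ) (y : ℝ) [IsProbabilityMeasure μ] :
    M.shortfall m y 1 = max (M.δ * (m - 1) - y) 0 := by
  simp [shortfall]

lemma abs_max_sub_max_le (a b : ℝ) : |max a 0 - max b 0| ≤ |a - b| :=
  abs_max_sub_max_le_abs a b 0

lemma abs_shortfall_sub_le [IsProbabilityMeasure μ] (m : ℤ) (x y : ℝ) (t : unitInterval) :
    |M.shortfall m x t - M.shortfall m y t| ≤ |x - y| := by
  rw [shortfall, shortfall, ← integral_sub (M.integrable_shortfall m x t)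
    (M.integrable_shortfall m y t)]
  refine abs_integral_le_integral_abs.trans ?_
  refine (integral_mono ((M.integrable_shortfall m x t).fun_sub
    (M.integrable_shortfall m y t)).abs (integrable_const |x - y|) fun ω => ?_).trans (by simp)
  refine (abs_max_sub_max_le _ _).trans (le_of_eq ?_)
  rw [abs_sub_comm x y]
  congr 1
  ring

lemma abs_shortfall_time_sub_le [IsProbabilityMeasure μ] (m : ℤ) (y : ℝ) (s t : unitInterval) :
    |M.shortfall m y s - M.shortfall m y t| ≤ 2 * M.δ * M.β * |(s : ℝ) - t| := by
  rw [shortfall, shortfall, ← integral_sub (M.integrable_shortfall m y s)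
    (M.integrable_shortfall m y t)]
  refine abs_integral_le_integral_abs.trans ((integral_mono
    ((M.integrable_shortfall m y s).fun_sub (M.integrable_shortfall m y t)).abs
    (M.integrable_Z_sub t s).abs fun ω => ?_).trans (M.integral_abs_Z_sub_le t s))
  refine (abs_max_sub_max_le _ _).trans (le_of_eq ?_)
  congr 1
  ring

lemma continuous_shortfall_space [IsProbabilityMeasure μ] (m : ℤ) (t : unitInterval) :
    Continuous fun y => M.shortfall m y t :=
  (LipschitzWith.of_dist_le_mul (K := 1) fun x y => by
    simpa [Real.dist_eq] using M.abs_shortfall_sub_le m x y t).continuous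

lemma continuous_shortfall_time [IsProbabilityMeasure μ] (m : ℤ) (y : ℝ) :
    Continuous (M.shortfall m y) :=
  (LipschitzWith.of_dist_le_mul (K := (2 * M.δ * M.β).toNNReal) fun s t => by
    rw [Real.coe_toNNReal _ (by have := M.δ_pos; have := M.β_pos; positivity), Real.dist_eq,
      Subtype.dist_eq, Real.dist_eq]
    exact M.abs_shortfall_time_sub_le m y s t).continuous

/-- The Markov property of the noise. -/
lemma shortfall_eq_integral [IsProbabilityMeasure μ] (m : ℤ) (y : ℝ) {s t : unitInterval}
    (hst : s ≤ t) :
    M.shortfall m y s = ∫ ω, M.shortfall m (y + (M.Z t ω - M.Z s ω)) t ∂μ := by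
  have h := integral_of_indepFun ((M.measurable_Z t).fun_sub (M.measurable_Z s))
    ((M.measurable_Z 1).fun_sub (M.measurable_Z t)) (M.indepFun_Z_sub hst unitInterval.le_one')
    (F := fun p : ℝ × ℝ => max (M.δ * (m - 1) - (y + p.1) - p.2) 0) (by fun_prop)
    ((M.integrable_shortfall m y s).congr (ae_of_all _ fun ω => by ring_nf))
  simp only [shortfall]
  rw [← h]
  congr 1
  funext ω
  ring_nf

/-! ### The shortfall and the pricing rule -/

lemma measurable_P (z : ℝ) : Measurable (P z) :=
  Measurable.ite measurableSet_Iio measurable_const measurable_const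

lemma P_nonneg (z y : ℝ) : 0 ≤ P z y := by unfold P; split_ifs <;> norm_num

lemma P_le_one (z y : ℝ) : P z y ≤ 1 := by unfold P; split_ifs <;> norm_num

lemma integrable_P [IsProbabilityMeasure μ] (z y : ℝ) (t : unitInterval) :
    Integrable (fun ω => P z (y + (M.Z 1 ω - M.Z t ω))) μ := by
  refine (integrable_const (1 : ℝ)).mono' ((measurable_P z).comp (((M.measurable_Z 1).fun_sub
    (M.measurable_Z t)).const_add y)).aestronglyMeasurable (ae_of_all _ fun ω => ?_)
  rw [Real.norm_of_nonneg (P_nonneg _ _)]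
  exact P_le_one _ _

lemma pz_nonneg (z y : ℝ) (t : unitInterval) : 0 ≤ M.pz z y t :=
  integral_nonneg fun _ => P_nonneg _ _

lemma pz_le_one [IsProbabilityMeasure μ] (z y : ℝ) (t : unitInterval) : M.pz z y t ≤ 1 := by
  refine (integral_mono (M.integrable_P z y t) (integrable_const 1) fun ω => P_le_one _ _).trans ?_
  simp

lemma exists_int_Z_sub (s t : unitInterval) (ω : Ω) : ∃ j : ℤ, M.Z t ω - M.Z s ω = M.δ * j := by
  obtain ⟨a, ha⟩ := M.exists_int_Z t ω
  obtain ⟨b, hb⟩ := M.exists_int_Z s ω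
  exact ⟨a - b, by rw [ha, hb]; push_cast; ring⟩

lemma P_lattice (m j : ℤ) : P (M.δ * m) (M.δ * j) = if j < m then 0 else 1 := by
  have : M.δ * (j : ℝ) < M.δ * m ↔ j < m := by
    rw [mul_lt_mul_iff_right₀ M.δ_pos, Int.cast_lt]
  simp only [P, this]

/-- Buying one lot reduces the shortfall by the probability that the terminal demand stays below
the threshold. -/
lemma shortfall_add_sub [IsProbabilityMeasure μ] (m k : ℤ) (t : unitInterval) :
    M.shortfall m (M.δ * k + M.δ) t - M.shortfall m (M.δ * k) t =
      -(M.δ * (1 - M.pz (M.δ * m) (M.δ * k + M.δ) t)) := by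
  have e : M.δ * (1 - M.pz (M.δ * m) (M.δ * k + M.δ) t) =
      ∫ ω, M.δ * (1 - P (M.δ * m) (M.δ * k + M.δ + (M.Z 1 ω - M.Z t ω))) ∂μ := by
    rw [integral_const_mul, integral_sub (integrable_const _) (M.integrable_P _ _ _)]
    simp [pz]
  rw [e, shortfall, shortfall, ← integral_sub (M.integrable_shortfall _ _ _)
    (M.integrable_shortfall _ _ _), ← integral_neg]
  refine integral_congr_ae (ae_of_all _ fun ω => ?_)
  obtain ⟨j, hj⟩ := M.exists_int_Z_sub t 1 ω
  simp only [hj]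
  have e2 : M.δ * k + M.δ + M.δ * j = M.δ * ((k + 1 + j : ℤ) : ℝ) := by push_cast; ring
  rw [e2, M.P_lattice]
  have hδ := M.δ_pos
  split_ifs with h
  · have h' : (k : ℝ) + 1 + j + 1 ≤ m := by exact_mod_cast h
    rw [max_eq_left, max_eq_left]
    · ring
    · nlinarith
    · nlinarith
  · have h' : (m : ℝ) ≤ k + 1 + j := by exact_mod_cast not_lt.1 h
    rw [max_eq_right, max_eq_right]
    · ring
    · nlinarith
    · nlinarith

/-- The price is an affine function of the first difference of the shortfall. -/
lemma pz_eq_shortfall [IsProbabilityMeasure μ] (m k : ℤ) (t : unitInterval) :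
    M.pz (M.δ * m) (M.δ * k) t =
      1 + (M.shortfall m (M.δ * k) t - M.shortfall m (M.δ * k - M.δ) t) / M.δ := by
  have h := M.shortfall_add_sub m (k - 1) t
  have e : M.δ * ((k - 1 : ℤ) : ℝ) + M.δ = M.δ * k := by push_cast; ring
  have e' : M.δ * ((k - 1 : ℤ) : ℝ) = M.δ * k - M.δ := by push_cast; ring
  rw [e, e'] at h
  rw [h]
  have := M.δ_pos.ne'
  field_simp
  ring

lemma continuous_pz [IsProbabilityMeasure μ] (m k : ℤ) :
    Continuous (M.pz (M.δ * m) (M.δ * k)) := by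
  have : M.pz (M.δ * m) (M.δ * k) = fun t =>
      1 + (M.shortfall m (M.δ * k) t - M.shortfall m (M.δ * k - M.δ) t) / M.δ :=
    funext fun t => M.pz_eq_shortfall m k t
  rw [this]
  have h1 := M.continuous_shortfall_time m (M.δ * k)
  have h2 := M.continuous_shortfall_time m (M.δ * k - M.δ)
  fun_prop

/-- Before time `1`, the price strictly increases with the demand. -/
lemma pz_lt_pz_add [IsProbabilityMeasure μ] (m k : ℤ) {t : unitInterval} (ht : t < 1) :
    M.pz (M.δ * m) (M.δ * k) t < M.pz (M.δ * m) (M.δ * k + M.δ) t := by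
  rw [← sub_pos, pz, pz, ← integral_sub (M.integrable_P _ _ _) (M.integrable_P _ _ _)]
  have hδ := M.δ_pos
  have key : ∀ ω, ∃ j : ℤ, M.Z 1 ω - M.Z t ω = M.δ * j ∧
      P (M.δ * m) (M.δ * k + M.δ + (M.Z 1 ω - M.Z t ω)) -
      P (M.δ * m) (M.δ * k + (M.Z 1 ω - M.Z t ω)) = if j = m - 1 - k then 1 else 0 := by
    intro ω
    obtain ⟨j, hj⟩ := M.exists_int_Z_sub t 1 ω
    refine ⟨j, hj, ?_⟩
    have e1 : M.δ * k + M.δ + M.δ * j = M.δ * ((k + 1 + j : ℤ) : ℝ) := by push_cast; ring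
    have e2 : M.δ * k + M.δ * j = M.δ * ((k + j : ℤ) : ℝ) := by push_cast; ring
    rw [hj, e1, e2, M.P_lattice, M.P_lattice]
    split_ifs <;> first | omega | norm_num
  rw [integral_pos_iff_support_of_nonneg]
  · refine (M.measure_Z_sub_eq_pos ht (m - 1 - k)).trans_le (measure_mono fun ω hω => ?_)
    obtain ⟨j, hj, hP⟩ := key ω
    have hjk : j = m - 1 - k := by
      have h : M.δ * (j : ℝ) = M.δ * ((m - 1 - k : ℤ) : ℝ) := hj.symm.trans hω
      exact_mod_cast mul_left_cancel₀ hδ.ne' h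
    rw [Function.mem_support, hP, if_pos hjk]
    exact one_ne_zero
  · intro ω
    obtain ⟨j, -, hP⟩ := key ω
    simp only [Pi.zero_apply]
    rw [hP]
    split_ifs <;> norm_num
  · exact (M.integrable_P _ _ _).fun_sub (M.integrable_P _ _ _)

lemma pz_le_pz_add [IsProbabilityMeasure μ] (m k : ℤ) (t : unitInterval) :
    M.pz (M.δ * m) (M.δ * k) t ≤ M.pz (M.δ * m) (M.δ * k + M.δ) t := by
  refine integral_mono (M.integrable_P _ _ _) (M.integrable_P _ _ _) fun ω => ?_
  have := M.δ_pos
  simp only [P]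
  split_ifs <;> linarith

/-! ### The functions `H` and the shortfall coincide -/

lemma eq_one_of_abs_sub_le_sq {D : unitInterval → ℝ} {C : ℝ}
    (hD : ∀ s t : unitInterval, s ≤ t → |D s - D t| ≤ C * ((t : ℝ) - s) ^ 2) (t : unitInterval) :
    D t = D 1 := by
  have hC : 0 ≤ C := by simpa using (abs_nonneg _).trans (hD 0 1 unitInterval.le_one')
  have hn : ∀ n : ℕ, |D 1 - D t| ≤ C * (1 / ((n : ℝ) + 1)) := by
    intro n
    rw [← sum_grid_telescope t n D]
    refine (Finset.abs_sum_le_sum_abs _ _).trans ?_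
    have : ∀ i ∈ Finset.range (n + 1), |D (grid t n (i + 1)) - D (grid t n i)| ≤
        C * (1 / ((n : ℝ) + 1)) ^ 2 := by
      intro i hi
      rw [abs_sub_comm]
      have hm := grid_mono t n (Nat.le_succ i)
      refine (hD _ _ hm).trans ?_
      have h0 : (0 : ℝ) ≤ (grid t n (i + 1) : ℝ) - grid t n i := sub_nonneg.2 hm
      gcongr
      exact grid_succ_sub t (Finset.mem_range.1 hi)
    refine (Finset.sum_le_sum this).trans (le_of_eq ?_)
    rw [Finset.sum_const, Finset.card_range, nsmul_eq_mul]
    push_cast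
    have : (n : ℝ) + 1 ≠ 0 := by positivity
    field_simp
  have hlim : Tendsto (fun n : ℕ => C * (1 / ((n : ℝ) + 1))) atTop (𝓝 0) := by
    simpa using (tendsto_one_div_add_atTop_nhds_zero_nat (𝕜 := ℝ)).const_mul C
  have := ge_of_tendsto' hlim hn
  have := abs_nonpos_iff.1 this
  linarith

lemma measureReal_Ioc (s t : unitInterval) (hst : s ≤ t) :
    (volume : Measure unitInterval).real (Ioc s t) = (t : ℝ) - s := by
  rw [Measure.real, unitInterval.volume_Ioc, ENNReal.toReal_ofReal (sub_nonneg.2 hst)]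

/-- The integral of a Lipschitz function over a short interval, to second order. -/
lemma abs_integral_Ioc_sub_le {f : unitInterval → ℝ} {C : ℝ}
    (hf : ∀ s t, |f s - f t| ≤ C * |(s : ℝ) - t|) {s t : unitInterval} (hst : s ≤ t) :
    |(∫ u in Ioc s t, f u) - ((t : ℝ) - s) * f t| ≤ C * ((t : ℝ) - s) ^ 2 := by
  have hC : 0 ≤ C := by simpa using (abs_nonneg _).trans (hf 0 1)
  have hcont : Continuous f := (LipschitzWith.of_dist_le_mul (K := C.toNNReal) fun s t => by
    rw [Real.coe_toNNReal _ hC, Real.dist_eq, Subtype.dist_eq, Real.dist_eq]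
    exact hf s t).continuous
  have hint : IntegrableOn f (Ioc s t) volume :=
    (hcont.integrableOn_Icc (a := s) (b := t)).mono_set Ioc_subset_Icc_self
  have e : (∫ u in Ioc s t, f u) - ((t : ℝ) - s) * f t = ∫ u in Ioc s t, (f u - f t) := by
    rw [integral_sub hint (integrable_const _), setIntegral_const, measureReal_Ioc s t hst,
      smul_eq_mul]
  rw [e, ← Real.norm_eq_abs]
  refine (norm_setIntegral_le_of_norm_le_const (C := C * ((t : ℝ) - s)) ?_ fun u hu => ?_).trans
    (le_of_eq ?_)
  · rw [unitInterval.volume_Ioc]; exact ENNReal.ofReal_lt_top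
  · refine (hf u t).trans (mul_le_mul_of_nonneg_left ?_ hC)
    have h1 : (s : ℝ) < u := hu.1
    have h2 : (u : ℝ) ≤ t := hu.2
    rw [abs_sub_comm, abs_of_nonneg (by linarith)]
    linarith
  · rw [measureReal_Ioc s t hst]; ring

lemma signedSum_eq (m k : ℤ) : M.δ * signedSum k (m - 1)
    (fun j => 1 - P (M.δ * m) (M.δ * j + M.δ)) = max (M.δ * (m - 1) - M.δ * k) 0 := by
  have hδ := M.δ_pos
  have e : ∀ j : ℤ, 1 - P (M.δ * m) (M.δ * j + M.δ) = if j < m - 1 then 1 else 0 := by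
    intro j
    have : M.δ * (j : ℝ) + M.δ = M.δ * ((j + 1 : ℤ) : ℝ) := by push_cast; ring
    rw [this, M.P_lattice]
    split_ifs <;> first | omega | norm_num
  simp only [e, signedSum]
  split_ifs with h
  · have h' : (k : ℝ) ≤ m - 1 := by exact_mod_cast h
    rw [Finset.sum_ite, Finset.sum_const_zero, add_zero, Finset.sum_const, nsmul_one]
    have : (Finset.Icc k (m - 1)).filter (· < m - 1) = Finset.Ico k (m - 1) := by
      ext j; simp only [Finset.mem_filter, Finset.mem_Icc, Finset.mem_Ico]; omega
    rw [this, Int.card_Ico, max_eq_left (by nlinarith)]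
    have h2 : (((m - 1 - k).toNat : ℤ) : ℝ) = ((m - 1 - k : ℤ) : ℝ) := by
      rw [Int.toNat_of_nonneg (by omega)]
    rw [← Int.cast_natCast, h2]
    push_cast
    ring
  · have h' : (m : ℝ) - 1 ≤ k := by exact_mod_cast (not_le.1 h).le
    rw [Finset.sum_eq_zero, max_eq_right (by nlinarith)]
    · simp
    · intro j hj
      rw [if_neg]
      have := (Finset.mem_Icc.1 hj).1
      omega

/-- `H` solves the backward equation of the noise with the terminal value `(z - δ - y)^+`, hence is
the expected terminal shortfall. -/
theorem H_eq_shortfall [IsProbabilityMeasure μ] (m k : ℤ) (t : unitInterval) :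
    M.H m k t = M.shortfall m (M.δ * k) t := by
  have hδ := M.δ_pos
  have hβ := M.β_pos
  -- the second difference in space
  set Δ : unitInterval → ℝ := fun u => M.shortfall m (M.δ * k + M.δ) u +
    M.shortfall m (M.δ * k - M.δ) u - 2 * M.shortfall m (M.δ * k) u with hΔ
  have hΔLip : ∀ s t, |Δ s - Δ t| ≤ (8 * M.δ * M.β) * |(s : ℝ) - t| := by
    intro s t
    have h1 := abs_le.1 (M.abs_shortfall_time_sub_le m (M.δ * k + M.δ) s t)
    have h2 := abs_le.1 (M.abs_shortfall_time_sub_le m (M.δ * k - M.δ) s t)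
    have h3 := abs_le.1 (M.abs_shortfall_time_sub_le m (M.δ * k) s t)
    rw [abs_le]
    simp only [hΔ]
    constructor <;> linarith [h1.1, h1.2, h2.1, h2.2, h3.1, h3.2]
  have hp : ∀ u, M.pz (M.δ * m) (M.δ * k + M.δ) u - M.pz (M.δ * m) (M.δ * k) u = Δ u / M.δ := by
    intro u
    have h1 := M.pz_eq_shortfall m (k + 1) u
    rw [show M.δ * ((k + 1 : ℤ) : ℝ) = M.δ * k + M.δ by push_cast; ring,
      show M.δ * (k : ℝ) + M.δ - M.δ = M.δ * k by ring] at h1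
    rw [h1, M.pz_eq_shortfall m k u]
    simp only [hΔ]
    ring
  have hH : M.H m k t = max (M.δ * (m - 1) - M.δ * k) 0 + M.β * ∫ u in Ioc t 1, Δ u := by
    rw [H, M.signedSum_eq]
    simp only [hp]
    rw [integral_div]
    field_simp
  have hcont : Continuous Δ := by
    have h1 := M.continuous_shortfall_time m (M.δ * k + M.δ)
    have h2 := M.continuous_shortfall_time m (M.δ * k - M.δ)
    have h3 := M.continuous_shortfall_time m (M.δ * k)
    fun_prop
  set D : unitInterval → ℝ := fun t => M.shortfall m (M.δ * k) t - M.β * ∫ u in Ioc t 1, Δ u with hD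
  have hDle : ∀ s t : unitInterval, s ≤ t →
      |D s - D t| ≤ (6 * M.δ * M.β ^ 2 + M.β * (8 * M.δ * M.β)) * ((t : ℝ) - s) ^ 2 := by
    intro s t hst
    have h1 := M.abs_integral_comp_Z_sub_le hst (φ := fun x => M.shortfall m (M.δ * k + x) t)
      (K := 1) ((M.continuous_shortfall_space m t).comp (by fun_prop)).measurable
      (fun x y => by
        have := M.abs_shortfall_sub_le m (M.δ * k + x) (M.δ * k + y) t
        simpa using this)
    rw [← M.shortfall_eq_integral m (M.δ * k) hst] at h1
    have h2 := abs_integral_Ioc_sub_le hΔLip hst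
    have h3 : ∫ u in Ioc s 1, Δ u = (∫ u in Ioc s t, Δ u) + ∫ u in Ioc t 1, Δ u := by
      rw [← setIntegral_union (Ioc_disjoint_Ioc_of_le le_rfl) measurableSet_Ioc
        ((hcont.integrableOn_Icc (a := s) (b := t)).mono_set Ioc_subset_Icc_self)
        ((hcont.integrableOn_Icc (a := t) (b := 1)).mono_set Ioc_subset_Icc_self),
        Ioc_union_Ioc_eq_Ioc hst unitInterval.le_one']
    simp only [add_zero, ← sub_eq_add_neg] at h1
    have h4 : M.shortfall m (M.δ * k + M.δ) t + M.shortfall m (M.δ * k - M.δ) t -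
        2 * M.shortfall m (M.δ * k) t = Δ t := rfl
    rw [h4] at h1
    have h5 := mul_le_mul_of_nonneg_left h2 hβ.le
    rw [← abs_of_nonneg hβ.le, ← abs_mul, abs_of_nonneg hβ.le] at h5
    rw [abs_le] at h1 h5 ⊢
    simp only [hD, h3]
    constructor <;> nlinarith [h1.1, h1.2, h5.1, h5.2]
  have := eq_one_of_abs_sub_le_sq hDle t
  simp only [hD, Ioc_self, setIntegral_empty, mul_zero, sub_zero, M.shortfall_one] at this
  rw [hH, ← this]
  ring

end Market

/-! ### Jump times of the orders -/

open Classical in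
/-- The set of jump times of a path with finitely many jumps. -/
noncomputable def jumpTimes (x : unitInterval → ℝ) : Finset unitInterval :=
  if h : {s | jump x s ≠ 0}.Finite then h.toFinset else ∅

lemma jumpTimes_count {δ : ℝ} (hδ : δ ≠ 0) {J : Finset unitInterval} (hJ : 0 ∉ J) :
    jumpTimes (fun t => δ * count J t) = J := by
  have h : {s | jump (fun t => δ * count J t) s ≠ 0} = (J : Set unitInterval) := by
    ext s; simp [jump_count δ hJ, hδ]
  have hf : {s | jump (fun t => δ * count J t) s ≠ 0}.Finite := h ▸ J.finite_toSet
  rw [jumpTimes, dif_pos hf]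
  ext s
  rw [Set.Finite.mem_toFinset, h, Finset.mem_coe]

lemma IsPointPath.eq_count {δ : ℝ} (hδ : δ ≠ 0) {x : unitInterval → ℝ} (hx : IsPointPath δ x) :
    0 ∉ jumpTimes x ∧ ∀ t, x t = δ * count (jumpTimes x) t := by
  obtain ⟨J, h0, h⟩ := hx.exists_count
  obtain rfl : x = fun t => δ * count J t := funext h
  rw [jumpTimes_count hδ h0]
  exact ⟨h0, fun _ => rfl⟩

/-- Fine grids separate the points of a finite set. -/
lemma eventually_card_cell_le_one (t₀ : unitInterval) (J : Finset unitInterval) :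
    ∀ᶠ n : ℕ in atTop, ∀ i < n + 1,
      (J.filter (· ∈ Ioc (grid t₀ n i) (grid t₀ n (i + 1)))).card ≤ 1 := by
  have h : ∀ᶠ n : ℕ in atTop, ∀ s ∈ J, ∀ s' ∈ J, s ≠ s' → 1 / ((n : ℝ) + 1) < |(s : ℝ) - s'| := by
    rw [eventually_all_finset]
    intro s _
    rw [eventually_all_finset]
    intro s' _
    by_cases hs : s = s'
    · exact Eventually.of_forall fun n h => absurd hs h
    · have : 0 < |(s : ℝ) - s'| := abs_pos.2 (sub_ne_zero.2 fun h => hs (Subtype.ext h))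
      filter_upwards [(tendsto_one_div_add_atTop_nhds_zero_nat (𝕜 := ℝ)).eventually_lt_const this]
        with n hn _
      exact hn
  filter_upwards [h] with n hn i hi
  rw [Finset.card_le_one]
  intro a ha b hb
  simp only [Finset.mem_filter, Set.mem_Ioc] at ha hb
  by_contra hab
  have h1 := hn a ha.1 b hb.1 hab
  have h2 := grid_succ_sub t₀ hi
  have a1 : (grid t₀ n i : ℝ) < a := ha.2.1
  have a2 : (a : ℝ) ≤ grid t₀ n (i + 1) := ha.2.2
  have b1 : (grid t₀ n i : ℝ) < b := hb.2.1
  have b2 : (b : ℝ) ≤ grid t₀ n (i + 1) := hb.2.2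
  have : |(a : ℝ) - b| ≤ 1 / ((n : ℝ) + 1) := by
    rw [abs_le]; constructor <;> linarith
  linarith

lemma count_sub_count_eq_card (J : Finset unitInterval) {a b : unitInterval} (hab : a ≤ b) :
    count J b - count J a = ((J.filter (· ∈ Ioc a b)).card : ℝ) := by
  rw [count_sub_count J hab, Finset.card_filter]
  push_cast
  exact Finset.sum_congr rfl fun s _ => by simp [Set.indicator_apply]

/-- On fine grids two disjoint finite sets never meet the same cell, and meet each cell at most
once. -/
lemma eventually_cell_cases (t₀ : unitInterval) {J J' : Finset unitInterval} (hd : Disjoint J J') :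
    ∀ᶠ n : ℕ in atTop, ∀ i < n + 1,
      let b := count J (grid t₀ n (i + 1)) - count J (grid t₀ n i)
      let a := count J' (grid t₀ n (i + 1)) - count J' (grid t₀ n i)
      (b = 0 ∧ a = 0) ∨ (b = 1 ∧ a = 0) ∨ (b = 0 ∧ a = 1) := by
  filter_upwards [eventually_card_cell_le_one t₀ (J ∪ J')] with n hn i hi
  have h := hn i hi
  have hm : grid t₀ n i ≤ grid t₀ n (i + 1) := grid_mono t₀ n i.le_succ
  simp only [count_sub_count_eq_card J hm, count_sub_count_eq_card J' hm]
  rw [Finset.filter_union, Finset.card_union_of_disjoint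
    (Finset.disjoint_filter_filter hd)] at h
  norm_cast
  omega

namespace Market

variable {Ω : Type*} [mΩ : MeasurableSpace Ω] {μ : Measure Ω} {M : Market Ω μ} {S : Strategy Ω}

/-- The times of the insider's buy orders. -/
noncomputable def buyTimes (S : Strategy Ω) (ω : Ω) : Finset unitInterval :=
  jumpTimes fun t => S.XB t ω

/-- The times of the insider's sell orders. -/
noncomputable def sellTimes (S : Strategy Ω) (ω : Ω) : Finset unitInterval :=
  jumpTimes fun t => S.XS t ω

variable (M) in
/-- The times of the noise buy orders. -/
noncomputable def noiseBuyTimes (ω : Ω) : Finset unitInterval :=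
  jumpTimes fun t => M.ZB t ω

variable (M) in
/-- The times of the noise sell orders. -/
noncomputable def noiseSellTimes (ω : Ω) : Finset unitInterval :=
  jumpTimes fun t => M.ZS t ω

lemma Admissible.XB_eq (hS : M.Admissible S) (t : unitInterval) (ω : Ω) :
    S.XB t ω = M.δ * count (buyTimes S ω) t :=
  ((hS.buy_path ω).eq_count M.δ_pos.ne').2 t

lemma Admissible.XS_eq (hS : M.Admissible S) (t : unitInterval) (ω : Ω) :
    S.XS t ω = M.δ * count (sellTimes S ω) t :=
  ((hS.sell_path ω).eq_count M.δ_pos.ne').2 t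

lemma Admissible.zero_notMem_buyTimes (hS : M.Admissible S) (ω : Ω) : 0 ∉ buyTimes S ω :=
  ((hS.buy_path ω).eq_count M.δ_pos.ne').1

lemma Admissible.zero_notMem_sellTimes (hS : M.Admissible S) (ω : Ω) : 0 ∉ sellTimes S ω :=
  ((hS.sell_path ω).eq_count M.δ_pos.ne').1

variable (M) in
lemma noiseBuyTimes_spec (ω : Ω) :
    0 ∉ M.noiseBuyTimes ω ∧ ∀ t, M.ZB t ω = M.δ * count (M.noiseBuyTimes ω) t := by
  obtain ⟨J, h0, h⟩ := M.exists_count_ZB ω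
  have e : (fun t => M.ZB t ω) = fun t => M.δ * count J t := funext h
  rw [noiseBuyTimes, e, jumpTimes_count M.δ_pos.ne' h0]
  exact ⟨h0, h⟩

variable (M) in
lemma noiseSellTimes_spec (ω : Ω) :
    0 ∉ M.noiseSellTimes ω ∧ ∀ t, M.ZS t ω = M.δ * count (M.noiseSellTimes ω) t := by
  obtain ⟨J, h0, h⟩ := M.exists_count_ZS ω
  have e : (fun t => M.ZS t ω) = fun t => M.δ * count J t := funext h
  rw [noiseSellTimes, e, jumpTimes_count M.δ_pos.ne' h0]
  exact ⟨h0, h⟩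

lemma Admissible.Y_eq (hS : M.Admissible S) (y₀ : ℝ) (t : unitInterval) (ω : Ω) :
    M.Y S y₀ t ω = y₀ + (M.δ * count (M.noiseBuyTimes ω) t - M.δ * count (M.noiseSellTimes ω) t)
      + M.δ * count (buyTimes S ω) t - M.δ * count (sellTimes S ω) t := by
  rw [Y, Z, (M.noiseBuyTimes_spec ω).2, (M.noiseSellTimes_spec ω).2, hS.XB_eq, hS.XS_eq]

lemma Admissible.Yleft_eq (hS : M.Admissible S) (y₀ : ℝ) {t : unitInterval} (ht : 0 < t) (ω : Ω) :
    (∀ᶠ s in 𝓝[<] t, M.Y S y₀ s ω = M.Yleft S y₀ t ω) ∧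
    M.Yleft S y₀ t ω = y₀ + (M.δ * countLeft (M.noiseBuyTimes ω) t -
      M.δ * countLeft (M.noiseSellTimes ω) t)
      + M.δ * countLeft (buyTimes S ω) t - M.δ * countLeft (sellTimes S ω) t := by
  have h : ∀ᶠ s in 𝓝[<] t, M.Y S y₀ s ω = y₀ + (M.δ * countLeft (M.noiseBuyTimes ω) t -
      M.δ * countLeft (M.noiseSellTimes ω) t)
      + M.δ * countLeft (buyTimes S ω) t - M.δ * countLeft (sellTimes S ω) t := by
    filter_upwards [count_eventuallyEq_left (M.noiseBuyTimes ω) t,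
      count_eventuallyEq_left (M.noiseSellTimes ω) t, count_eventuallyEq_left (buyTimes S ω) t,
      count_eventuallyEq_left (sellTimes S ω) t] with s h1 h2 h3 h4
    rw [hS.Y_eq, h1, h2, h3, h4]
  have e := leftLim_eq_of_eventually ht h
  refine ⟨h.mono fun s hs => hs.trans e.symm, e⟩

lemma Admissible.Y_eventuallyEq_right (hS : M.Admissible S) (y₀ : ℝ) (t : unitInterval) (ω : Ω) :
    ∀ᶠ s in 𝓝[≥] t, M.Y S y₀ s ω = M.Y S y₀ t ω := by
  filter_upwards [count_eventuallyEq_right (M.noiseBuyTimes ω) t,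
    count_eventuallyEq_right (M.noiseSellTimes ω) t, count_eventuallyEq_right (buyTimes S ω) t,
    count_eventuallyEq_right (sellTimes S ω) t] with s h1 h2 h3 h4
  rw [hS.Y_eq, hS.Y_eq, h1, h2, h3, h4]

lemma Admissible.exists_int_Y (hS : M.Admissible S) (k₀ : ℤ) (t : unitInterval) (ω : Ω) :
    ∃ k : ℤ, M.Y S (M.δ * k₀) t ω = M.δ * k := by
  refine ⟨k₀ + (((M.noiseBuyTimes ω).filter (· ≤ t)).card -
    ((M.noiseSellTimes ω).filter (· ≤ t)).card) + ((buyTimes S ω).filter (· ≤ t)).card -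
    ((sellTimes S ω).filter (· ≤ t)).card, ?_⟩
  rw [hS.Y_eq]
  simp only [count]
  push_cast
  ring

lemma Admissible.exists_int_Yleft (hS : M.Admissible S) (k₀ : ℤ) {t : unitInterval} (ht : 0 < t)
    (ω : Ω) : ∃ k : ℤ, M.Yleft S (M.δ * k₀) t ω = M.δ * k := by
  have := nhdsLT_neBot_of_pos ht
  obtain ⟨s, hs⟩ := (hS.Yleft_eq (M.δ * k₀) ht ω).1.exists
  rw [← hs]
  exact hS.exists_int_Y k₀ s ω

/-! ### Measurability and integrability -/

lemma Admissible.comap_v_le_FI (hS : M.Admissible S) (t : unitInterval) :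
    MeasurableSpace.comap M.v inferInstance ≤ (S.FI t : MeasurableSpace Ω) := by
  obtain ⟨ℋ, -, h⟩ := hS.information
  rw [h]
  exact le_sup_left.trans le_sup_left

lemma Admissible.measurableSet_v_eq (hS : M.Admissible S) (x : ℝ) (t : unitInterval) :
    MeasurableSet[S.FI t] {ω | M.v ω = x} :=
  hS.comap_v_le_FI t _ ⟨{x}, measurableSet_singleton x, rfl⟩

lemma Admissible.measurable_Z_FI (hS : M.Admissible S) (t : unitInterval) :
    Measurable[S.FI t] (M.Z t) := by
  obtain ⟨ℋ, -, h⟩ := hS.information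
  rw [h]
  exact (measurable_history M.Z le_rfl).mono (le_sup_right.trans le_sup_left) le_rfl

lemma Admissible.measurable_Y_FI (hS : M.Admissible S) (y₀ : ℝ) (t : unitInterval) :
    Measurable[S.FI t] (M.Y S y₀ t) := by
  unfold Y
  exact (((hS.measurable_Z_FI t).const_add y₀).fun_add (hS.buy_adapted t)).fun_sub
    (hS.sell_adapted t)

lemma Admissible.measurable_Y (hS : M.Admissible S) (y₀ : ℝ) (t : unitInterval) :
    Measurable (M.Y S y₀ t) :=
  (hS.measurable_Y_FI y₀ t).mono (S.FI.le t) le_rfl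

lemma Admissible.measurable_XB (hS : M.Admissible S) (t : unitInterval) : Measurable (S.XB t) :=
  (hS.buy_adapted t).mono (S.FI.le t) le_rfl

lemma Admissible.measurable_XS (hS : M.Admissible S) (t : unitInterval) : Measurable (S.XS t) :=
  (hS.sell_adapted t).mono (S.FI.le t) le_rfl

lemma Admissible.XB_mono (hS : M.Admissible S) (ω : Ω) : Monotone fun t => S.XB t ω := by
  intro s t hst
  simp only [hS.XB_eq]
  exact mul_le_mul_of_nonneg_left (count_mono _ hst) M.δ_pos.le

lemma Admissible.XS_mono (hS : M.Admissible S) (ω : Ω) : Monotone fun t => S.XS t ω := by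
  intro s t hst
  simp only [hS.XS_eq]
  exact mul_le_mul_of_nonneg_left (count_mono _ hst) M.δ_pos.le

lemma Admissible.XB_nonneg (hS : M.Admissible S) (t : unitInterval) (ω : Ω) : 0 ≤ S.XB t ω := by
  rw [hS.XB_eq]; exact mul_nonneg M.δ_pos.le (count_nonneg _ _)

lemma Admissible.XS_nonneg (hS : M.Admissible S) (t : unitInterval) (ω : Ω) : 0 ≤ S.XS t ω := by
  rw [hS.XS_eq]; exact mul_nonneg M.δ_pos.le (count_nonneg _ _)

lemma Admissible.integrable_XB (hS : M.Admissible S) (t : unitInterval) :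
    Integrable (S.XB t) μ :=
  hS.buy_integrable.mono' (hS.measurable_XB t).aestronglyMeasurable (ae_of_all _ fun ω => by
    rw [Real.norm_of_nonneg (hS.XB_nonneg t ω)]; exact hS.XB_mono ω unitInterval.le_one')

lemma Admissible.integrable_XS (hS : M.Admissible S) (t : unitInterval) :
    Integrable (S.XS t) μ :=
  hS.sell_integrable.mono' (hS.measurable_XS t).aestronglyMeasurable (ae_of_all _ fun ω => by
    rw [Real.norm_of_nonneg (hS.XS_nonneg t ω)]; exact hS.XS_mono ω unitInterval.le_one')

lemma Admissible.integrable_Y [IsProbabilityMeasure μ] (hS : M.Admissible S) (y₀ : ℝ)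
    (t : unitInterval) : Integrable (M.Y S y₀ t) μ := by
  unfold Y
  exact (((integrable_const y₀).fun_add (M.integrable_Z t)).fun_add
    (hS.integrable_XB t)).fun_sub (hS.integrable_XS t)

lemma Admissible.disjoint_times (hS : M.Admissible S) :
    ∀ᵐ ω ∂μ, Disjoint (buyTimes S ω) (sellTimes S ω) := by
  filter_upwards [hS.no_opposite] with ω hω
  rw [Finset.disjoint_left]
  intro s hb ha
  have eB : (fun t => S.XB t ω) = fun t => M.δ * count (buyTimes S ω) t :=
    funext fun t => hS.XB_eq t ω
  have eS : (fun t => S.XS t ω) = fun t => M.δ * count (sellTimes S ω) t :=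
    funext fun t => hS.XS_eq t ω
  have := hω s
  rw [eB, eS, jump_count _ (hS.zero_notMem_buyTimes ω), jump_count _ (hS.zero_notMem_sellTimes ω),
    if_pos hb, if_pos ha] at this
  exact this.elim M.δ_pos.ne' M.δ_pos.ne'

lemma integrable_shortfall_comp [IsProbabilityMeasure μ] (m : ℤ) (t : unitInterval) {f : Ω → ℝ}
    (hm : Measurable f) (hf : Integrable f μ) :
    Integrable (fun ω => M.shortfall m (f ω) t) μ := by
  refine (hf.abs.fun_add (integrable_const |M.shortfall m 0 t|)).mono'
    ((M.continuous_shortfall_space m t).measurable.comp hm).aestronglyMeasurable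
    (ae_of_all _ fun ω => ?_)
  have h1 := M.abs_shortfall_sub_le m (f ω) 0 t
  have h2 := abs_sub_abs_le_abs_sub (M.shortfall m (f ω) t) (M.shortfall m 0 t)
  rw [sub_zero] at h1
  rw [Real.norm_eq_abs]
  linarith

/-- The expected shortfall does not change, on average, if only the noise trades. -/
lemma Admissible.setIntegral_shortfall_step [IsProbabilityMeasure μ] (hS : M.Admissible S) (m : ℤ)
    (y₀ : ℝ) {s t : unitInterval} (hst : s ≤ t) {A : Set Ω} (hA : MeasurableSet[S.FI s] A) :
    ∫ ω in A, M.shortfall m (M.Y S y₀ s ω + (M.Z t ω - M.Z s ω)) t ∂μ =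
      ∫ ω in A, M.shortfall m (M.Y S y₀ s ω) s ∂μ := by
  have hA' : MeasurableSet A := S.FI.le s _ hA
  have hmW : Measurable fun ω => M.Z t ω - M.Z s ω := (M.measurable_Z t).fun_sub (M.measurable_Z s)
  have hmX : Measurable[S.FI s] fun ω => (A.indicator (fun _ => (1 : ℝ)) ω, M.Y S y₀ s ω) :=
    (measurable_const.indicator hA).prodMk (hS.measurable_Y_FI y₀ s)
  have hind : IndepFun (fun ω => (A.indicator (fun _ => (1 : ℝ)) ω, M.Y S y₀ s ω))
      (fun ω => M.Z t ω - M.Z s ω) μ := by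
    rw [IndepFun_iff_Indep]
    exact indep_of_indep_of_le_left (hS.indep_incr hst) hmX.comap_le
  have hF : Measurable fun p : (ℝ × ℝ) × ℝ => p.1.1 * M.shortfall m (p.1.2 + p.2) t :=
    (measurable_fst.comp measurable_fst).mul ((M.continuous_shortfall_space m t).measurable.comp
      ((measurable_snd.comp measurable_fst).add measurable_snd))
  have hi : Integrable (fun ω => M.shortfall m (M.Y S y₀ s ω + (M.Z t ω - M.Z s ω)) t) μ :=
    integrable_shortfall_comp m t ((hS.measurable_Y y₀ s).fun_add hmW)
      ((hS.integrable_Y y₀ s).fun_add (M.integrable_Z_sub s t))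
  have key := integral_of_indepFun (hmX.mono (S.FI.le s) le_rfl) hmW hind hF (by
    refine (hi.indicator hA').congr (ae_of_all _ fun ω => ?_)
    by_cases h : ω ∈ A <;> simp [h])
  simp only [integral_const_mul, ← M.shortfall_eq_integral m _ hst] at key
  rw [← integral_indicator hA', ← integral_indicator hA']
  convert key using 2 <;>
  · funext ω
    by_cases h : ω ∈ A <;> simp [h]

/-! ### Sums over the insider's orders -/

/-- A bounded function of demand and time that may serve as the gain of an order: it is measurable
in the demand and, at lattice points, continuous in time. -/
structure IsGain (M : Market Ω μ) (q : ℝ → unitInterval → ℝ) : Prop where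
  measurable : ∀ t, Measurable fun y => q y t
  bound : ∀ y t, |q y t| ≤ 1
  continuous : ∀ k : ℤ, Continuous (q (M.δ * k))

/-- The sum over the times of `J` in `(t₀, 1]` of the gains `δ q(Y_s, s)`. -/
noncomputable def orderSum (M : Market Ω μ) (S : Strategy Ω) (y₀ : ℝ) (t₀ : unitInterval)
    (J : Ω → Finset unitInterval) (q : ℝ → unitInterval → ℝ) (ω : Ω) : ℝ :=
  ∑ s ∈ J ω with t₀ < s, M.δ * q (M.Y S y₀ s ω) s

lemma Admissible.tendsto_orderSum (hS : M.Admissible S) (k₀ : ℤ) (t₀ : unitInterval)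
    (J : Ω → Finset unitInterval) {q : ℝ → unitInterval → ℝ} (hq : IsGain M q) (ω : Ω) :
    Tendsto (fun n => ∑ i ∈ Finset.range (n + 1),
      q (M.Y S (M.δ * k₀) (grid t₀ n (i + 1)) ω) (grid t₀ n (i + 1)) *
        (M.δ * count (J ω) (grid t₀ n (i + 1)) - M.δ * count (J ω) (grid t₀ n i))) atTop
      (𝓝 (M.orderSum S (M.δ * k₀) t₀ J q ω)) := by
  have h := tendsto_sum_grid_right t₀ (J ω)
    (f := fun t => M.δ * q (M.Y S (M.δ * k₀) t ω) t)
    (g := fun t => M.δ * q (M.Y S (M.δ * k₀) t ω) t) (by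
      intro s _ _
      obtain ⟨k, hk⟩ := hS.exists_int_Y k₀ s ω
      have : Tendsto (fun t => M.δ * q (M.δ * k) t) (𝓝[≥] s) (𝓝 (M.δ * q (M.δ * k) s)) :=
        (((hq.continuous k).tendsto s).mono_left nhdsWithin_le_nhds).const_mul _
      rw [hk]
      refine this.congr' ?_
      filter_upwards [hS.Y_eventuallyEq_right (M.δ * k₀) s ω] with t ht
      rw [ht, hk])
  refine h.congr fun n => Finset.sum_congr rfl fun i _ => ?_
  ring

lemma abs_orderSum_le (M : Market Ω μ) (S : Strategy Ω) (y₀ : ℝ) (t₀ : unitInterval)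
    (J : Ω → Finset unitInterval) {q : ℝ → unitInterval → ℝ} (hq : IsGain M q) (ω : Ω) :
    |M.orderSum S y₀ t₀ J q ω| ≤ M.δ * count (J ω) 1 := by
  refine (Finset.abs_sum_le_sum_abs _ _).trans ?_
  have : ∀ s ∈ (J ω).filter (t₀ < ·), |M.δ * q (M.Y S y₀ s ω) s| ≤ M.δ := by
    intro s _
    rw [abs_mul, abs_of_pos M.δ_pos]
    nlinarith [hq.bound (M.Y S y₀ s ω) s, M.δ_pos]
  refine (Finset.sum_le_sum this).trans ?_
  rw [Finset.sum_const, nsmul_eq_mul, mul_comm, count_one]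
  refine mul_le_mul_of_nonneg_left ?_ M.δ_pos.le
  exact_mod_cast Finset.card_filter_le _ _

lemma Admissible.integrable_orderSum_buy (hS : M.Admissible S) (k₀ : ℤ) (t₀ : unitInterval)
    {q : ℝ → unitInterval → ℝ} (hq : IsGain M q) :
    Integrable (M.orderSum S (M.δ * k₀) t₀ (buyTimes S) q) μ := by
  refine (hS.integrable_XB 1).mono' ?_ (ae_of_all _ fun ω => ?_)
  · refine aestronglyMeasurable_of_tendsto_ae atTop (fun n => ?_)
      (ae_of_all _ fun ω => hS.tendsto_orderSum k₀ t₀ (buyTimes S) hq ω)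
    simp only [← hS.XB_eq]
    exact (Finset.measurable_fun_sum _ fun i _ => ((hq.measurable _).comp
      (hS.measurable_Y _ _)).mul ((hS.measurable_XB _).fun_sub
        (hS.measurable_XB _))).aestronglyMeasurable
  · rw [hS.XB_eq]
    exact M.abs_orderSum_le S _ t₀ _ hq ω

lemma Admissible.integrable_orderSum_sell (hS : M.Admissible S) (k₀ : ℤ) (t₀ : unitInterval)
    {q : ℝ → unitInterval → ℝ} (hq : IsGain M q) :
    Integrable (M.orderSum S (M.δ * k₀) t₀ (sellTimes S) q) μ := by
  refine (hS.integrable_XS 1).mono' ?_ (ae_of_all _ fun ω => ?_)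
  · refine aestronglyMeasurable_of_tendsto_ae atTop (fun n => ?_)
      (ae_of_all _ fun ω => hS.tendsto_orderSum k₀ t₀ (sellTimes S) hq ω)
    simp only [← hS.XS_eq]
    exact (Finset.measurable_fun_sum _ fun i _ => ((hq.measurable _).comp
      (hS.measurable_Y _ _)).mul ((hS.measurable_XS _).fun_sub
        (hS.measurable_XS _))).aestronglyMeasurable
  · rw [hS.XS_eq]
    exact M.abs_orderSum_le S _ t₀ _ hq ω

lemma monotone_P (z : ℝ) : Monotone (P z) := by
  intro x y hxy
  simp only [P]
  split_ifs <;> linarith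

lemma monotone_pz [IsProbabilityMeasure μ] (M : Market Ω μ) (z : ℝ) (t : unitInterval) :
    Monotone fun y => M.pz z y t := by
  intro x y hxy
  refine integral_mono (M.integrable_P _ _ _) (M.integrable_P _ _ _) fun ω => ?_
  exact monotone_P z (by linarith)

/-- The gain of a buy order for the high type, as a function of the demand after the order. -/
lemma isGain_one_sub_pz [IsProbabilityMeasure μ] (M : Market Ω μ) (m : ℤ) :
    IsGain M fun y t => 1 - M.pz (M.δ * m) y t where
  measurable t := (M.monotone_pz _ t).measurable.const_sub 1
  bound y t := by
    have := M.pz_nonneg (M.δ * m) y t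
    have := M.pz_le_one (M.δ * m) y t
    rw [abs_of_nonneg (by linarith)]; linarith
  continuous k := continuous_const.sub (M.continuous_pz m k)

lemma isGain_one_sub_pz_add [IsProbabilityMeasure μ] (M : Market Ω μ) (m : ℤ) :
    IsGain M fun y t => 1 - M.pz (M.δ * m) (y + M.δ) t where
  measurable t := ((M.monotone_pz _ t).measurable.comp (measurable_add_const _)).const_sub 1
  bound y t := by
    have := M.pz_nonneg (M.δ * m) (y + M.δ) t
    have := M.pz_le_one (M.δ * m) (y + M.δ) t
    rw [abs_of_nonneg (by linarith)]; linarith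
  continuous k := by
    have := M.continuous_pz m (k + 1)
    rw [show M.δ * ((k + 1 : ℤ) : ℝ) = M.δ * k + M.δ by push_cast; ring] at this
    exact continuous_const.sub this

/-- The loss from a sell order compared with not trading, as a function of the demand after the
order. -/
lemma isGain_pz_add_sub_pz [IsProbabilityMeasure μ] (M : Market Ω μ) (m : ℤ) :
    IsGain M fun y t => M.pz (M.δ * m) (y + M.δ) t - M.pz (M.δ * m) y t where
  measurable t := ((M.monotone_pz _ t).measurable.comp (measurable_add_const _)).fun_sub
    (M.monotone_pz _ t).measurable
  bound y t := by
    have := M.pz_nonneg (M.δ * m) (y + M.δ) t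
    have := M.pz_le_one (M.δ * m) (y + M.δ) t
    have := M.pz_nonneg (M.δ * m) y t
    have := M.pz_le_one (M.δ * m) y t
    rw [abs_le]; constructor <;> linarith
  continuous k := by
    have := M.continuous_pz m (k + 1)
    rw [show M.δ * ((k + 1 : ℤ) : ℝ) = M.δ * k + M.δ by push_cast; ring] at this
    exact this.sub (M.continuous_pz m k)

/-! ### The verification identity -/

/-- The change of the shortfall caused by the insider's own orders in one cell of the grid. -/
noncomputable def tradeEffect (M : Market Ω μ) (S : Strategy Ω) (m : ℤ) (y₀ : ℝ)
    (s t : unitInterval) (ω : Ω) : ℝ :=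
  M.shortfall m (M.Y S y₀ t ω) t - M.shortfall m (M.Y S y₀ s ω + (M.Z t ω - M.Z s ω)) t

lemma Admissible.tendsto_sum_tradeEffect [IsProbabilityMeasure μ] (hS : M.Admissible S) (m k₀ : ℤ)
    (t₀ : unitInterval) {ω : Ω} (hω : Disjoint (buyTimes S ω) (sellTimes S ω)) :
    Tendsto (fun n => ∑ i ∈ Finset.range (n + 1),
      M.tradeEffect S m (M.δ * k₀) (grid t₀ n i) (grid t₀ n (i + 1)) ω) atTop
      (𝓝 (M.orderSum S (M.δ * k₀) t₀ (sellTimes S)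
          (fun y t => 1 - M.pz (M.δ * m) (y + M.δ) t) ω -
        M.orderSum S (M.δ * k₀) t₀ (buyTimes S) (fun y t => 1 - M.pz (M.δ * m) y t) ω)) := by
  refine ((hS.tendsto_orderSum k₀ t₀ (sellTimes S) (M.isGain_one_sub_pz_add m) ω).sub
    (hS.tendsto_orderSum k₀ t₀ (buyTimes S) (M.isGain_one_sub_pz m) ω)).congr' ?_
  filter_upwards [eventually_cell_cases t₀ hω] with n hn
  rw [← Finset.sum_sub_distrib]
  refine Finset.sum_congr rfl fun i hi => ?_
  have hcell := hn i (Finset.mem_range.1 hi)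
  simp only at hcell
  set s := grid t₀ n i
  set t := grid t₀ n (i + 1)
  obtain ⟨k, hk⟩ := hS.exists_int_Y k₀ t ω
  have hYs : M.Y S (M.δ * k₀) s ω + (M.Z t ω - M.Z s ω) = M.δ * k -
      M.δ * (count (buyTimes S ω) t - count (buyTimes S ω) s) +
      M.δ * (count (sellTimes S ω) t - count (sellTimes S ω) s) := by
    rw [← hk]
    simp only [Y, hS.XB_eq, hS.XS_eq]
    ring
  have h1 := M.shortfall_add_sub m (k - 1) t
  have h2 := M.shortfall_add_sub m k t
  rw [show M.δ * ((k - 1 : ℤ) : ℝ) + M.δ = M.δ * k by push_cast; ring,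
    show M.δ * ((k - 1 : ℤ) : ℝ) = M.δ * k - M.δ by push_cast; ring] at h1
  rw [tradeEffect, hYs, hk, ← mul_sub M.δ, ← mul_sub M.δ]
  rcases hcell with ⟨hb, ha⟩ | ⟨hb, ha⟩ | ⟨hb, ha⟩ <;> rw [hb, ha]
  · simp
  · simp only [mul_zero, add_zero, mul_one, zero_sub]
    linarith
  · simp only [mul_zero, sub_zero, mul_one]
    linarith

lemma Admissible.abs_sum_tradeEffect_le [IsProbabilityMeasure μ] (hS : M.Admissible S) (m : ℤ)
    (y₀ : ℝ) (t₀ : unitInterval) (n : ℕ) (ω : Ω) :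
    |∑ i ∈ Finset.range (n + 1), M.tradeEffect S m y₀ (grid t₀ n i) (grid t₀ n (i + 1)) ω| ≤
      S.XB 1 ω + S.XS 1 ω := by
  refine (Finset.abs_sum_le_sum_abs _ _).trans ?_
  have h : ∀ i ∈ Finset.range (n + 1),
      |M.tradeEffect S m y₀ (grid t₀ n i) (grid t₀ n (i + 1)) ω| ≤
      (S.XB (grid t₀ n (i + 1)) ω + S.XS (grid t₀ n (i + 1)) ω) -
      (S.XB (grid t₀ n i) ω + S.XS (grid t₀ n i) ω) := by
    intro i _
    have hm := grid_mono t₀ n i.le_succ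
    have h1 := hS.XB_mono ω hm
    have h2 := hS.XS_mono ω hm
    refine (M.abs_shortfall_sub_le m _ _ _).trans ?_
    simp only [Y] at h1 h2 ⊢
    rw [abs_le]
    constructor <;> linarith
  refine (Finset.sum_le_sum h).trans ?_
  rw [sum_grid_telescope t₀ n (fun t => S.XB t ω + S.XS t ω)]
  linarith [hS.XB_nonneg t₀ ω, hS.XS_nonneg t₀ ω]

/-- The average change of the shortfall between `t₀` and `1` is caused by the insider's orders
only. -/
lemma Admissible.setIntegral_shortfall_sub [IsProbabilityMeasure μ] (hS : M.Admissible S)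
    (m k₀ : ℤ) (t₀ : unitInterval) {A : Set Ω} (hA : MeasurableSet[S.FI t₀] A) :
    ∫ ω in A, M.shortfall m (M.Y S (M.δ * k₀) 1 ω) 1 ∂μ -
      ∫ ω in A, M.shortfall m (M.Y S (M.δ * k₀) t₀ ω) t₀ ∂μ =
    ∫ ω in A, (M.orderSum S (M.δ * k₀) t₀ (sellTimes S)
          (fun y t => 1 - M.pz (M.δ * m) (y + M.δ) t) ω -
        M.orderSum S (M.δ * k₀) t₀ (buyTimes S) (fun y t => 1 - M.pz (M.δ * m) y t) ω) ∂μ := by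
  have hi : ∀ t, Integrable (fun ω => M.shortfall m (M.Y S (M.δ * k₀) t ω) t) μ := fun t =>
    integrable_shortfall_comp m t (hS.measurable_Y _ t) (hS.integrable_Y _ t)
  have hi' : ∀ s t, Integrable (fun ω => M.shortfall m (M.Y S (M.δ * k₀) s ω +
      (M.Z t ω - M.Z s ω)) t) μ := fun s t =>
    integrable_shortfall_comp m t ((hS.measurable_Y _ s).fun_add
      ((M.measurable_Z t).fun_sub (M.measurable_Z s)))
      ((hS.integrable_Y _ s).fun_add (M.integrable_Z_sub s t))
  have hte : ∀ s t, Integrable (M.tradeEffect S m (M.δ * k₀) s t) μ := fun s t =>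
    (hi t).fun_sub (hi' s t)
  have hconst : ∀ n, ∫ ω in A, ∑ i ∈ Finset.range (n + 1),
      M.tradeEffect S m (M.δ * k₀) (grid t₀ n i) (grid t₀ n (i + 1)) ω ∂μ =
      ∫ ω in A, M.shortfall m (M.Y S (M.δ * k₀) 1 ω) 1 ∂μ -
      ∫ ω in A, M.shortfall m (M.Y S (M.δ * k₀) t₀ ω) t₀ ∂μ := by
    intro n
    rw [integral_finsetSum _ fun i _ => (hte _ _).integrableOn,
      ← sum_grid_telescope t₀ n
        (fun t => ∫ ω in A, M.shortfall m (M.Y S (M.δ * k₀) t ω) t ∂μ)]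
    refine Finset.sum_congr rfl fun i _ => ?_
    have hm := grid_mono t₀ n i.le_succ
    have hA' : MeasurableSet[S.FI (grid t₀ n i)] A := by
      refine S.FI.mono ?_ _ hA
      have := grid_mono t₀ n (Nat.zero_le i)
      rwa [grid_zero] at this
    rw [← hS.setIntegral_shortfall_step m _ hm hA']
    exact integral_sub (hi _).integrableOn (hi' _ _).integrableOn
  refine tendsto_nhds_unique (tendsto_const_nhds (f := (atTop : Filter ℕ))) ?_
  refine (tendsto_integral_of_dominated_convergence (fun ω => S.XB 1 ω + S.XS 1 ω) (fun n => ?_)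
    ((hS.integrable_XB 1).fun_add (hS.integrable_XS 1)).integrableOn (fun n => ?_) ?_).congr hconst
  · exact (integrable_finsetSum _ fun i _ => hte _ _).1.restrict
  · exact ae_of_all _ fun ω => hS.abs_sum_tradeEffect_le m _ t₀ n ω
  · refine ae_restrict_of_ae ?_
    filter_upwards [hS.disjoint_times] with ω hω
    exact hS.tendsto_sum_tradeEffect m k₀ t₀ hω

end Market

/-! ### Simultaneous noise orders -/

lemma IsPoissonProcess.measureReal_incr_ne_zero_le {Ω : Type*} [MeasurableSpace Ω] {μ : Measure Ω}
    [IsProbabilityMeasure μ] {N : unitInterval → Ω → ℝ} {β : ℝ} (hβ : 0 ≤ β)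
    (hN : IsPoissonProcess N β μ) {s t : unitInterval} (hst : s ≤ t) :
    μ.real {ω | N t ω - N s ω ≠ 0} ≤ β * ((t : ℝ) - s) := by
  have hm : Measurable fun ω => N t ω - N s ω := (hN.measurable t).fun_sub (hN.measurable s)
  have h0 : (0 : ℝ) ≤ β * ((t : ℝ) - s) := mul_nonneg hβ (sub_nonneg.2 hst)
  have h1 : μ.real {ω | N t ω - N s ω = 0} = Real.exp (-(β * ((t : ℝ) - s))) := by
    have e : {ω | N t ω - N s ω = 0} = (fun ω => N t ω - N s ω) ⁻¹' {0} := rfl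
    rw [e, ← map_measureReal_apply hm (measurableSet_singleton _), (hN.law s t hst).map_eq,
      map_measureReal_apply .of_discrete (measurableSet_singleton _)]
    have : (Nat.cast : ℕ → ℝ) ⁻¹' {0} = {0} := by ext n; simp
    rw [this, poissonMeasure_real_singleton, Real.coe_toNNReal _ h0]
    simp
  have h2 : {ω | N t ω - N s ω ≠ 0} = {ω | N t ω - N s ω = 0}ᶜ := rfl
  have hms : MeasurableSet {ω | N t ω - N s ω = 0} := hm (measurableSet_singleton 0)
  rw [h2, measureReal_compl hms, h1]
  have := Real.add_one_le_exp (-(β * ((t : ℝ) - s)))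
  simp only [probReal_univ]
  linarith

namespace Market

variable {Ω : Type*} [mΩ : MeasurableSpace Ω] {μ : Measure Ω} {M : Market Ω μ} {S : Strategy Ω}

lemma exists_incr_ne_zero_of_mem {J : Finset unitInterval} {s : unitInterval} (hs : s ∈ J)
    {a b : unitInterval} (ha : a < s) (hb : s ≤ b) : count J b - count J a ≠ 0 := by
  rw [count_sub_count_eq_card J (ha.le.trans hb)]
  have : s ∈ J.filter (· ∈ Ioc a b) := Finset.mem_filter.2 ⟨hs, ha, hb⟩
  exact_mod_cast Finset.card_ne_zero_of_mem this

/-- Almost surely noise buy orders and noise sell orders never arrive together. -/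
lemma disjoint_noiseTimes [IsProbabilityMeasure μ] (M : Market Ω μ) :
    ∀ᵐ ω ∂μ, Disjoint (M.noiseBuyTimes ω) (M.noiseSellTimes ω) := by
  have hβ := M.β_pos
  -- the event that some cell of the grid contains noise orders of both signs
  set E : ℕ → Set Ω := fun n => ⋃ i ∈ Finset.range (n + 1),
    {ω | M.ZB (grid 0 n (i + 1)) ω / M.δ - M.ZB (grid 0 n i) ω / M.δ ≠ 0} ∩
    {ω | M.ZS (grid 0 n (i + 1)) ω / M.δ - M.ZS (grid 0 n i) ω / M.δ ≠ 0} with hE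
  have hEle : ∀ n, μ.real (E n) ≤ M.β ^ 2 * (1 / ((n : ℝ) + 1)) := by
    intro n
    refine (measureReal_biUnion_finset_le _ _).trans ?_
    have : ∀ i ∈ Finset.range (n + 1), μ.real
        ({ω | M.ZB (grid 0 n (i + 1)) ω / M.δ - M.ZB (grid 0 n i) ω / M.δ ≠ 0} ∩
        {ω | M.ZS (grid 0 n (i + 1)) ω / M.δ - M.ZS (grid 0 n i) ω / M.δ ≠ 0}) ≤
        (M.β * (1 / ((n : ℝ) + 1))) ^ 2 := by
      intro i hi
      have hm : grid 0 n i ≤ grid 0 n (i + 1) := grid_mono 0 n i.le_succ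
      have hf : Measurable fun x : unitInterval → ℝ =>
        x (grid 0 n (i + 1)) / M.δ - x (grid 0 n i) / M.δ := by fun_prop
      have hind := (M.noise_indep.comp hf hf).measure_inter_preimage_eq_mul {0}ᶜ {0}ᶜ
        (measurableSet_singleton (0 : ℝ)).compl (measurableSet_singleton (0 : ℝ)).compl
      have hind' := congrArg ENNReal.toReal hind
      rw [ENNReal.toReal_mul] at hind'
      have hg := grid_succ_sub 0 (Finset.mem_range.1 hi)
      have h1 := (M.ZB_poisson.measureReal_incr_ne_zero_le hβ.le hm).trans
        (mul_le_mul_of_nonneg_left hg hβ.le)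
      have h2 := (M.ZS_poisson.measureReal_incr_ne_zero_le hβ.le hm).trans
        (mul_le_mul_of_nonneg_left hg hβ.le)
      refine hind'.le.trans ?_
      rw [pow_two]
      exact mul_le_mul h1 h2 ENNReal.toReal_nonneg (by positivity)
    refine (Finset.sum_le_sum this).trans (le_of_eq ?_)
    rw [Finset.sum_const, Finset.card_range, nsmul_eq_mul]
    push_cast
    have : (n : ℝ) + 1 ≠ 0 := by positivity
    field_simp
  have hsub : ∀ n, {ω | ¬ Disjoint (M.noiseBuyTimes ω) (M.noiseSellTimes ω)} ⊆ E n := by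
    intro n ω hω
    rw [mem_ofPred_eq, Finset.not_disjoint_iff] at hω
    obtain ⟨s, hb, ha⟩ := hω
    have hs : 0 < s := lt_of_le_of_ne unitInterval.nonneg' fun h =>
      (M.noiseBuyTimes_spec ω).1 (h ▸ hb)
    obtain ⟨i, hi, h1, h2⟩ := exists_grid_cell hs n
    refine mem_biUnion (Finset.mem_range.2 hi) ⟨?_, ?_⟩
    · have := exists_incr_ne_zero_of_mem hb h1 h2
      simp only [mem_ofPred_eq, (M.noiseBuyTimes_spec ω).2]
      rwa [mul_div_cancel_left₀ _ M.δ_pos.ne', mul_div_cancel_left₀ _ M.δ_pos.ne']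
    · have := exists_incr_ne_zero_of_mem ha h1 h2
      simp only [mem_ofPred_eq, (M.noiseSellTimes_spec ω).2]
      rwa [mul_div_cancel_left₀ _ M.δ_pos.ne', mul_div_cancel_left₀ _ M.δ_pos.ne']
  have hlim : Tendsto (fun n : ℕ => M.β ^ 2 * (1 / ((n : ℝ) + 1))) atTop (𝓝 0) := by
    simpa using (tendsto_one_div_add_atTop_nhds_zero_nat (𝕜 := ℝ)).const_mul (M.β ^ 2)
  have h0 : μ.real {ω | ¬ Disjoint (M.noiseBuyTimes ω) (M.noiseSellTimes ω)} = 0 :=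
    le_antisymm (ge_of_tendsto' hlim fun n => (measureReal_mono (hsub n)
      (measure_ne_top μ _)).trans (hEle n))
      measureReal_nonneg
  rw [ae_iff]
  exact (measureReal_eq_zero_iff (by finiteness)).1 h0

/-! ### The six kinds of orders -/

variable (M) in
/-- The times of the insider's orders of kind `c`. -/
noncomputable def kindTimes (S : Strategy Ω) (c : OrderKind) (ω : Ω) : Finset unitInterval :=
  match c with
  | .BB => (buyTimes S ω).filter fun s => s ∉ M.noiseBuyTimes ω ∧ s ∉ M.noiseSellTimes ω
  | .BT => (buyTimes S ω).filter fun s => s ∈ M.noiseBuyTimes ω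
  | .BS => (buyTimes S ω).filter fun s => s ∈ M.noiseSellTimes ω
  | .SS => (sellTimes S ω).filter fun s => s ∉ M.noiseBuyTimes ω ∧ s ∉ M.noiseSellTimes ω
  | .ST => (sellTimes S ω).filter fun s => s ∈ M.noiseSellTimes ω
  | .SB => (sellTimes S ω).filter fun s => s ∈ M.noiseBuyTimes ω

/-- The order kind is a buy order. -/
def _root_.GlostenMilgrom.OrderKind.IsBuy : OrderKind → Prop
  | .BB | .BT | .BS => True
  | .SS | .ST | .SB => False

lemma kindTimes_subset_buyTimes {c : OrderKind} (hc : c.IsBuy) (ω : Ω) :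
    M.kindTimes S c ω ⊆ buyTimes S ω := by
  cases c <;> first | exact Finset.filter_subset _ _ | exact hc.elim

lemma kindTimes_subset_sellTimes {c : OrderKind} (hc : ¬ c.IsBuy) (ω : Ω) :
    M.kindTimes S c ω ⊆ sellTimes S ω := by
  cases c <;> first | exact Finset.filter_subset _ _ | exact (hc trivial).elim

lemma jump_noise_buy (M : Market Ω μ) (s : unitInterval) (ω : Ω) :
    jump (fun t => M.ZB t ω) s = if s ∈ M.noiseBuyTimes ω then M.δ else 0 := by
  have e : (fun t => M.ZB t ω) = fun t => M.δ * count (M.noiseBuyTimes ω) t :=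
    funext (M.noiseBuyTimes_spec ω).2
  rw [e, jump_count _ (M.noiseBuyTimes_spec ω).1]

lemma jump_noise_sell (M : Market Ω μ) (s : unitInterval) (ω : Ω) :
    jump (fun t => M.ZS t ω) s = if s ∈ M.noiseSellTimes ω then M.δ else 0 := by
  have e : (fun t => M.ZS t ω) = fun t => M.δ * count (M.noiseSellTimes ω) t :=
    funext (M.noiseSellTimes_spec ω).2
  rw [e, jump_count _ (M.noiseSellTimes_spec ω).1]

lemma Admissible.jump_XB (hS : M.Admissible S) (s : unitInterval) (ω : Ω) :
    jump (fun t => S.XB t ω) s = if s ∈ buyTimes S ω then M.δ else 0 := by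
  have e : (fun t => S.XB t ω) = fun t => M.δ * count (buyTimes S ω) t :=
    funext fun t => hS.XB_eq t ω
  rw [e, jump_count _ (hS.zero_notMem_buyTimes ω)]

lemma Admissible.jump_XS (hS : M.Admissible S) (s : unitInterval) (ω : Ω) :
    jump (fun t => S.XS t ω) s = if s ∈ sellTimes S ω then M.δ else 0 := by
  have e : (fun t => S.XS t ω) = fun t => M.δ * count (sellTimes S ω) t :=
    funext fun t => hS.XS_eq t ω
  rw [e, jump_count _ (hS.zero_notMem_sellTimes ω)]

lemma Admissible.compJump_eq (hS : M.Admissible S) (c : OrderKind) (s : unitInterval) (ω : Ω) :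
    M.compJump S c s ω = if s ∈ M.kindTimes S c ω then M.δ else 0 := by
  have hδ := M.δ_pos.ne'
  cases c <;> simp only [compJump, kindTimes, hS.jump_XB, hS.jump_XS, jump_noise_buy,
    jump_noise_sell, Finset.mem_filter] <;> split_ifs <;> simp_all

lemma Admissible.comp_eq (hS : M.Admissible S) (c : OrderKind) (t : unitInterval) (ω : Ω) :
    M.comp S c t ω = M.δ * count (M.kindTimes S c ω) t := by
  have e : M.comp S c t ω = ∑ᶠ s ∈ Iic t, M.compJump S c s ω :=
    finsum_set_coe_eq_finsum_mem (f := fun s => M.compJump S c s ω) (Iic t)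
  rw [e, finsum_mem_eq_sum_of_inter_support_eq (t := (M.kindTimes S c ω).filter (· ≤ t))]
  · rw [Finset.sum_congr rfl (g := fun _ => M.δ)]
    · simp only [Finset.sum_const, nsmul_eq_mul, count]
      ring
    · intro s hs
      rw [hS.compJump_eq, if_pos (Finset.mem_filter.1 hs).1]
  · ext s
    simp only [mem_inter_iff, mem_Iic, Function.mem_support, hS.compJump_eq, Finset.coe_filter,
      mem_ofPred_eq, ne_eq, ite_eq_right_iff, M.δ_pos.ne', imp_false, not_not]
    tauto

lemma Admissible.zero_notMem_kindTimes (hS : M.Admissible S) (c : OrderKind) (ω : Ω) :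
    0 ∉ M.kindTimes S c ω := by
  by_cases hc : c.IsBuy
  · exact fun h => hS.zero_notMem_buyTimes ω (kindTimes_subset_buyTimes hc ω h)
  · exact fun h => hS.zero_notMem_sellTimes ω (kindTimes_subset_sellTimes hc ω h)

lemma Admissible.comp_eq_zero_iff (hS : M.Admissible S) (c : OrderKind) (ω : Ω) :
    (∀ t, M.comp S c t ω = 0) ↔ M.kindTimes S c ω = ∅ := by
  constructor
  · intro h
    have := h 1
    rw [hS.comp_eq, count_one, mul_eq_zero, Nat.cast_eq_zero, Finset.card_eq_zero] at this
    exact this.resolve_left M.δ_pos.ne'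
  · intro h t
    rw [hS.comp_eq, h]
    simp [count]

lemma Admissible.sell_comp_eq_zero_iff (hS : M.Admissible S) (ω : Ω) :
    (∀ t, M.comp S .SS t ω = 0 ∧ M.comp S .ST t ω = 0 ∧ M.comp S .SB t ω = 0) ↔
      sellTimes S ω = ∅ := by
  rw [forall_and, forall_and, hS.comp_eq_zero_iff, hS.comp_eq_zero_iff, hS.comp_eq_zero_iff]
  constructor
  · rintro ⟨h1, h2, h3⟩
    refine Finset.eq_empty_of_forall_notMem fun s hs => ?_
    simp only [kindTimes, Finset.filter_eq_empty_iff] at h1 h2 h3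
    exact h1 hs ⟨h3 hs, h2 hs⟩
  · intro h
    simp [kindTimes, h]

/-- The sign of an order: `1` for buy orders and `-1` for sell orders. -/
def _root_.GlostenMilgrom.OrderKind.sign : OrderKind → ℝ
  | .BB | .BT | .BS => 1
  | .SS | .ST | .SB => -1

/-- Whatever its kind, an order is executed at the price of the demand that results from it. -/
lemma Admissible.unitGain_eq (hS : M.Admissible S) (p : ℝ → unitInterval → ℝ) (x y₀ : ℝ) {ω : Ω}
    (hN : Disjoint (M.noiseBuyTimes ω) (M.noiseSellTimes ω))
    (hX : Disjoint (buyTimes S ω) (sellTimes S ω)) {c : OrderKind} {s : unitInterval}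
    (hs : s ∈ M.kindTimes S c ω) :
    M.unitGain p x c (M.Yleft S y₀ s ω) s = c.sign * (x - p (M.Y S y₀ s ω) s) := by
  have h0 : 0 < s := lt_of_le_of_ne unitInterval.nonneg' fun h =>
    hS.zero_notMem_kindTimes c ω (h ▸ hs)
  have hY : M.Y S y₀ s ω = M.Yleft S y₀ s ω +
      M.δ * ((if s ∈ M.noiseBuyTimes ω then 1 else 0) - (if s ∈ M.noiseSellTimes ω then 1 else 0)
        + (if s ∈ buyTimes S ω then 1 else 0) - (if s ∈ sellTimes S ω then 1 else 0)) := by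
    rw [hS.Y_eq, (hS.Yleft_eq y₀ h0 ω).2]
    simp only [count_eq_countLeft_add]
    ring
  rw [Finset.disjoint_left] at hN hX
  have hX' : ∀ ⦃a⦄, a ∈ sellTimes S ω → a ∉ buyTimes S ω := fun a h1 h2 => hX h2 h1
  have hN' : ∀ ⦃a⦄, a ∈ M.noiseSellTimes ω → a ∉ M.noiseBuyTimes ω := fun a h1 h2 => hN h2 h1
  cases c <;> simp only [kindTimes, Finset.mem_filter] at hs <;> obtain ⟨h1, h2⟩ := hs <;>
    simp only [unitGain, OrderKind.sign, hY, one_mul, neg_one_mul]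
  · rw [if_neg h2.1, if_neg h2.2, if_pos h1, if_neg (hX h1)]
    congr 2; ring
  · rw [if_pos h2, if_neg (hN h2), if_pos h1, if_neg (hX h1)]
    congr 2; ring
  · rw [if_pos h2, if_neg (hN' h2), if_pos h1, if_neg (hX h1)]
    congr 2; ring
  · rw [if_neg h2.1, if_neg h2.2, if_pos h1, if_neg (hX' h1)]
    congr 3; ring
  · rw [if_pos h2, if_neg (hN' h2), if_pos h1, if_neg (hX' h1)]
    congr 3; ring
  · rw [if_pos h2, if_neg (hN h2), if_pos h1, if_neg (hX' h1)]
    congr 3; ring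

variable (M) in
/-- The gains in `(t₀, 1]` from the orders of kind `c`. -/
noncomputable def kindGain (p : ℝ → unitInterval → ℝ) (S : Strategy Ω) (x y₀ : ℝ)
    (t₀ : unitInterval) (c : OrderKind) (ω : Ω) : ℝ :=
  ∑ s ∈ M.kindTimes S c ω with t₀ < s, M.unitGain p x c (M.Yleft S y₀ s ω) s * M.δ

/-- The gains from all orders, as a sum over buy orders and a sum over sell orders. -/
lemma Admissible.sum_kindGain (hS : M.Admissible S) (p : ℝ → unitInterval → ℝ) (x y₀ : ℝ)
    (t₀ : unitInterval) {ω : Ω}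
    (hN : Disjoint (M.noiseBuyTimes ω) (M.noiseSellTimes ω))
    (hX : Disjoint (buyTimes S ω) (sellTimes S ω)) :
    M.kindGain p S x y₀ t₀ .BB ω + M.kindGain p S x y₀ t₀ .BT ω + M.kindGain p S x y₀ t₀ .BS ω +
      M.kindGain p S x y₀ t₀ .SS ω + M.kindGain p S x y₀ t₀ .ST ω + M.kindGain p S x y₀ t₀ .SB ω =
    M.orderSum S y₀ t₀ (buyTimes S) (fun y t => x - p y t) ω -
      M.orderSum S y₀ t₀ (sellTimes S) (fun y t => x - p y t) ω := by
  have key : ∀ c, M.kindGain p S x y₀ t₀ c ω = ∑ s ∈ M.kindTimes S c ω,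
      if t₀ < s then c.sign * (M.δ * (x - p (M.Y S y₀ s ω) s)) else 0 := by
    intro c
    rw [kindGain, Finset.sum_filter]
    refine Finset.sum_congr rfl fun s hs => ?_
    rw [hS.unitGain_eq p x y₀ hN hX hs]
    split_ifs <;> ring
  simp only [key, kindTimes, orderSum]
  simp only [Finset.sum_filter, OrderKind.sign]
  have e : ∀ a b c d e f g h : ℝ, a + b + c = g → d + e + f = -h →
      a + b + c + d + e + f = g - h := by intros; linarith
  rw [Finset.disjoint_left] at hN
  refine e _ _ _ _ _ _ _ _ ?_ ?_
  · rw [← Finset.sum_add_distrib, ← Finset.sum_add_distrib]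
    refine Finset.sum_congr rfl fun s _ => ?_
    by_cases h1 : s ∈ M.noiseBuyTimes ω
    · simp [h1, hN h1]
    · by_cases h2 : s ∈ M.noiseSellTimes ω <;> simp [h1, h2]
  · rw [← Finset.sum_add_distrib, ← Finset.sum_add_distrib, ← Finset.sum_neg_distrib]
    refine Finset.sum_congr rfl fun s _ => ?_
    by_cases h1 : s ∈ M.noiseBuyTimes ω
    · by_cases h3 : t₀ < s <;> simp [h1, hN h1, h3]
    · by_cases h2 : s ∈ M.noiseSellTimes ω <;> by_cases h3 : t₀ < s <;> simp [h1, h2, h3]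

lemma Admissible.gainFrom_eq (hS : M.Admissible S) (p : ℝ → unitInterval → ℝ) (c : OrderKind)
    (ω : Ω) : M.gainFrom p S c ω = M.kindGain p S (M.v ω) 0 0 c ω := by
  have e : (fun t => M.comp S c t ω) = fun t => M.δ * count (M.kindTimes S c ω) t :=
    funext fun t => hS.comp_eq c t ω
  rw [gainFrom, e, jumpIntegral_count _ (hS.zero_notMem_kindTimes c ω), kindGain,
    Finset.filter_true_of_mem]
  intro s hs
  exact lt_of_le_of_ne unitInterval.nonneg' fun h => hS.zero_notMem_kindTimes c ω (h ▸ hs)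

lemma Admissible.profit_eq [IsProbabilityMeasure μ] (hS : M.Admissible S)
    (p : ℝ → unitInterval → ℝ) :
    ∀ᵐ ω ∂μ, M.profit p S ω =
      M.orderSum S 0 0 (buyTimes S) (fun y t => M.v ω - p y t) ω -
      M.orderSum S 0 0 (sellTimes S) (fun y t => M.v ω - p y t) ω := by
  filter_upwards [M.disjoint_noiseTimes, hS.disjoint_times] with ω h1 h2
  simp only [profit, hS.gainFrom_eq]
  exact hS.sum_kindGain p (M.v ω) 0 0 h1 h2

/-! ### The expected profit of the high type -/

/-- The verification identity: on an event known at time `t₀`, the expected gains from trading after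
`t₀` are the expected shortfall, less the expected terminal shortfall and the expected loss from
sell orders. -/
lemma Admissible.setIntegral_gain [IsProbabilityMeasure μ] (hS : M.Admissible S) (m k₀ : ℤ)
    (t₀ : unitInterval) {A : Set Ω} (hA : MeasurableSet[S.FI t₀] A) :
    ∫ ω in A, (M.orderSum S (M.δ * k₀) t₀ (buyTimes S) (fun y t => 1 - M.pz (M.δ * m) y t) ω -
      M.orderSum S (M.δ * k₀) t₀ (sellTimes S) (fun y t => 1 - M.pz (M.δ * m) y t) ω) ∂μ =
    ∫ ω in A, M.shortfall m (M.Y S (M.δ * k₀) t₀ ω) t₀ ∂μ -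
      ∫ ω in A, M.shortfall m (M.Y S (M.δ * k₀) 1 ω) 1 ∂μ -
      ∫ ω in A, M.orderSum S (M.δ * k₀) t₀ (sellTimes S)
        (fun y t => M.pz (M.δ * m) (y + M.δ) t - M.pz (M.δ * m) y t) ω ∂μ := by
  have h := hS.setIntegral_shortfall_sub m k₀ t₀ hA
  have i1 := hS.integrable_orderSum_buy k₀ t₀ (M.isGain_one_sub_pz m)
  have i2 := hS.integrable_orderSum_sell k₀ t₀ (M.isGain_one_sub_pz m)
  have i3 := hS.integrable_orderSum_sell k₀ t₀ (M.isGain_one_sub_pz_add m)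
  have i4 := hS.integrable_orderSum_sell k₀ t₀ (M.isGain_pz_add_sub_pz m)
  have e : ∀ ω, M.orderSum S (M.δ * k₀) t₀ (sellTimes S)
      (fun y t => 1 - M.pz (M.δ * m) (y + M.δ) t) ω =
      M.orderSum S (M.δ * k₀) t₀ (sellTimes S) (fun y t => 1 - M.pz (M.δ * m) y t) ω -
      M.orderSum S (M.δ * k₀) t₀ (sellTimes S)
        (fun y t => M.pz (M.δ * m) (y + M.δ) t - M.pz (M.δ * m) y t) ω := by
    intro ω
    simp only [orderSum]
    rw [← Finset.sum_sub_distrib]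
    exact Finset.sum_congr rfl fun s _ => by ring
  rw [integral_sub i3.integrableOn i1.integrableOn] at h
  rw [integral_sub i1.integrableOn i2.integrableOn]
  have h3 : ∫ ω in A, M.orderSum S (M.δ * k₀) t₀ (sellTimes S)
      (fun y t => 1 - M.pz (M.δ * m) (y + M.δ) t) ω ∂μ =
      ∫ ω in A, M.orderSum S (M.δ * k₀) t₀ (sellTimes S)
        (fun y t => 1 - M.pz (M.δ * m) y t) ω ∂μ -
      ∫ ω in A, M.orderSum S (M.δ * k₀) t₀ (sellTimes S)
        (fun y t => M.pz (M.δ * m) (y + M.δ) t - M.pz (M.δ * m) y t) ω ∂μ := by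
    rw [← integral_sub i2.integrableOn i4.integrableOn]
    exact integral_congr_ae (ae_of_all _ e)
  linarith

lemma integral_cond {A : Set Ω} (f : Ω → ℝ) :
    ∫ ω, f ω ∂(cond μ A) = (μ.real A)⁻¹ * ∫ ω in A, f ω ∂μ := by
  rw [ProbabilityTheory.cond, integral_smul_measure, ENNReal.toReal_inv, smul_eq_mul]
  rfl

lemma measure_v_eq_one_ne_zero [IsProbabilityMeasure μ] (M : Market Ω μ) :
    μ {ω | M.v ω = 1} ≠ 0 := by
  have h : {ω | M.v ω = 1} = {ω | M.v ω = 0}ᶜ := by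
    ext ω
    simp only [mem_ofPred_eq, mem_compl_iff]
    rcases M.v_values ω with h | h <;> simp [h]
  have hms : MeasurableSet {ω | M.v ω = 0} := M.v_measurable (measurableSet_singleton 0)
  rw [h, prob_compl_eq_one_sub hms]
  exact (tsub_pos_of_lt M.v_random.2).ne'

lemma measureReal_v_eq_one_pos [IsProbabilityMeasure μ] (M : Market Ω μ) :
    0 < μ.real {ω | M.v ω = 1} :=
  ENNReal.toReal_pos M.measure_v_eq_one_ne_zero (by finiteness)

/-- The loss from sell orders in `(t₀, 1]`: a lot is sold at the price `p(Y_s, s)`, whereas the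
shortfall values it at the higher price `p(Y_s + δ, s)` of buying it back. -/
noncomputable def sellLoss (M : Market Ω μ) (S : Strategy Ω) (m : ℤ) (y₀ : ℝ) (t₀ : unitInterval) :
    Ω → ℝ :=
  M.orderSum S y₀ t₀ (sellTimes S) fun y t => M.pz (M.δ * m) (y + M.δ) t - M.pz (M.δ * m) y t

lemma Admissible.sellLoss_nonneg [IsProbabilityMeasure μ] (hS : M.Admissible S) (m k₀ : ℤ)
    (t₀ : unitInterval) (ω : Ω) : 0 ≤ M.sellLoss S m (M.δ * k₀) t₀ ω := by
  refine Finset.sum_nonneg fun s _ => mul_nonneg M.δ_pos.le ?_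
  obtain ⟨k, hk⟩ := hS.exists_int_Y k₀ s ω
  rw [hk]
  exact sub_nonneg.2 (M.pz_le_pz_add m k s)

/-- The expected profit of the high type falls short of the expected shortfall at the start by the
expected terminal shortfall and the expected loss from sell orders. -/
lemma Admissible.expectedProfit_one [IsProbabilityMeasure μ] (hS : M.Admissible S) (m : ℤ) :
    M.expectedProfit (M.pz (M.δ * m)) 1 S = M.shortfall m 0 0 -
      (μ.real {ω | M.v ω = 1})⁻¹ * (∫ ω in {ω | M.v ω = 1}, M.shortfall m (M.Y S 0 1 ω) 1 ∂μ +
      ∫ ω in {ω | M.v ω = 1}, M.sellLoss S m 0 0 ω ∂μ) := by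
  have hA := hS.measurableSet_v_eq 1 0
  have hA' : MeasurableSet {ω | M.v ω = 1} := S.FI.le 0 _ hA
  have hpos := M.measureReal_v_eq_one_pos
  have h := hS.setIntegral_gain m 0 0 hA
  rw [Int.cast_zero, mul_zero] at h
  have hY0 : ∀ ω, M.Y S 0 0 ω = 0 := by
    intro ω
    have h1 := hS.XB_eq 0 ω
    have h2 := hS.XS_eq 0 ω
    obtain ⟨n, hn0, -, -, -, hn⟩ := hS.buy_path ω
    obtain ⟨n', hn0', -, -, -, hn'⟩ := hS.sell_path ω
    have a := hn 0
    have b := hn' 0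
    simp only [hn0, hn0', Nat.cast_zero, mul_zero] at a b
    rw [Y, M.Z_zero, a, b]
    simp
  have e1 : ∫ ω in {ω | M.v ω = 1}, M.shortfall m (M.Y S 0 0 ω) 0 ∂μ =
      μ.real {ω | M.v ω = 1} * M.shortfall m 0 0 := by
    simp only [hY0]
    rw [setIntegral_const, smul_eq_mul]
  have e2 : ∫ ω in {ω | M.v ω = 1}, M.profit (M.pz (M.δ * m)) S ω ∂μ =
      ∫ ω in {ω | M.v ω = 1}, (M.orderSum S 0 0 (buyTimes S)
        (fun y t => 1 - M.pz (M.δ * m) y t) ω - M.orderSum S 0 0 (sellTimes S)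
        (fun y t => 1 - M.pz (M.δ * m) y t) ω) ∂μ := by
    refine integral_congr_ae ?_
    filter_upwards [ae_restrict_of_ae (hS.profit_eq (M.pz (M.δ * m))), ae_restrict_mem hA']
      with ω h1 h2
    rw [h1, h2]
  rw [expectedProfit, integral_cond, e2, h, e1, sellLoss]
  field_simp
  ring

lemma Admissible.integrable_sellLoss [IsProbabilityMeasure μ] (hS : M.Admissible S) (m k₀ : ℤ)
    (t₀ : unitInterval) : Integrable (M.sellLoss S m (M.δ * k₀) t₀) μ :=
  hS.integrable_orderSum_sell k₀ t₀ (M.isGain_pz_add_sub_pz m)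

lemma Admissible.expectedProfit_one_le [IsProbabilityMeasure μ] (hS : M.Admissible S) (m : ℤ) :
    M.expectedProfit (M.pz (M.δ * m)) 1 S ≤ M.shortfall m 0 0 := by
  rw [hS.expectedProfit_one, sub_le_self_iff]
  refine mul_nonneg (inv_nonneg.2 measureReal_nonneg) (add_nonneg
    (integral_nonneg fun _ => M.shortfall_nonneg _ _ _) (integral_nonneg fun ω => ?_))
  have := hS.sellLoss_nonneg m 0 0 ω
  rwa [Int.cast_zero, mul_zero] at this

/-- A process with an absolutely continuous compensator almost surely does not jump at time `1`. -/
lemma Admissible.one_notMem_sellTimes [IsProbabilityMeasure μ] (hS : M.Admissible S) :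
    ∀ᵐ ω ∂μ, 1 ∉ sellTimes S ω := by
  obtain ⟨A, hA, hAC⟩ := hS.sell_compensator
  have hδ := M.δ_pos
  let τ : ℕ → unitInterval := fun n => grid 0 n n
  have hτ : ∀ n, (τ n : ℝ) = 1 - 1 / ((n : ℝ) + 1) := by
    intro n
    have : (n : ℝ) + 1 ≠ 0 := by positivity
    simp only [τ]
    rw [coe_grid 0 (by omega)]
    simp
    field_simp
    ring
  have hτlt : ∀ n, τ n < 1 := by
    intro n
    rw [← Subtype.coe_lt_coe, hτ]
    have : (0 : ℝ) < 1 / ((n : ℝ) + 1) := by positivity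
    simpa using this
  have hτ1 : Tendsto τ atTop (𝓝 1) := by
    rw [tendsto_subtype_rng]
    simp only [hτ]
    simpa using (tendsto_one_div_add_atTop_nhds_zero_nat (𝕜 := ℝ)).const_sub 1
  have hτ1' : Tendsto τ atTop (𝓝[<] 1) :=
    tendsto_nhdsWithin_iff.2 ⟨hτ1, Eventually.of_forall hτlt⟩
  have iA : ∀ t, Integrable (A t) μ := by
    intro t
    have := (hS.integrable_XS t).fun_sub (hA.martingale.integrable t)
    simpa using this
  have hint : ∀ n, ∫ ω, (S.XS 1 ω - S.XS (τ n) ω) ∂μ = ∫ ω, (A 1 ω - A (τ n) ω) ∂μ := by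
    intro n
    have h := hA.martingale.setIntegral_eq (i := τ n) (j := 1) unitInterval.le_one'
      (s := univ) MeasurableSet.univ
    simp only [setIntegral_univ] at h
    rw [integral_sub (hS.integrable_XS _) (iA _), integral_sub (hS.integrable_XS _) (iA _)] at h
    rw [integral_sub (hS.integrable_XS _) (hS.integrable_XS _), integral_sub (iA _) (iA _)]
    linarith
  have hlimA : Tendsto (fun n => ∫ ω, (A 1 ω - A (τ n) ω) ∂μ) atTop (𝓝 (∫ _, (0 : ℝ) ∂μ)) := by
    refine tendsto_integral_of_dominated_convergence (fun ω => |A 1 ω|)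
      (fun n => ((iA _).fun_sub (iA _)).1) (iA 1).abs (fun n => ?_) ?_
    · filter_upwards [hA.path] with ω hω
      have h1 : A 0 ω ≤ A (τ n) ω := hω.2.1 unitInterval.nonneg'
      have h2 : A (τ n) ω ≤ A 1 ω := hω.2.1 unitInterval.le_one'
      rw [hω.1] at h1
      rw [Real.norm_eq_abs, abs_of_nonneg (by linarith), abs_of_nonneg (by linarith)]
      linarith
    · filter_upwards [hAC] with ω hω
      have hc := hω.continuousOn
      rw [uIcc_of_le zero_le_one] at hc
      have h1 : Tendsto (fun n => A (Set.projIcc 0 1 zero_le_one (τ n : ℝ)) ω) atTop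
          (𝓝 (A (Set.projIcc 0 1 zero_le_one 1) ω)) :=
        (hc 1 (by simp)).tendsto.comp (tendsto_nhdsWithin_iff.2
          ⟨(continuous_subtype_val.tendsto _).comp hτ1, Eventually.of_forall fun n => (τ n).2⟩)
      simp only [projIcc_val, projIcc_right] at h1
      have := (tendsto_const_nhds (x := A 1 ω)).sub h1
      simpa using this
  have hlimX : ∀ ω, Tendsto (fun n => S.XS 1 ω - S.XS (τ n) ω) atTop
      (𝓝 (if 1 ∈ sellTimes S ω then M.δ else 0)) := by
    intro ω
    refine tendsto_const_nhds.congr' ?_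
    filter_upwards [hτ1'.eventually (count_eventuallyEq_left (sellTimes S ω) 1)] with n hn
    rw [hS.XS_eq, hS.XS_eq, hn, count_eq_countLeft_add]
    split_ifs <;> ring
  have hlim : Tendsto (fun n => ∫ ω, (S.XS 1 ω - S.XS (τ n) ω) ∂μ) atTop
      (𝓝 (∫ ω, (if 1 ∈ sellTimes S ω then M.δ else 0) ∂μ)) := by
    refine tendsto_integral_of_dominated_convergence (fun ω => S.XS 1 ω)
      (fun n => ((hS.integrable_XS _).fun_sub (hS.integrable_XS _)).1) (hS.integrable_XS 1)
      (fun n => ae_of_all _ fun ω => ?_) (ae_of_all _ hlimX)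
    have := hS.XS_mono ω (hτlt n).le
    simp only at this
    rw [Real.norm_of_nonneg (by linarith)]
    linarith [hS.XS_nonneg (τ n) ω]
  simp only [hint] at hlim
  have h0 : ∫ ω, (if 1 ∈ sellTimes S ω then M.δ else 0) ∂μ = 0 := by
    rw [tendsto_nhds_unique hlim hlimA, integral_zero]
  have hi : Integrable (fun ω => if 1 ∈ sellTimes S ω then M.δ else 0) μ := by
    refine (integrable_const M.δ).mono' (aestronglyMeasurable_of_tendsto_ae atTop
      (fun n => ((hS.integrable_XS 1).fun_sub (hS.integrable_XS (τ n))).1) (ae_of_all _ hlimX))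
      (ae_of_all _ fun ω => ?_)
    split_ifs <;> simp [abs_of_pos hδ, hδ.le]
  rw [integral_eq_zero_iff_of_nonneg (fun ω => by
    simp only [Pi.zero_apply]; split_ifs <;> simp [hδ.le]) hi] at h0
  filter_upwards [h0] with ω hω h1
  simp only [h1, if_true, Pi.zero_apply] at hω
  exact hδ.ne' hω

/-- The bound on the expected profit is attained exactly under the high condition. -/
lemma Admissible.expectedProfit_one_eq_iff [IsProbabilityMeasure μ] (hS : M.Admissible S) (m : ℤ) :
    M.expectedProfit (M.pz (M.δ * m)) 1 S = M.shortfall m 0 0 ↔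
      M.HighCondition (M.δ * m) S := by
  have hA' : MeasurableSet {ω | M.v ω = 1} := S.FI.le 0 _ (hS.measurableSet_v_eq 1 0)
  have hpos := M.measureReal_v_eq_one_pos
  have hδ := M.δ_pos
  have hl0 : ∀ ω, 0 ≤ M.sellLoss S m 0 0 ω := fun ω => by
    have := hS.sellLoss_nonneg m 0 0 ω
    rwa [Int.cast_zero, mul_zero] at this
  have hli : Integrable (M.sellLoss S m 0 0) μ := by
    have := hS.integrable_sellLoss m 0 0
    rwa [Int.cast_zero, mul_zero] at this
  have hhi : Integrable (fun ω => M.shortfall m (M.Y S 0 1 ω) 1) μ :=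
    integrable_shortfall_comp m 1 (hS.measurable_Y 0 1) (hS.integrable_Y 0 1)
  have hI1 : 0 ≤ ∫ ω in {ω | M.v ω = 1}, M.shortfall m (M.Y S 0 1 ω) 1 ∂μ :=
    integral_nonneg fun _ => M.shortfall_nonneg _ _ _
  have hI2 : 0 ≤ ∫ ω in {ω | M.v ω = 1}, M.sellLoss S m 0 0 ω ∂μ := integral_nonneg hl0
  rw [hS.expectedProfit_one, sub_eq_self, mul_eq_zero, or_iff_right (inv_pos.2 hpos).ne',
    add_eq_zero_iff_of_nonneg hI1 hI2,
    setIntegral_eq_zero_iff_of_nonneg_ae (ae_of_all _ fun _ => M.shortfall_nonneg _ _ _)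
      hhi.integrableOn,
    setIntegral_eq_zero_iff_of_nonneg_ae (ae_of_all _ hl0) hli.integrableOn]
  rw [Filter.EventuallyEq, Filter.EventuallyEq, ae_restrict_iff' hA', ae_restrict_iff' hA',
    ← eventually_and, HighCondition]
  have hsh : ∀ ω, M.shortfall m (M.Y S 0 1 ω) 1 = 0 ↔ M.δ * m - M.δ ≤ M.Y S 0 1 ω := by
    intro ω
    rw [M.shortfall_one, max_eq_right_iff]
    constructor <;> intro h <;> linarith
  constructor
  · intro h
    filter_upwards [h, hS.one_notMem_sellTimes] with ω h1 h2 hv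
    refine ⟨(hsh ω).1 (h1.1 hv), (hS.sell_comp_eq_zero_iff ω).2 ?_⟩
    refine Finset.eq_empty_of_forall_notMem fun s hs => ?_
    have hs1 : s < 1 := lt_of_le_of_ne unitInterval.le_one' fun h => h2 (h ▸ hs)
    have hs0 : 0 < s := lt_of_le_of_ne unitInterval.nonneg' fun h =>
      hS.zero_notMem_sellTimes ω (h ▸ hs)
    have hsum := h1.2 hv
    simp only [sellLoss, orderSum, Pi.zero_apply] at hsum
    rw [Finset.sum_eq_zero_iff_of_nonneg] at hsum
    · have := hsum s (Finset.mem_filter.2 ⟨hs, hs0⟩)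
      obtain ⟨k, hk⟩ := hS.exists_int_Y 0 s ω
      rw [Int.cast_zero, mul_zero] at hk
      rw [hk] at this
      have h3 := M.pz_lt_pz_add m k hs1
      rcases mul_eq_zero.1 this with h4 | h4
      · exact hδ.ne' h4
      · linarith
    · intro u _
      obtain ⟨k, hk⟩ := hS.exists_int_Y 0 u ω
      rw [Int.cast_zero, mul_zero] at hk
      rw [hk]
      exact mul_nonneg hδ.le (sub_nonneg.2 (M.pz_le_pz_add m k u))
  · intro h
    filter_upwards [h] with ω h1
    refine ⟨fun hv => (hsh ω).2 (h1 hv).1, fun hv => ?_⟩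
    have := (hS.sell_comp_eq_zero_iff ω).1 (h1 hv).2
    simp [sellLoss, orderSum, this]

end Market

/-! ### Intensities and the expected remaining profit -/

/-- A predictable process is jointly measurable in time and chance. -/
lemma predictable_le_prod {Ω : Type*} [mΩ : MeasurableSpace Ω] (ℱ : Filtration unitInterval mΩ) :
    ℱ.predictable ≤ (inferInstance : MeasurableSpace (unitInterval × Ω)) := by
  refine measurableSpace_le_predictable_of_measurableSet ?_ ?_
  · exact fun A hA => (measurableSet_singleton _).prod (ℱ.le _ A hA)
  · exact fun i A hA => measurableSet_Ioi.prod (ℱ.le _ A hA)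

/-- Increments of a martingale are orthogonal to what is known at their beginning. -/
lemma setIntegral_mul_martingale_sub {Ω : Type*} [mΩ : MeasurableSpace Ω] {μ : Measure Ω}
    [IsProbabilityMeasure μ] {ℱ : Filtration unitInterval mΩ} {N : unitInterval → Ω → ℝ}
    (hN : Martingale N ℱ μ) {s t : unitInterval} (hst : s ≤ t) {ξ : Ω → ℝ}
    (hξ : Measurable[ℱ s] ξ) (hb : ∀ ω, |ξ ω| ≤ 1) {A : Set Ω} (hA : MeasurableSet[ℱ s] A) :
    ∫ ω in A, ξ ω * (N t ω - N s ω) ∂μ = 0 := by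
  have hi : Integrable (N t - N s) μ := (hN.integrable t).sub (hN.integrable s)
  have hξs : StronglyMeasurable[ℱ s] ξ := hξ.stronglyMeasurable
  have hmul : Integrable (ξ * (N t - N s)) μ :=
    hi.bdd_mul (hξ.mono (ℱ.le s) le_rfl).aestronglyMeasurable
      (c := 1) (ae_of_all _ fun ω => by simpa using hb ω)
  have h1 := setIntegral_condExp (ℱ.le s) hmul hA
  have h2 := condExp_mul_of_stronglyMeasurable_left (m := ℱ s) hξs hmul hi
  have h3 : μ[N t - N s|ℱ s] =ᵐ[μ] 0 := by
    refine (condExp_sub (hN.integrable t) (hN.integrable s) _).trans ?_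
    filter_upwards [hN.condExp_ae_eq hst, hN.condExp_ae_eq (le_refl s)] with ω h h'
    simp [h, h']
  have h4 : μ[ξ * (N t - N s)|ℱ s] =ᵐ[μ] 0 := by
    filter_upwards [h2, h3] with ω h h'
    simp [h, h']
  have h5 : ∫ ω in A, (ξ * (N t - N s)) ω ∂μ = 0 := by
    rw [← h1, setIntegral_congr_ae (g := fun _ => (0 : ℝ)) (ℱ.le s A hA)
      (h4.mono fun ω h _ => h)]
    simp
  exact h5

namespace Market

variable {Ω : Type*} [mΩ : MeasurableSpace Ω] {μ : Measure Ω} {M : Market Ω μ} {S : Strategy Ω}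

lemma _root_.GlostenMilgrom.IsIntensity.measurable_integral {ℱ : Filtration unitInterval mΩ}
    {x θ : unitInterval → Ω → ℝ} {δ : ℝ} (hθ : IsIntensity ℱ μ δ x θ) (s : Set unitInterval) :
    Measurable fun ω => ∫ u in s, θ u ω := by
  have h : StronglyMeasurable (Function.uncurry θ) := hθ.predictable.mono (predictable_le_prod ℱ)
  exact (h.integral_prod_left (μ := volume.restrict s)).measurable

variable (M) in
/-- The sum of the values `q (Y_{s-}, s)` over the orders of kind `c` after time `t₀`, times the
order size. -/
noncomputable def kindSum (S : Strategy Ω) (y₀ : ℝ) (t₀ : unitInterval) (c : OrderKind)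
    (q : ℝ → unitInterval → ℝ) (ω : Ω) : ℝ :=
  ∑ s ∈ M.kindTimes S c ω with t₀ < s, q (M.Yleft S y₀ s ω) s * M.δ

lemma Admissible.tendsto_left (hS : M.Admissible S) (k₀ : ℤ) {q : ℝ → unitInterval → ℝ}
    (hq : IsGain M q) {s : unitInterval} (hs : 0 < s) (ω : Ω) :
    Tendsto (fun t => q (M.Y S (M.δ * k₀) t ω) t) (𝓝[<] s)
      (𝓝 (q (M.Yleft S (M.δ * k₀) s ω) s)) := by
  obtain ⟨k, hk⟩ := hS.exists_int_Yleft k₀ hs ω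
  have h := (hS.Yleft_eq (M.δ * k₀) hs ω).1
  rw [hk] at h ⊢
  refine Tendsto.congr' (f₁ := q (M.δ * k)) ?_ (((hq.continuous k).tendsto s).mono_left
    nhdsWithin_le_nhds)
  filter_upwards [h] with t ht
  rw [ht]

lemma Admissible.comp_one_le (hS : M.Admissible S) (c : OrderKind) (ω : Ω) :
    0 ≤ M.comp S c 1 ω ∧ M.comp S c 1 ω ≤ S.XB 1 ω + S.XS 1 ω := by
  have hδ := M.δ_pos
  rw [hS.comp_eq, hS.XB_eq, hS.XS_eq, count_one, count_one, count_one, ← mul_add]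
  refine ⟨by positivity, mul_le_mul_of_nonneg_left ?_ hδ.le⟩
  by_cases hc : c.IsBuy
  · have : ((M.kindTimes S c ω).card : ℝ) ≤ (buyTimes S ω).card := by
      exact_mod_cast Finset.card_le_card (kindTimes_subset_buyTimes hc ω)
    have h2 : (0 : ℝ) ≤ (sellTimes S ω).card := by positivity
    linarith
  · have : ((M.kindTimes S c ω).card : ℝ) ≤ (sellTimes S ω).card := by
      exact_mod_cast Finset.card_le_card (kindTimes_subset_sellTimes hc ω)
    have h2 : (0 : ℝ) ≤ (buyTimes S ω).card := by positivity
    linarith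

lemma Admissible.integrable_comp_one (hS : M.Admissible S) {c : OrderKind}
    {θ : unitInterval → Ω → ℝ} (hθ : IsIntensity S.FI μ M.δ (M.comp S c) θ) :
    Integrable (M.comp S c 1) μ := by
  have h1 : AEStronglyMeasurable (M.comp S c 1) μ := by
    have h := ((hθ.martingale.integrable 1).1).add
      (((hθ.measurable_integral (Iic 1)).const_mul M.δ).aestronglyMeasurable)
    refine h.congr (ae_of_all _ fun ω => ?_)
    simp
  refine ((hS.integrable_XB 1).add (hS.integrable_XS 1)).mono' h1 (ae_of_all _ fun ω => ?_)
  rw [Real.norm_of_nonneg (hS.comp_one_le c ω).1]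
  exact (hS.comp_one_le c ω).2

lemma Admissible.integrable_cumulative_intensity (hS : M.Admissible S) {c : OrderKind}
    {θ : unitInterval → Ω → ℝ} (hθ : IsIntensity S.FI μ M.δ (M.comp S c) θ) :
    Integrable (fun ω => ∫ u in Iic (1 : unitInterval), θ u ω) μ := by
  have h := ((hS.integrable_comp_one hθ).fun_sub (hθ.martingale.integrable 1)).const_mul M.δ⁻¹
  refine h.congr (ae_of_all _ fun ω => ?_)
  have := M.δ_pos.ne'
  simp only [sub_sub_cancel]
  field_simp

/-- The orders of kind `c` may be replaced by their intensity when gains are integrated. -/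
lemma Admissible.setIntegral_kindSum [IsProbabilityMeasure μ] (hS : M.Admissible S)
    {c : OrderKind} {θ : unitInterval → Ω → ℝ} (hθ : IsIntensity S.FI μ M.δ (M.comp S c) θ)
    (k₀ : ℤ) (t₀ : unitInterval) {q : ℝ → unitInterval → ℝ} (hq : IsGain M q) {A : Set Ω}
    (hA : MeasurableSet[S.FI t₀] A) :
    Integrable (M.kindSum S (M.δ * k₀) t₀ c q) μ ∧
    Integrable (fun ω => ∫ u in Ioc t₀ 1, q (M.Yleft S (M.δ * k₀) u ω) u * θ u ω) μ ∧
    ∫ ω in A, M.kindSum S (M.δ * k₀) t₀ c q ω ∂μ =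
      M.δ * ∫ ω in A, (∫ u in Ioc t₀ 1, q (M.Yleft S (M.δ * k₀) u ω) u * θ u ω) ∂μ := by
  have hδ := M.δ_pos
  set y₀ := M.δ * (k₀ : ℝ) with hy₀
  set Λ : unitInterval → Ω → ℝ := fun t ω => ∫ u in Iic t, θ u ω with hΛ
  have hΛm : ∀ t, Measurable (Λ t) := fun t => hθ.measurable_integral (Iic t)
  have hΛi : Integrable (Λ 1) μ := hS.integrable_cumulative_intensity hθ
  have hNi := hS.integrable_comp_one hθ
  set f : ℕ → ℕ → Ω → ℝ := fun n i ω => q (M.Y S y₀ (grid t₀ n i) ω) (grid t₀ n i) with hf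
  have hfm : ∀ n i, Measurable[S.FI (grid t₀ n i)] (f n i) := fun n i =>
    (hq.measurable _).comp (hS.measurable_Y_FI y₀ _)
  have hfm' : ∀ n i, Measurable (f n i) := fun n i => (hfm n i).mono (S.FI.le _) le_rfl
  have hfb : ∀ n i ω, |f n i ω| ≤ 1 := fun n i ω => hq.bound _ _
  -- measurability of the partial sums
  have hΛcell : ∀ᵐ ω ∂μ, ∀ a b : unitInterval, a ≤ b →
      ∫ u in Ioc a b, θ u ω = Λ b ω - Λ a ω := by
    filter_upwards [hθ.integrable] with ω hω a b hab
    have hd : Disjoint (Iic a) (Ioc a b) :=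
      Set.disjoint_left.2 fun u (h1 : u ≤ a) (h2 : u ∈ Ioc a b) => absurd h2.1 (not_lt.2 h1)
    have := setIntegral_union (μ := volume) (f := fun u => θ u ω) hd
      measurableSet_Ioc (hω.integrableOn (s := Iic a)) (hω.integrableOn (s := Ioc a b))
    rw [Iic_union_Ioc_eq_Iic hab] at this
    simp only [hΛ]
    linarith
  set G : ℕ → Ω → ℝ := fun n ω => ∑ i ∈ Finset.range (n + 1),
    f n i ω * (Λ (grid t₀ n (i + 1)) ω - Λ (grid t₀ n i) ω) with hG
  have hGm : ∀ n, Measurable (G n) := fun n =>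
    Finset.measurable_fun_sum _ fun i _ => (hfm' n i).mul ((hΛm _).sub (hΛm _))
  have hGlim : ∀ᵐ ω ∂μ, Tendsto (fun n => G n ω) atTop
      (𝓝 (∫ u in Ioc t₀ 1, q (M.Yleft S y₀ u ω) u * θ u ω)) := by
    filter_upwards [hθ.integrable, hΛcell] with ω hω hc
    have := tendsto_sum_grid_integral t₀ (f := fun s => q (M.Y S y₀ s ω) s)
      (g := fun s => q (M.Yleft S y₀ s ω) s) (C := 1) (fun s => hq.bound _ _) hω
      (fun s hs => hS.tendsto_left k₀ hq (unitInterval.nonneg'.trans_lt hs) ω)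
    refine this.congr fun n => Finset.sum_congr rfl fun i _ => ?_
    rw [hc _ _ (grid_mono t₀ n i.le_succ)]
  have hGb : ∀ᵐ ω ∂μ, ∀ n, |G n ω| ≤ Λ 1 ω := by
    filter_upwards [hθ.integrable, hΛcell] with ω hω hc n
    have hmono : ∀ a b : unitInterval, a ≤ b → 0 ≤ Λ b ω - Λ a ω := fun a b hab => by
      rw [← hc a b hab]
      exact integral_nonneg fun u => hθ.nonneg u ω
    have h0 : 0 ≤ Λ t₀ ω := integral_nonneg fun u => hθ.nonneg u ω
    calc |G n ω| ≤ ∑ i ∈ Finset.range (n + 1),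
          |f n i ω * (Λ (grid t₀ n (i + 1)) ω - Λ (grid t₀ n i) ω)| :=
          Finset.abs_sum_le_sum_abs _ _
      _ ≤ ∑ i ∈ Finset.range (n + 1), (Λ (grid t₀ n (i + 1)) ω - Λ (grid t₀ n i) ω) := by
          refine Finset.sum_le_sum fun i _ => ?_
          have h := hmono _ _ (grid_mono t₀ n i.le_succ : grid t₀ n i ≤ grid t₀ n (i + 1))
          rw [abs_mul, abs_of_nonneg h]
          exact mul_le_of_le_one_left h (hfb n i ω)
      _ = Λ 1 ω - Λ t₀ ω := sum_grid_telescope t₀ n (fun t => Λ t ω)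
      _ ≤ Λ 1 ω := by linarith
  set K : ℕ → Ω → ℝ := fun n ω => ∑ i ∈ Finset.range (n + 1),
    f n i ω * (M.comp S c (grid t₀ n (i + 1)) ω - M.comp S c (grid t₀ n i) ω) with hK
  have hKlim : ∀ ω, Tendsto (fun n => K n ω) atTop (𝓝 (M.kindSum S y₀ t₀ c q ω)) := by
    intro ω
    have := (tendsto_sum_grid_left t₀ (M.kindTimes S c ω) (f := fun s => q (M.Y S y₀ s ω) s)
      (g := fun s => q (M.Yleft S y₀ s ω) s)
      (fun s _ hs => hS.tendsto_left k₀ hq (unitInterval.nonneg'.trans_lt hs) ω)).mul_const M.δ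
    rw [kindSum, ← Finset.sum_mul]
    refine this.congr fun n => ?_
    rw [hK, Finset.sum_mul]
    refine Finset.sum_congr rfl fun i _ => ?_
    simp only [hS.comp_eq, hf]
    ring
  have hcm : ∀ ω, Monotone fun t => M.comp S c t ω := fun ω a b hab => by
    simp only [hS.comp_eq]
    exact mul_le_mul_of_nonneg_left (count_mono _ hab) hδ.le
  have hKb : ∀ ω n, |K n ω| ≤ M.comp S c 1 ω := by
    intro ω n
    have h0 : 0 ≤ M.comp S c t₀ ω := by
      rw [hS.comp_eq]
      exact mul_nonneg hδ.le (count_nonneg _ _)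
    calc |K n ω| ≤ ∑ i ∈ Finset.range (n + 1),
          |f n i ω * (M.comp S c (grid t₀ n (i + 1)) ω - M.comp S c (grid t₀ n i) ω)| :=
          Finset.abs_sum_le_sum_abs _ _
      _ ≤ ∑ i ∈ Finset.range (n + 1),
          (M.comp S c (grid t₀ n (i + 1)) ω - M.comp S c (grid t₀ n i) ω) := by
          refine Finset.sum_le_sum fun i _ => ?_
          have h : 0 ≤ M.comp S c (grid t₀ n (i + 1)) ω - M.comp S c (grid t₀ n i) ω :=
            sub_nonneg.2 (hcm ω (grid_mono t₀ n i.le_succ))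
          rw [abs_mul, abs_of_nonneg h]
          exact mul_le_of_le_one_left h (hfb n i ω)
      _ = M.comp S c 1 ω - M.comp S c t₀ ω := sum_grid_telescope t₀ n (fun t => M.comp S c t ω)
      _ ≤ M.comp S c 1 ω := by linarith
  have hcompm : ∀ t, Measurable (M.comp S c t) := by
    intro t
    have h := ((hθ.martingale.1 t).measurable.mono (S.FI.le t) le_rfl).add
      ((hΛm t).const_mul M.δ)
    convert h using 1
    funext ω
    simp [hΛ]
  have hKm : ∀ n, Measurable (K n) := fun n =>
    Finset.measurable_fun_sum _ fun i _ => (hfm' n i).mul ((hcompm _).sub (hcompm _))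
  have hKi : Integrable (M.kindSum S y₀ t₀ c q) μ := by
    refine hNi.mono' (aestronglyMeasurable_of_tendsto_ae atTop
      (fun n => (hKm n).aestronglyMeasurable) (ae_of_all _ hKlim)) (ae_of_all _ fun ω => ?_)
    exact le_of_tendsto (hKlim ω).norm (Eventually.of_forall fun n => hKb ω n)
  have hGi : Integrable (fun ω => ∫ u in Ioc t₀ 1, q (M.Yleft S y₀ u ω) u * θ u ω) μ := by
    refine hΛi.mono' (aestronglyMeasurable_of_tendsto_ae atTop
      (fun n => (hGm n).aestronglyMeasurable) hGlim) ?_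
    filter_upwards [hGlim, hGb] with ω h1 h2
    exact le_of_tendsto h1.norm (Eventually.of_forall fun n => h2 n)
  refine ⟨hKi, hGi, ?_⟩
  have hKn : ∀ n, Integrable (K n) μ := fun n =>
    hNi.mono' (hKm n).aestronglyMeasurable (ae_of_all _ fun ω => hKb ω n)
  have hGn : ∀ n, Integrable (G n) μ := fun n =>
    hΛi.mono' (hGm n).aestronglyMeasurable (hGb.mono fun ω h => h n)
  have hzero : ∀ n, ∫ ω in A, K n ω ∂μ = M.δ * ∫ ω in A, G n ω ∂μ := by
    intro n
    have h1 : ∫ ω in A, (K n ω - M.δ * G n ω) ∂μ = 0 := by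
      have e : ∀ ω, K n ω - M.δ * G n ω = ∑ i ∈ Finset.range (n + 1), f n i ω *
          ((M.comp S c (grid t₀ n (i + 1)) ω - M.δ * Λ (grid t₀ n (i + 1)) ω) -
            (M.comp S c (grid t₀ n i) ω - M.δ * Λ (grid t₀ n i) ω)) := by
        intro ω
        rw [hK, hG, Finset.mul_sum, ← Finset.sum_sub_distrib]
        exact Finset.sum_congr rfl fun i _ => by ring
      simp only [e]
      rw [integral_finsetSum]
      · refine Finset.sum_eq_zero fun i _ => ?_
        exact setIntegral_mul_martingale_sub hθ.martingale (grid_mono t₀ n i.le_succ) (hfm n i)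
          (hfb n i) (S.FI.mono (by simpa [grid_zero] using grid_mono t₀ n i.zero_le) A hA)
      · intro i _
        refine Integrable.integrableOn ?_
        exact ((hθ.martingale.integrable _).sub (hθ.martingale.integrable _)).bdd_mul
          (hfm' n i).aestronglyMeasurable (c := 1) (ae_of_all _ fun ω => hfb n i ω)
    rw [integral_sub (hKn n).integrableOn ((hGn n).const_mul _).integrableOn,
      integral_const_mul] at h1
    linarith
  have l1 : Tendsto (fun n => ∫ ω in A, K n ω ∂μ) atTop
      (𝓝 (∫ ω in A, M.kindSum S y₀ t₀ c q ω ∂μ)) :=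
    tendsto_integral_of_dominated_convergence _ (fun n => (hKm n).aestronglyMeasurable)
      hNi.integrableOn (fun n => ae_of_all _ fun ω => hKb ω n) (ae_of_all _ hKlim)
  have l2 : Tendsto (fun n => ∫ ω in A, G n ω ∂μ) atTop
      (𝓝 (∫ ω in A, (∫ u in Ioc t₀ 1, q (M.Yleft S y₀ u ω) u * θ u ω) ∂μ)) :=
    tendsto_integral_of_dominated_convergence _ (fun n => (hGm n).aestronglyMeasurable)
      hΛi.integrableOn (fun n => ae_restrict_of_ae (hGb.mono fun ω h => h n))
      (ae_restrict_of_ae hGlim)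
  simp only [hzero] at l1
  exact tendsto_nhds_unique l1 (l2.const_mul _)

lemma isGain_unitGain [IsProbabilityMeasure μ] (M : Market Ω μ) (m : ℤ) (c : OrderKind) :
    IsGain M fun y t => M.unitGain (M.pz (M.δ * m)) 1 c y t := by
  have hm : ∀ t, Measurable fun y => M.pz (M.δ * m) y t := fun t => (M.monotone_pz _ t).measurable
  have hb : ∀ y t, |1 - M.pz (M.δ * m) y t| ≤ 1 := (M.isGain_one_sub_pz m).bound
  have hc : ∀ k : ℤ, Continuous fun t => M.pz (M.δ * m) (M.δ * k) t := M.continuous_pz m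
  refine ⟨fun t => ?_, fun y t => ?_, fun k => ?_⟩
  · cases c <;> simp only [unitGain]
    · exact measurable_const.sub ((hm t).comp (measurable_id.add_const _))
    · exact measurable_const.sub ((hm t).comp (measurable_id.add_const _))
    · exact measurable_const.sub (hm t)
    · exact (measurable_const.sub ((hm t).comp (measurable_id.sub_const _))).neg
    · exact (measurable_const.sub ((hm t).comp (measurable_id.sub_const _))).neg
    · exact (measurable_const.sub (hm t)).neg
  · cases c <;> simp only [unitGain, abs_neg] <;> exact hb _ t
  · have h1 : M.δ * k + M.δ = M.δ * ((k + 1 : ℤ) : ℝ) := by push_cast; ring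
    have h2 : M.δ * k + 2 * M.δ = M.δ * ((k + 2 : ℤ) : ℝ) := by push_cast; ring
    have h3 : M.δ * k - M.δ = M.δ * ((k - 1 : ℤ) : ℝ) := by push_cast; ring
    have h4 : M.δ * k - 2 * M.δ = M.δ * ((k - 2 : ℤ) : ℝ) := by push_cast; ring
    cases c <;> simp only [unitGain]
    · rw [h1]; exact continuous_const.sub (hc _)
    · rw [h2]; exact continuous_const.sub (hc _)
    · exact continuous_const.sub (hc _)
    · rw [h3]; exact (continuous_const.sub (hc _)).neg
    · rw [h4]; exact (continuous_const.sub (hc _)).neg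
    · exact (continuous_const.sub (hc _)).neg

lemma Admissible.measurableSet_state (hS : M.Admissible S) (y₀ x y : ℝ) (t : unitInterval) :
    MeasurableSet[S.FI t] (M.state S y₀ x y t) :=
  (hS.measurable_Y_FI y₀ t (measurableSet_singleton y)).inter (hS.measurableSet_v_eq x t)

/-- The expected remaining profit of the high type falls short of the expected shortfall by the
expected terminal shortfall and the expected loss from sell orders. -/
lemma Admissible.remainingProfit_one [IsProbabilityMeasure μ] (hS : M.Admissible S)
    {θ : OrderKind → unitInterval → Ω → ℝ} (hθ : M.HasIntensities S θ) (m k₀ k : ℤ)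
    (t : unitInterval) (hpos : μ (M.state S (M.δ * k₀) 1 (M.δ * k) t) ≠ 0) :
    M.remainingProfit (M.pz (M.δ * m)) S θ (M.δ * k₀) 1 (M.δ * k) t = M.shortfall m (M.δ * k) t -
      (μ.real (M.state S (M.δ * k₀) 1 (M.δ * k) t))⁻¹ *
      (∫ ω in M.state S (M.δ * k₀) 1 (M.δ * k) t, M.shortfall m (M.Y S (M.δ * k₀) 1 ω) 1 ∂μ +
      ∫ ω in M.state S (M.δ * k₀) 1 (M.δ * k) t, M.sellLoss S m (M.δ * k₀) t ω ∂μ) := by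
  set A := M.state S (M.δ * k₀) 1 (M.δ * k) t with hAdef
  have hA : MeasurableSet[S.FI t] A := hS.measurableSet_state _ _ _ _
  have hA' : MeasurableSet A := S.FI.le t _ hA
  have hpos' : 0 < μ.real A := ENNReal.toReal_pos hpos (by finiteness)
  have key := fun c => hS.setIntegral_kindSum (hθ c) k₀ t (M.isGain_unitGain m c) hA
  have hg := hS.setIntegral_gain m k₀ t hA
  have e0 : ∫ ω in A, M.shortfall m (M.Y S (M.δ * k₀) t ω) t ∂μ =
      μ.real A * M.shortfall m (M.δ * k) t := by
    rw [setIntegral_congr_fun (g := fun _ => M.shortfall m (M.δ * k) t) hA'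
      (fun ω hω => by simp only [hω.1])]
    rw [setIntegral_const, smul_eq_mul]
  have e1 : ∫ ω in A, (M.orderSum S (M.δ * k₀) t (buyTimes S)
        (fun y t => 1 - M.pz (M.δ * m) y t) ω - M.orderSum S (M.δ * k₀) t (sellTimes S)
        (fun y t => 1 - M.pz (M.δ * m) y t) ω) ∂μ =
      ∫ ω in A, (M.kindSum S (M.δ * k₀) t .BB (M.unitGain (M.pz (M.δ * m)) 1 .BB) ω +
        M.kindSum S (M.δ * k₀) t .BT (M.unitGain (M.pz (M.δ * m)) 1 .BT) ω +
        M.kindSum S (M.δ * k₀) t .BS (M.unitGain (M.pz (M.δ * m)) 1 .BS) ω +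
        M.kindSum S (M.δ * k₀) t .SS (M.unitGain (M.pz (M.δ * m)) 1 .SS) ω +
        M.kindSum S (M.δ * k₀) t .ST (M.unitGain (M.pz (M.δ * m)) 1 .ST) ω +
        M.kindSum S (M.δ * k₀) t .SB (M.unitGain (M.pz (M.δ * m)) 1 .SB) ω) ∂μ := by
    refine integral_congr_ae ?_
    filter_upwards [ae_restrict_of_ae M.disjoint_noiseTimes, ae_restrict_of_ae hS.disjoint_times]
      with ω h1 h2
    exact (hS.sum_kindGain (M.pz (M.δ * m)) 1 (M.δ * k₀) t h1 h2).symm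
  have i := fun c => (key c).1.integrableOn (s := A)
  have j := fun c => (key c).2.1.integrableOn (s := A)
  have six : ∀ f : OrderKind → Ω → ℝ, (∀ c, Integrable (f c) (μ.restrict A)) →
      ∫ ω in A, (f .BB ω + f .BT ω + f .BS ω + f .SS ω + f .ST ω + f .SB ω) ∂μ =
      ∫ ω in A, f .BB ω ∂μ + ∫ ω in A, f .BT ω ∂μ + ∫ ω in A, f .BS ω ∂μ +
        ∫ ω in A, f .SS ω ∂μ + ∫ ω in A, f .ST ω ∂μ + ∫ ω in A, f .SB ω ∂μ := by
    intro f hf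
    have h2 := (hf .BB).fun_add (hf .BT)
    have h3 := h2.fun_add (hf .BS)
    have h4 := h3.fun_add (hf .SS)
    have h5 := h4.fun_add (hf .ST)
    rw [integral_add h5 (hf .SB), integral_add h4 (hf .ST), integral_add h3 (hf .SS),
      integral_add h2 (hf .BS), integral_add (hf .BB) (hf .BT)]
  rw [e1, six (fun c => M.kindSum S (M.δ * k₀) t c (M.unitGain (M.pz (M.δ * m)) 1 c)) i,
    (key _).2.2, (key _).2.2, (key _).2.2, (key _).2.2, (key _).2.2, (key _).2.2, e0] at hg
  rw [remainingProfit, integral_cond, six (fun c ω => ∫ u in Ioc t 1,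
    M.unitGain (M.pz (M.δ * m)) 1 c (M.Yleft S (M.δ * k₀) u ω) u * θ c u ω) j]
  rw [← mul_add, ← mul_add, ← mul_add, ← mul_add, ← mul_add] at hg
  have fin : ∀ a b c : ℝ, (μ.real A)⁻¹ * (μ.real A * a - b - c) =
      a - (μ.real A)⁻¹ * (b + c) := by
    intro a b c
    field_simp
    ring
  rw [mul_left_comm, hg]
  exact fin _ _ _

/-- The expected remaining profit of the high type never exceeds the expected shortfall. -/
lemma Admissible.remainingProfit_one_le [IsProbabilityMeasure μ] (hS : M.Admissible S)
    {θ : OrderKind → unitInterval → Ω → ℝ} (hθ : M.HasIntensities S θ) (m k₀ k : ℤ)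
    (t : unitInterval) (hpos : μ (M.state S (M.δ * k₀) 1 (M.δ * k) t) ≠ 0) :
    M.remainingProfit (M.pz (M.δ * m)) S θ (M.δ * k₀) 1 (M.δ * k) t ≤
      M.shortfall m (M.δ * k) t := by
  rw [hS.remainingProfit_one hθ m k₀ k t hpos, sub_le_self_iff]
  exact mul_nonneg (inv_nonneg.2 measureReal_nonneg) (add_nonneg
    (integral_nonneg fun _ => M.shortfall_nonneg _ _ _)
    (integral_nonneg fun ω => hS.sellLoss_nonneg m k₀ t ω))

/-- Under the high condition the expected remaining profit attains the expected shortfall. -/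
lemma Admissible.remainingProfit_one_eq [IsProbabilityMeasure μ] (hS : M.Admissible S)
    {θ : OrderKind → unitInterval → Ω → ℝ} (hθ : M.HasIntensities S θ) (m k : ℤ)
    (t : unitInterval) (hpos : μ (M.state S 0 1 (M.δ * k) t) ≠ 0)
    (hH : M.HighCondition (M.δ * m) S) :
    M.remainingProfit (M.pz (M.δ * m)) S θ 0 1 (M.δ * k) t = M.shortfall m (M.δ * k) t := by
  have h0 : M.δ * ((0 : ℤ) : ℝ) = 0 := by simp
  have hA' : MeasurableSet (M.state S 0 1 (M.δ * k) t) :=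
    S.FI.le t _ (hS.measurableSet_state _ _ _ _)
  have h := hS.remainingProfit_one hθ m 0 k t (by rwa [h0])
  rw [h0] at h
  have hae : ∀ᵐ ω ∂μ.restrict (M.state S 0 1 (M.δ * k) t),
      M.shortfall m (M.Y S 0 1 ω) 1 = 0 ∧ M.sellLoss S m 0 t ω = 0 := by
    filter_upwards [ae_restrict_of_ae hH, ae_restrict_mem hA'] with ω h1 h2
    obtain ⟨h3, h4⟩ := h1 h2.2
    refine ⟨?_, ?_⟩
    · rw [M.shortfall_one, max_eq_right_iff]
      linarith
    · have := (hS.sell_comp_eq_zero_iff ω).1 h4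
      simp [sellLoss, orderSum, this]
  rw [h, integral_congr_ae (g := fun _ => (0 : ℝ)) (hae.mono fun ω h => h.1),
    integral_congr_ae (g := fun _ => (0 : ℝ)) (hae.mono fun ω h => h.2)]
  simp

end Market

/-! ### Independent exponential clocks -/

namespace Market

variable {Ω : Type*} [mΩ : MeasurableSpace Ω] {μ : Measure Ω} {M : Market Ω μ}

/-- A sequence of independent exponential waiting times with rate `r`, independent of the exogenous
data of the market. The independence of one waiting time from all others is stated jointly with the
market, the others being listed with a dummy entry at the place of the chosen one. -/
structure IsClockFamily (M : Market Ω μ) (E : ℕ → Ω → ℝ) (r : ℝ) : Prop where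
  measurable : ∀ j, Measurable (E j)
  pos : ∀ j ω, 0 < E j ω
  law : ∀ j x, 0 ≤ x → μ.real {ω | E j ω ≤ x} = 1 - Real.exp (-(r * x))
  indep_market : IndepFun (fun ω i => E i ω)
    (fun ω => (M.v ω, ((fun t => M.ZB t ω), (fun t => M.ZS t ω)))) μ
  indep_others : ∀ j, IndepFun
    (fun ω => ((M.v ω, fun t => M.Z t ω), fun i => if i = j then 0 else E i ω)) (E j) μ

/-- A random variable that is uniform on `[0, 1]` and independent of the market drives a family of
exponential clocks. -/
lemma exists_isClockFamily [IsProbabilityMeasure μ] (M : Market Ω μ) {U : Ω → ℝ}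
    (hU : Measurable U) (hU_law : HasLaw U (volume.restrict (Set.Icc (0 : ℝ) 1)) μ)
    (hU_indep : IndepFun U
      (fun ω => (M.v ω, ((fun t => M.ZB t ω), (fun t => M.ZS t ω)))) μ) {r : ℝ} (hr : 0 < r) :
    ∃ E : ℕ → Ω → ℝ, M.IsClockFamily E r := by
  have : IsProbabilityMeasure (expMeasure r) := isProbabilityMeasure_expMeasure hr
  obtain ⟨f, hf, hfmap⟩ := Measure.exists_measurable_map_eq
    (Measure.infinitePi fun _ : ℕ => expMeasure r)
  have hproj : Measurable (Set.projIcc (0 : ℝ) 1 zero_le_one) := continuous_projIcc.measurable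
  set g : ℝ → ℕ → ℝ := fun u => f (Set.projIcc 0 1 zero_le_one u) with hg
  have hgm : Measurable g := hf.comp hproj
  set X : ℕ → Ω → ℝ := fun j ω => g (U ω) j with hX
  have hXm : ∀ j, Measurable (X j) := fun j => (measurable_pi_apply j).comp (hgm.comp hU)
  have hvol : (volume.restrict (Set.Icc (0 : ℝ) 1)).map (Set.projIcc (0 : ℝ) 1 zero_le_one) =
      (volume : Measure unitInterval) := by
    have h1 : (volume.restrict (Set.Icc (0 : ℝ) 1)) =
        (volume : Measure unitInterval).map Subtype.val :=
      (map_comap_subtype_coe measurableSet_Icc volume).symm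
    rw [h1, Measure.map_map hproj measurable_subtype_coe]
    have : (Set.projIcc (0 : ℝ) 1 zero_le_one) ∘ Subtype.val = id := by
      funext u
      simp
    rw [this, Measure.map_id]
  have hXlaw : μ.map (fun ω i => X i ω) = Measure.infinitePi fun _ : ℕ => expMeasure r := by
    have e : (fun ω i => X i ω) = f ∘ (Set.projIcc (0 : ℝ) 1 zero_le_one) ∘ U := rfl
    rw [e, ← Measure.map_map hf (hproj.comp hU), ← Measure.map_map hproj hU, hU_law.map_eq, hvol,
      hfmap]
  have hXj : ∀ j, μ.map (X j) = expMeasure r := by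
    intro j
    have e : X j = (fun x : ℕ → ℝ => x j) ∘ fun ω i => X i ω := rfl
    rw [e, ← Measure.map_map (measurable_pi_apply j) (measurable_pi_lambda _ hXm), hXlaw]
    exact Measure.infinitePi_map_eval _ j
  have hXind : iIndepFun X μ := by
    rw [iIndepFun_iff_map_fun_eq_infinitePi_map hXm, hXlaw]
    simp only [hXj]
  -- the waiting times are made positive off a null set as well
  set pos : ℝ → ℝ := fun x => if 0 < x then x else 1 with hpos
  have hposm : Measurable pos :=
    Measurable.ite measurableSet_Ioi measurable_id measurable_const
  set E : ℕ → Ω → ℝ := fun j ω => pos (X j ω) with hE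
  have hEm : ∀ j, Measurable (E j) := fun j => hposm.comp (hXm j)
  have hEind : iIndepFun E μ := hXind.comp (fun _ => pos) fun _ => hposm
  have hEU : ∀ j, MeasurableSpace.comap (E j) inferInstance ≤
      MeasurableSpace.comap U inferInstance := fun j => by
    have : Measurable fun u => pos (g u j) :=
      hposm.comp ((measurable_pi_apply j).comp hgm)
    exact (this.comp (comap_measurable U)).comap_le
  have hindm : IndepFun (fun ω i => E i ω)
      (fun ω => (M.v ω, ((fun t => M.ZB t ω), (fun t => M.ZS t ω)))) μ :=
    hU_indep.comp (φ := fun u i => pos (g u i)) (measurable_pi_lambda _ fun i =>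
      hposm.comp ((measurable_pi_apply i).comp hgm)) measurable_id
  refine ⟨E, hEm, fun j ω => ?_, fun j x hx => ?_, hindm, fun j => ?_⟩
  · simp only [hE, hpos]
    split_ifs with h
    · exact h
    · exact one_pos
  · have hae : ∀ᵐ ω ∂μ, 0 < X j ω := by
      have h0 : μ.real (X j ⁻¹' Iic 0) = 0 := by
        rw [← map_measureReal_apply (hXm j) measurableSet_Iic, hXj, ← cdf_eq_real,
          cdf_expMeasure_eq hr]
        simp
      have h1 : μ (X j ⁻¹' Iic 0) = 0 := (measureReal_eq_zero_iff (by finiteness)).1 h0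
      rw [ae_iff]
      convert h1 using 2
      ext ω
      simp
    have h2 : μ.real {ω | E j ω ≤ x} = μ.real (X j ⁻¹' Iic x) := by
      refine measureReal_congr ?_
      filter_upwards [hae] with ω hω
      have : E j ω = X j ω := by simp [hE, hpos, hω]
      simp only [eq_iff_iff]
      change E j ω ≤ x ↔ X j ω ≤ x
      rw [this]
    rw [h2, ← map_measureReal_apply (hXm j) measurableSet_Iic, hXj, ← cdf_eq_real,
      cdf_expMeasure_eq hr, if_pos hx]
  · have hle : ∀ i, MeasurableSpace.comap (E i) inferInstance ≤ mΩ := fun i => (hEm i).comap_le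
    have hbc : Indep (⨆ i ∈ {i | i ≠ j}, MeasurableSpace.comap (E i) inferInstance)
        (⨆ i ∈ ({j} : Set ℕ), MeasurableSpace.comap (E i) inferInstance) μ :=
      indep_iSup_of_disjoint hle hEind (by simp)
    rw [iSup_singleton] at hbc
    have hb : (⨆ i ∈ {i | i ≠ j}, MeasurableSpace.comap (E i) inferInstance) ≤ mΩ :=
      iSup₂_le fun i _ => hle i
    set mkt : Ω → ℝ × ((unitInterval → ℝ) × (unitInterval → ℝ)) :=
      fun ω => (M.v ω, ((fun t => M.ZB t ω), (fun t => M.ZS t ω))) with hmkt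
    have hmktm : Measurable mkt := M.v_measurable.prodMk
      ((measurable_pi_lambda _ fun t => M.measurable_ZB t).prodMk
        (measurable_pi_lambda _ fun t => M.measurable_ZS t))
    have h : Indep (MeasurableSpace.comap mkt inferInstance)
        ((⨆ i ∈ {i | i ≠ j}, MeasurableSpace.comap (E i) inferInstance) ⊔
          MeasurableSpace.comap (E j) inferInstance) μ := by
      refine indep_of_indep_of_le_right (hU_indep.symm : IndepFun mkt U μ) ?_
      exact sup_le (iSup₂_le fun i _ => hEU i) (hEU j)
    have h2 := Indep.sup_left hmktm.comap_le hb (hle j) h hbc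
    refine indep_of_indep_of_le_left h2 ?_
    have m1 : Measurable[MeasurableSpace.comap mkt inferInstance]
        fun ω => (M.v ω, fun t => M.Z t ω) := by
      have : Measurable fun p : ℝ × ((unitInterval → ℝ) × (unitInterval → ℝ)) =>
          (p.1, fun t => p.2.1 t - p.2.2 t) := by fun_prop
      exact this.comp (comap_measurable mkt)
    have m2 : Measurable[⨆ i ∈ {i | i ≠ j}, MeasurableSpace.comap (E i) inferInstance]
        fun ω i => if i = j then 0 else E i ω := by
      refine @measurable_pi_lambda _ _ _ (_) _ _ fun i => ?_
      by_cases hi : i = j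
      · simp only [hi, if_true]
        exact measurable_const
      · simp only [hi, if_false]
        exact (comap_measurable (E i)).mono (le_iSup₂_of_le i hi le_rfl) le_rfl
    exact ((m1.mono le_sup_left le_rfl).prodMk (m2.mono le_sup_right le_rfl)).comap_le

namespace IsClockFamily

variable {E : ℕ → Ω → ℝ} {r : ℝ}

lemma measureReal_lt [IsProbabilityMeasure μ] (hE : M.IsClockFamily E r) (j : ℕ) {x : ℝ}
    (hx : 0 ≤ x) : μ.real {ω | x < E j ω} = Real.exp (-(r * x)) := by
  have hm : MeasurableSet {ω | E j ω ≤ x} := hE.measurable j measurableSet_Iic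
  have e : {ω | x < E j ω} = {ω | E j ω ≤ x}ᶜ := by
    ext ω
    simp
  rw [e, measureReal_compl hm, hE.law j x hx, probReal_univ]
  ring

lemma integrable_min [IsProbabilityMeasure μ] (hE : M.IsClockFamily E r) (j : ℕ) {x : ℝ}
    (hx : 0 ≤ x) : Integrable (fun ω => min (E j ω) x) μ := by
  refine (integrable_const x).mono' ((hE.measurable j).min measurable_const).aestronglyMeasurable
    (ae_of_all _ fun ω => ?_)
  rw [Real.norm_of_nonneg (le_min (hE.pos j ω).le hx)]
  exact min_le_right _ _

/-- The compensator of an exponential clock: the probability that it has rung by time `x` is the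
rate times the expected time spent waiting before `x`. -/
lemma measureReal_le_eq [IsProbabilityMeasure μ] (hE : M.IsClockFamily E r) (hr : 0 < r) (j : ℕ)
    {x : ℝ} (hx : 0 ≤ x) :
    μ.real {ω | E j ω ≤ x} = r * ∫ ω, min (E j ω) x ∂μ := by
  have h := (hE.integrable_min j hx).integral_eq_integral_meas_lt
    (ae_of_all _ fun ω => le_min (hE.pos j ω).le hx)
  have e : ∀ t ∈ Ioi (0 : ℝ), μ.real {ω | t < min (E j ω) x} =
      (Iio x).indicator (fun t => Real.exp (-(r * t))) t := by
    intro t ht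
    by_cases htx : t < x
    · rw [indicator_of_mem (show t ∈ Iio x from htx), ← hE.measureReal_lt j (le_of_lt ht)]
      congr 1
      ext ω
      simp [htx]
    · rw [indicator_of_notMem (show t ∉ Iio x from htx)]
      have : {ω | t < min (E j ω) x} = ∅ := by
        ext ω
        simp [htx]
      rw [this, measureReal_empty]
  rw [setIntegral_congr_fun measurableSet_Ioi e, setIntegral_indicator measurableSet_Iio,
    Ioi_inter_Iio, ← integral_Ioc_eq_integral_Ioo, ← intervalIntegral.integral_of_le hx] at h
  have hd : ∀ t ∈ uIcc 0 x, HasDerivAt (fun t => -(r⁻¹ * Real.exp (-(r * t))))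
      (Real.exp (-(r * t))) t := by
    intro t _
    have h1 : HasDerivAt (fun t => -(r * t)) (-r) t := by
      simpa using (hasDerivAt_id t).const_mul (-r)
    have h2 := h1.exp.const_mul (-r⁻¹)
    have e1 : (fun t => -(r⁻¹ * Real.exp (-(r * t)))) = fun t => -r⁻¹ * Real.exp (-(r * t)) := by
      funext t
      ring
    have e2 : -r⁻¹ * (Real.exp (-(r * t)) * -r) = Real.exp (-(r * t)) := by
      field_simp
    rw [e1]
    rwa [e2] at h2
  rw [intervalIntegral.integral_eq_sub_of_hasDerivAt hd
    (Continuous.intervalIntegrable (by fun_prop) _ _)] at h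
  rw [h, hE.law j x hx]
  simp only [mul_zero, neg_zero, Real.exp_zero]
  field_simp
  ring

end IsClockFamily

end Market

/-! ### Completed filtrations generated by right-constant observations -/

/-- If what is observed up to time `t` is, path by path, the same as what is observed up to some
later time, then the completed observation filtration is right-continuous. -/
lemma isRightContinuous_of_eventually_eq {Ω : Type*} [mΩ : MeasurableSpace Ω] {μ : Measure Ω}
    {𝓧 : Type*} [m𝓧 : MeasurableSpace 𝓧] (W : unitInterval → Ω → 𝓧)
    (ℱ : Filtration unitInterval mΩ)
    (hℱ : ∀ t, (ℱ t : MeasurableSpace Ω) =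
      eventuallyMeasurableSpace (MeasurableSpace.comap (W t) inferInstance) (ae μ))
    (hW : ∀ t, t < 1 → ∀ ω, ∀ᶠ s in 𝓝[>] t, W s ω = W t ω) : ℱ.IsRightContinuous := by
  refine ⟨fun t => ?_⟩
  rcases eq_or_lt_of_le (unitInterval.le_one' : t ≤ 1) with rfl | ht
  · rw [Filtration.rightCont_eq_of_isMax _ fun _ _ => unitInterval.le_one']
  · rw [Filtration.rightCont_eq_of_not_isMax _ (not_isMax_of_lt ht)]
    intro A hA
    -- times decreasing to `t`
    obtain ⟨s, -, hs, hst⟩ := exists_seq_strictAnti_tendsto' ht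
    have hst' : Tendsto s atTop (𝓝[>] t) :=
      tendsto_nhdsWithin_iff.2 ⟨hst, Eventually.of_forall fun n => (hs n).1⟩
    have hAn : ∀ n, ∃ D : Set 𝓧, MeasurableSet D ∧ A =ᵐ[μ] W (s n) ⁻¹' D := by
      intro n
      have h1 : MeasurableSet[ℱ (s n)] A :=
        (iInf₂_le (s n) (hs n).1 : (⨅ j > t, (ℱ j : MeasurableSpace Ω)) ≤ ℱ (s n)) A hA
      rw [hℱ] at h1
      obtain ⟨B, ⟨D, hD, rfl⟩, hB⟩ := h1
      exact ⟨D, hD, hB⟩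
    choose D hD hAD using hAn
    rw [hℱ]
    refine ⟨W t ⁻¹' (⋃ N, ⋂ n, ⋂ _ : N ≤ n, D n), ⟨_, MeasurableSet.iUnion fun N =>
      MeasurableSet.iInter fun n => MeasurableSet.iInter fun _ => hD n, rfl⟩, ?_⟩
    refine eventuallyEq_set.2 ?_
    filter_upwards [ae_all_iff.2 fun n => (hAD n).mem_iff] with ω hω'
    obtain ⟨N, hN⟩ := eventually_atTop.1 (hst'.eventually (hW t ht ω))
    change ω ∈ A ↔ W t ω ∈ ⋃ N, ⋂ n, ⋂ _ : N ≤ n, D n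
    simp only [mem_iUnion, mem_iInter]
    constructor
    · intro hA
      exact ⟨N, fun n hn => hN n hn ▸ (hω' n).1 hA⟩
    · rintro ⟨N', hN'⟩
      have h := hN' (max N N') (le_max_right _ _)
      rw [← hN (max N N') (le_max_left _ _)] at h
      exact (hω' _).2 h

lemma eventuallyMeasurableSpace_le_of_isComplete {Ω : Type*} [mΩ : MeasurableSpace Ω]
    {μ : Measure Ω} [μ.IsComplete] {a : MeasurableSpace Ω} (ha : a ≤ mΩ) :
    eventuallyMeasurableSpace a (ae μ) ≤ mΩ := by
  rintro A ⟨B, hB, hAB⟩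
  exact NullMeasurableSet.measurable_of_complete ⟨B, ha B hB, hAB⟩

lemma eventuallyMeasurableSpace_mono {Ω : Type*} {l : Filter Ω} [CountableInterFilter l]
    {a b : MeasurableSpace Ω} (hab : a ≤ b) :
    eventuallyMeasurableSpace a l ≤ eventuallyMeasurableSpace b l :=
  fun _ ⟨B, hB, hAB⟩ => ⟨B, hab B hB, hAB⟩

/-- Completing one of two sigma-algebras completes their supremum. -/
lemma sup_eventuallyMeasurableSpace {Ω : Type*} {l : Filter Ω} [CountableInterFilter l]
    (a b : MeasurableSpace Ω) :
    a ⊔ eventuallyMeasurableSpace b l = eventuallyMeasurableSpace (a ⊔ b) l := by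
  refine le_antisymm (sup_le (le_sup_left.trans (le_eventuallyMeasurableSpace (l := l)))
    (eventuallyMeasurableSpace_mono le_sup_right)) ?_
  rintro A ⟨B, hB, hAB⟩
  have hB' : MeasurableSet[a ⊔ eventuallyMeasurableSpace b l] B :=
    (sup_le_sup_left (le_eventuallyMeasurableSpace (l := l)) a) B hB
  have hnull : ∀ C : Set Ω, C =ᶠ[l] (∅ : Set Ω) →
      MeasurableSet[a ⊔ eventuallyMeasurableSpace b l] C := fun C hC =>
    (le_sup_right : eventuallyMeasurableSpace b l ≤ _) C ⟨∅, MeasurableSet.empty, hC⟩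
  have e : A = (B \ (B \ A)) ∪ (A \ B) := by
    ext ω
    simp only [mem_union, Set.mem_sdiff]
    tauto
  rw [e]
  refine (hB'.diff (hnull _ ?_)).union (hnull _ ?_)
  · have := (EventuallyEq.refl l B).diff hAB
    simpa using this
  · have := (EventuallyEq.refl l A).diff hAB.symm
    simpa using this

lemma indep_eventuallyMeasurableSpace {Ω : Type*} [mΩ : MeasurableSpace Ω] {μ : Measure Ω}
    {a b : MeasurableSpace Ω} (h : Indep a b μ) :
    Indep (eventuallyMeasurableSpace a (ae μ)) b μ := by
  rw [Indep_iff] at h ⊢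
  rintro A B ⟨A', hA', hAA'⟩ hB
  rw [measure_congr hAA', measure_congr (hAA'.inter (EventuallyEq.refl _ B)), h A' B hA' hB]

/-! ### Orders driven by clocks -/

/-- The time spent up to time `t` in the `j`-th cell of the grid. -/
noncomputable def cellTime (t₀ : unitInterval) (n j : ℕ) (t : unitInterval) : ℝ :=
  max (min (t : ℝ) (grid t₀ n (j + 1)) - grid t₀ n j) 0

lemma cellTime_nonneg (t₀ : unitInterval) (n j : ℕ) (t : unitInterval) : 0 ≤ cellTime t₀ n j t :=
  le_max_right _ _

lemma cellTime_mono (t₀ : unitInterval) (n j : ℕ) : Monotone (cellTime t₀ n j) := fun _ _ hst =>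
  max_le_max (sub_le_sub_right (min_le_min_right _ (Subtype.coe_le_coe.2 hst)) _) le_rfl

lemma continuous_cellTime (t₀ : unitInterval) (n j : ℕ) : Continuous (cellTime t₀ n j) := by
  unfold cellTime
  fun_prop

lemma cellTime_of_le {t₀ : unitInterval} {n j : ℕ} {t : unitInterval} (h : t ≤ grid t₀ n j) :
    cellTime t₀ n j t = 0 :=
  max_eq_right (sub_nonpos.2 ((min_le_left _ _).trans (Subtype.coe_le_coe.2 h)))

lemma grid_of_ge (t₀ : unitInterval) {n j : ℕ} (hj : n + 1 ≤ j) : grid t₀ n j = 1 :=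
  le_antisymm unitInterval.le_one' (grid_last t₀ n ▸ grid_mono t₀ n hj)

lemma le_grid (t₀ : unitInterval) (n j : ℕ) : t₀ ≤ grid t₀ n j := by
  simpa [grid_zero] using grid_mono t₀ n j.zero_le

lemma cellTime_of_ge (t₀ : unitInterval) {n j : ℕ} (hj : n + 1 ≤ j) (t : unitInterval) :
    cellTime t₀ n j t = 0 :=
  cellTime_of_le (by rw [grid_of_ge t₀ hj]; exact unitInterval.le_one')

lemma grid_le_succ (t₀ : unitInterval) (n j : ℕ) :
    (grid t₀ n j : ℝ) ≤ grid t₀ n (j + 1) :=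
  Subtype.coe_le_coe.2 (grid_mono t₀ n j.le_succ)

lemma cellTime_one (t₀ : unitInterval) (n j : ℕ) :
    cellTime t₀ n j 1 = (grid t₀ n (j + 1) : ℝ) - grid t₀ n j := by
  have h1 : ((grid t₀ n (j + 1) : unitInterval) : ℝ) ≤ ((1 : unitInterval) : ℝ) :=
    Subtype.coe_le_coe.2 unitInterval.le_one'
  rw [cellTime, min_eq_right h1, max_eq_left (sub_nonneg.2 (grid_le_succ t₀ n j))]

lemma lipschitz_min_cellTime (t₀ : unitInterval) (n j : ℕ) (x : ℝ) (s t : unitInterval) :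
    |min x (cellTime t₀ n j s) - min x (cellTime t₀ n j t)| ≤ |(s : ℝ) - t| := by
  unfold cellTime
  refine (abs_min_sub_min_le_max _ _ _ _).trans ?_
  rw [sub_self, abs_zero, max_eq_right (abs_nonneg _)]
  refine (abs_max_sub_max_le_abs _ _ _).trans ?_
  rw [sub_sub_sub_cancel_right]
  refine (abs_min_sub_min_le_max _ _ _ _).trans ?_
  rw [sub_self, abs_zero, max_eq_left (abs_nonneg _)]

/-- What is known at time `t` about the waiting times `x`: those that have elapsed, where the
`j`-th clock runs during the `j`-th cell of the grid only. The value `0` stands for a waiting time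
that has not yet elapsed. -/
noncomputable def elapsed (t₀ : unitInterval) (n : ℕ) (t : unitInterval) (x : ℕ → ℝ) (j : ℕ) : ℝ :=
  if x j ≤ cellTime t₀ n j t then x j else 0

lemma measurable_elapsed (t₀ : unitInterval) (n : ℕ) (t : unitInterval) :
    Measurable (elapsed t₀ n t) := by
  refine measurable_pi_lambda _ fun j => ?_
  exact Measurable.ite (measurableSet_le (measurable_pi_apply j) measurable_const)
    (measurable_pi_apply j) measurable_const

lemma elapsed_elapsed (t₀ : unitInterval) (n : ℕ) {s t : unitInterval} (hst : s ≤ t)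
    (x : ℕ → ℝ) : elapsed t₀ n s (elapsed t₀ n t x) = elapsed t₀ n s x := by
  funext j
  have h := cellTime_mono t₀ n j hst
  have h0 := cellTime_nonneg t₀ n j s
  simp only [elapsed]
  by_cases h1 : x j ≤ cellTime t₀ n j t
  · simp only [h1, if_true]
  · have h2 : ¬ x j ≤ cellTime t₀ n j s := fun h2 => h1 (h2.trans h)
    simp only [h1, h2, if_false, h0, if_true]

lemma elapsed_eventuallyEq (t₀ : unitInterval) (n : ℕ) (t : unitInterval) {x : ℕ → ℝ}
    (hx : ∀ j, 0 < x j) : ∀ᶠ s in 𝓝[>] t, elapsed t₀ n s x = elapsed t₀ n t x := by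
  have h : ∀ᶠ s in 𝓝[>] t, ∀ j ∈ Finset.range (n + 1),
      elapsed t₀ n s x j = elapsed t₀ n t x j := by
    rw [Filter.eventually_all_finset]
    intro j _
    by_cases h1 : x j ≤ cellTime t₀ n j t
    · filter_upwards [self_mem_nhdsWithin] with s hs
      simp only [elapsed, h1, h1.trans (cellTime_mono t₀ n j (le_of_lt hs)), if_true]
    · have h2 : ∀ᶠ s in 𝓝[>] t, cellTime t₀ n j s < x j :=
        (((continuous_cellTime t₀ n j).tendsto t).mono_left nhdsWithin_le_nhds).eventually
          (gt_mem_nhds (not_le.1 h1))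
      filter_upwards [h2] with s hs
      simp only [elapsed, h1, not_le.2 hs, if_false]
  filter_upwards [h] with s hs
  funext j
  by_cases hj : j < n + 1
  · exact hs j (Finset.mem_range.2 hj)
  · simp only [elapsed, cellTime_of_ge t₀ (not_lt.1 hj), not_le.2 (hx j), if_false]

/-- The time at which the `j`-th clock rings, if it rings during its cell. -/
noncomputable def alarm (t₀ : unitInterval) (n : ℕ) (x : ℕ → ℝ) (j : ℕ) : unitInterval :=
  Set.projIcc 0 1 zero_le_one (grid t₀ n j + x j)

/-- The ringing times of the clocks that ring during their cells. -/
noncomputable def alarms (t₀ : unitInterval) (n : ℕ) (x : ℕ → ℝ) : Finset unitInterval :=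
  ((Finset.range (n + 1)).filter fun j => x j ≤ cellTime t₀ n j 1).image (alarm t₀ n x)

lemma coe_alarm {t₀ : unitInterval} {n j : ℕ} {x : ℕ → ℝ} (hx : 0 < x j)
    (h : x j ≤ cellTime t₀ n j 1) : (alarm t₀ n x j : ℝ) = grid t₀ n j + x j := by
  rw [cellTime_one] at h
  have h1 : (0 : ℝ) ≤ grid t₀ n j := (grid t₀ n j).2.1
  have h2 : (grid t₀ n (j + 1) : ℝ) ≤ 1 := (grid t₀ n (j + 1)).2.2
  rw [alarm, Set.projIcc_of_mem zero_le_one ⟨by linarith, by linarith⟩]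

lemma alarm_mem_Ioc {t₀ : unitInterval} {n j : ℕ} {x : ℕ → ℝ} (hx : 0 < x j)
    (h : x j ≤ cellTime t₀ n j 1) :
    alarm t₀ n x j ∈ Ioc (grid t₀ n j) (grid t₀ n (j + 1)) := by
  have h1 := coe_alarm hx h
  rw [cellTime_one] at h
  refine ⟨Subtype.coe_lt_coe.1 ?_, Subtype.coe_le_coe.1 ?_⟩ <;> rw [h1] <;> linarith

lemma alarm_le_iff {t₀ : unitInterval} {n j : ℕ} {x : ℕ → ℝ} (hx : 0 < x j)
    (h : x j ≤ cellTime t₀ n j 1) (t : unitInterval) :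
    alarm t₀ n x j ≤ t ↔ x j ≤ cellTime t₀ n j t := by
  rw [← Subtype.coe_le_coe, coe_alarm hx h]
  rw [cellTime_one] at h
  rw [cellTime, le_max_iff, or_iff_left (not_le.2 hx), le_sub_iff_add_le, le_min_iff]
  constructor
  · intro h1
    exact ⟨by linarith, by linarith⟩
  · intro h1
    linarith [h1.1]

lemma alarm_injOn (t₀ : unitInterval) (n : ℕ) {x : ℕ → ℝ} (hx : ∀ j, 0 < x j) :
    Set.InjOn (alarm t₀ n x)
      ((Finset.range (n + 1)).filter fun j => x j ≤ cellTime t₀ n j 1) := by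
  have key : ∀ i j, i < j → x i ≤ cellTime t₀ n i 1 → x j ≤ cellTime t₀ n j 1 →
      alarm t₀ n x i < alarm t₀ n x j := fun i j hij hi hj =>
    ((alarm_mem_Ioc (hx i) hi).2.trans (grid_mono t₀ n hij)).trans_lt (alarm_mem_Ioc (hx j) hj).1
  intro i hi j hj hij
  have hi' := (Finset.mem_filter.1 (Finset.mem_coe.1 hi)).2
  have hj' := (Finset.mem_filter.1 (Finset.mem_coe.1 hj)).2
  rcases lt_trichotomy i j with h | h | h
  · exact absurd hij (key i j h hi' hj').ne
  · exact h
  · exact absurd hij (key j i h hj' hi').ne'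

lemma count_alarms (t₀ : unitInterval) (n : ℕ) {x : ℕ → ℝ} (hx : ∀ j, 0 < x j)
    (t : unitInterval) : count (alarms t₀ n x) t =
      ∑ j ∈ Finset.range (n + 1), if x j ≤ cellTime t₀ n j t then 1 else 0 := by
  rw [count_eq_sum, alarms, Finset.sum_image (alarm_injOn t₀ n hx), Finset.sum_filter]
  refine Finset.sum_congr rfl fun j _ => ?_
  by_cases h : x j ≤ cellTime t₀ n j 1
  · rw [if_pos h]
    simp only [alarm_le_iff (hx j) h]
  · rw [if_neg h, if_neg fun h' => h (h'.trans (cellTime_mono t₀ n j unitInterval.le_one'))]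

lemma lt_of_mem_alarms {t₀ : unitInterval} {n : ℕ} {x : ℕ → ℝ} (hx : ∀ j, 0 < x j)
    {s : unitInterval} (hs : s ∈ alarms t₀ n x) : t₀ < s := by
  obtain ⟨j, hj, rfl⟩ := Finset.mem_image.1 hs
  exact (le_grid t₀ n j).trans_lt (alarm_mem_Ioc (hx j) (Finset.mem_filter.1 hj).2).1

lemma zero_notMem_alarms (t₀ : unitInterval) (n : ℕ) {x : ℕ → ℝ} (hx : ∀ j, 0 < x j) :
    0 ∉ alarms t₀ n x := fun h => absurd (lt_of_mem_alarms hx h) (not_lt.2 unitInterval.nonneg')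

/-- The rate at which the clocks ring at time `u`: the `j`-th clock contributes during its cell,
until it has rung. -/
noncomputable def clockRate (t₀ : unitInterval) (n : ℕ) (r : ℝ) (x : ℕ → ℝ) (u : unitInterval) :
    ℝ :=
  r * ∑ j ∈ Finset.range (n + 1),
    {u : unitInterval | u ∈ Ioc (grid t₀ n j) (grid t₀ n (j + 1)) ∧
      (u : ℝ) - grid t₀ n j ≤ x j}.indicator (fun _ => (1 : ℝ)) u

/-- The accumulated rate up to time `t`. -/
noncomputable def clockCompensator (t₀ : unitInterval) (n : ℕ) (r : ℝ) (x : ℕ → ℝ)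
    (t : unitInterval) : ℝ :=
  r * ∑ j ∈ Finset.range (n + 1), min (x j) (cellTime t₀ n j t)

lemma measurableSet_running (t₀ : unitInterval) (n j : ℕ) (c : ℝ) :
    MeasurableSet {u : unitInterval | u ∈ Ioc (grid t₀ n j) (grid t₀ n (j + 1)) ∧
      (u : ℝ) - grid t₀ n j ≤ c} :=
  measurableSet_Ioc.inter (measurableSet_le (measurable_subtype_coe.sub_const _) measurable_const)

lemma integrable_clockRate (t₀ : unitInterval) (n : ℕ) (r : ℝ) (x : ℕ → ℝ) :
    Integrable (clockRate t₀ n r x) volume := by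
  refine (integrable_finsetSum _ fun j _ => ?_).const_mul r
  exact (integrable_const (1 : ℝ)).indicator (measurableSet_running t₀ n j _)

lemma integral_clockRate (t₀ : unitInterval) (n : ℕ) (r : ℝ) {x : ℕ → ℝ} (hx : ∀ j, 0 < x j)
    (t : unitInterval) : ∫ u in Iic t, clockRate t₀ n r x u = clockCompensator t₀ n r x t := by
  simp only [clockRate, clockCompensator]
  rw [integral_const_mul, integral_finsetSum]
  swap
  · exact fun j _ => ((integrable_const (1 : ℝ)).indicator
      (measurableSet_running t₀ n j _)).integrableOn
  congr 1
  refine Finset.sum_congr rfl fun j _ => ?_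
  rw [setIntegral_indicator (measurableSet_running t₀ n j _)]
  set a := grid t₀ n j with ha
  set b := grid t₀ n (j + 1) with hb
  set y := min (x j) (cellTime t₀ n j t) with hy
  have hy0 : 0 ≤ y := le_min (hx j).le (cellTime_nonneg t₀ n j t)
  have hy1 : (a : ℝ) + y ≤ 1 := by
    have h1 : y ≤ cellTime t₀ n j 1 :=
      (min_le_right _ _).trans (cellTime_mono t₀ n j unitInterval.le_one')
    rw [cellTime_one] at h1
    have h2 : (b : ℝ) ≤ 1 := b.2.2
    linarith
  have ha0 : (0 : ℝ) ≤ a := a.2.1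
  set s : unitInterval := ⟨a + y, by linarith, hy1⟩ with hs
  have e : Iic t ∩ {u : unitInterval | u ∈ Ioc a b ∧ (u : ℝ) - a ≤ x j} = Ioc a s := by
    ext u
    have key : a < u → (u ≤ s ↔ u ≤ t ∧ u ≤ b ∧ (u : ℝ) - a ≤ x j) := by
      intro hau
      have hau' : (0 : ℝ) < (u : ℝ) - a := sub_pos.2 (Subtype.coe_lt_coe.2 hau)
      rw [← Subtype.coe_le_coe, ← Subtype.coe_le_coe, ← Subtype.coe_le_coe]
      change (u : ℝ) ≤ a + y ↔ _
      rw [← sub_le_iff_le_add', hy, le_min_iff, cellTime, le_max_iff,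
        or_iff_left (not_le.2 hau'), sub_le_sub_iff_right, le_min_iff]
      tauto
    simp only [mem_inter_iff, mem_Iic, mem_ofPred_eq, mem_Ioc]
    constructor
    · rintro ⟨h1, ⟨h2, h3⟩, h4⟩
      exact ⟨h2, (key h2).2 ⟨h1, h3, h4⟩⟩
    · rintro ⟨h1, h2⟩
      obtain ⟨h3, h4, h5⟩ := (key h1).1 h2
      exact ⟨h3, ⟨h1, h4⟩, h5⟩
  have has : a ≤ s := Subtype.coe_le_coe.1 (by change (a : ℝ) ≤ a + y; linarith)
  rw [e, setIntegral_const, Market.measureReal_Ioc a s has, smul_eq_mul, mul_one]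
  change (a : ℝ) + y - a = y
  ring

lemma clockCompensator_zero (t₀ : unitInterval) (n : ℕ) (r : ℝ) {x : ℕ → ℝ} (hx : ∀ j, 0 < x j) :
    clockCompensator t₀ n r x 0 = 0 := by
  rw [clockCompensator, Finset.sum_eq_zero, mul_zero]
  intro j _
  rw [cellTime_of_le unitInterval.nonneg', min_eq_right (hx j).le]

lemma lipschitz_clockCompensator (t₀ : unitInterval) (n : ℕ) {r : ℝ} (hr : 0 ≤ r) (x : ℕ → ℝ)
    (s t : unitInterval) : |clockCompensator t₀ n r x s - clockCompensator t₀ n r x t| ≤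
      r * (n + 1) * |(s : ℝ) - t| := by
  rw [clockCompensator, clockCompensator, ← mul_sub, ← Finset.sum_sub_distrib, abs_mul,
    abs_of_nonneg hr, mul_assoc]
  refine mul_le_mul_of_nonneg_left ((Finset.abs_sum_le_sum_abs _ _).trans
    ((Finset.sum_le_sum fun j _ => lipschitz_min_cellTime t₀ n j (x j) s t).trans ?_)) hr
  rw [Finset.sum_const, Finset.card_range, nsmul_eq_mul]
  push_cast
  rfl

namespace Market

variable {Ω : Type*} [mΩ : MeasurableSpace Ω] {μ : Measure Ω} {M : Market Ω μ}

variable (M) in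
/-- Everything an insider who knows the fundamental value observes up to time `t`: the fundamental
value, the path of noise orders stopped at `t`, and the elapsed waiting times. -/
noncomputable def observed (E : ℕ → Ω → ℝ) (t₀ : unitInterval) (n : ℕ) (t : unitInterval) (ω : Ω) :
    (ℝ × (unitInterval → ℝ)) × (ℕ → ℝ) :=
  ((M.v ω, fun r => M.Z (min r t) ω), elapsed t₀ n t fun j => E j ω)

lemma comap_observed (M : Market Ω μ) (E : ℕ → Ω → ℝ) (t₀ : unitInterval) (n : ℕ)
    (t : unitInterval) : MeasurableSpace.comap (M.observed E t₀ n t) inferInstance =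
      MeasurableSpace.comap M.v inferInstance ⊔ history M.Z t ⊔
        MeasurableSpace.comap (fun ω => elapsed t₀ n t fun j => E j ω) inferInstance := by
  have h1 : MeasurableSpace.comap (fun ω r => M.Z (min r t) ω) inferInstance = history M.Z t := by
    refine le_antisymm ?_ (iSup₂_le fun s hs => ?_)
    · refine Measurable.comap_le ?_
      exact @measurable_pi_lambda _ _ _ (_) _ _ fun r => measurable_history M.Z (min_le_right r t)
    · have : M.Z s = fun ω => (fun ω r => M.Z (min r t) ω) ω s := by
        funext ω
        simp only [min_eq_left hs]
      rw [this]
      exact ((measurable_pi_apply s).comp (comap_measurable fun ω r => M.Z (min r t) ω)).comap_le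
  rw [← h1, ← MeasurableSpace.comap_prodMk, ← MeasurableSpace.comap_prodMk]
  rfl

/-- The filtration of an insider who observes the fundamental value, the noise orders and the
clocks. -/
noncomputable def clockFiltration [μ.IsComplete] (M : Market Ω μ) (E : ℕ → Ω → ℝ)
    (hE : ∀ j, Measurable (E j)) (t₀ : unitInterval) (n : ℕ) : Filtration unitInterval mΩ where
  seq t := MeasurableSpace.comap M.v inferInstance ⊔ history M.Z t ⊔
    eventuallyMeasurableSpace
      (MeasurableSpace.comap (fun ω => elapsed t₀ n t fun j => E j ω) inferInstance) (ae μ)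
  mono' s t hst := by
    refine sup_le_sup (sup_le_sup_left (history_mono M.Z hst) _)
      (eventuallyMeasurableSpace_mono ?_)
    have : (fun ω => elapsed t₀ n s fun j => E j ω) =
        elapsed t₀ n s ∘ fun ω => elapsed t₀ n t fun j => E j ω := by
      funext ω
      exact (elapsed_elapsed t₀ n hst _).symm
    rw [this]
    exact ((measurable_elapsed t₀ n s).comp (comap_measurable _)).comap_le
  le' t := sup_le (sup_le M.comap_v_le (history_le M.measurable_Z t))
    (eventuallyMeasurableSpace_le_of_isComplete
      ((measurable_elapsed t₀ n t).comp (measurable_pi_lambda _ hE)).comap_le)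

lemma clockFiltration_eq [μ.IsComplete] (M : Market Ω μ) (E : ℕ → Ω → ℝ)
    (hE : ∀ j, Measurable (E j)) (t₀ : unitInterval) (n : ℕ) (t : unitInterval) :
    (M.clockFiltration E hE t₀ n t : MeasurableSpace Ω) =
      eventuallyMeasurableSpace (MeasurableSpace.comap (M.observed E t₀ n t) inferInstance)
        (ae μ) := by
  rw [comap_observed, ← sup_eventuallyMeasurableSpace]
  rfl

lemma stopped_Z_eventuallyEq (M : Market Ω μ) (t : unitInterval) (ht : t < 1) (ω : Ω) :
    ∀ᶠ s in 𝓝[>] t, (fun r => M.Z (min r s) ω) = fun r => M.Z (min r t) ω := by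
  have h : ∀ᶠ s in 𝓝[>] t, M.Z s ω = M.Z t ω := by
    have h1 := (count_eventuallyEq_right (M.noiseBuyTimes ω) t).filter_mono
      (nhdsWithin_mono t Ioi_subset_Ici_self)
    have h2 := (count_eventuallyEq_right (M.noiseSellTimes ω) t).filter_mono
      (nhdsWithin_mono t Ioi_subset_Ici_self)
    filter_upwards [h1, h2] with s h1 h2
    simp only [Z, (M.noiseBuyTimes_spec ω).2, (M.noiseSellTimes_spec ω).2, h1, h2]
  obtain ⟨u, hu, hsub⟩ := (mem_nhdsGT_iff_exists_Ioo_subset' ht).1 h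
  filter_upwards [Ioo_mem_nhdsGT hu] with s hs
  funext r
  rcases le_total r t with hr | hr
  · rw [min_eq_left hr, min_eq_left (hr.trans hs.1.le)]
  · rw [min_eq_right hr]
    rcases eq_or_lt_of_le (le_min hr hs.1.le) with h' | h'
    · rw [← h']
    · exact hsub ⟨h', (min_le_right _ _).trans_lt hs.2⟩

namespace IsClockFamily

variable {E : ℕ → Ω → ℝ} {r : ℝ}

lemma elapsed_pos_iff (hE : M.IsClockFamily E r) (t₀ : unitInterval) (n j : ℕ)
    (t : unitInterval) (ω : Ω) :
    0 < elapsed t₀ n t (fun j => E j ω) j ↔ E j ω ≤ cellTime t₀ n j t := by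
  have := hE.pos j ω
  simp only [elapsed]
  split_ifs with h <;> simp [h, this]

variable [μ.IsComplete]

lemma usualConditions (hE : M.IsClockFamily E r) (t₀ : unitInterval) (n : ℕ) :
    UsualConditions (M.clockFiltration E hE.measurable t₀ n) μ := by
  refine ⟨isRightContinuous_of_eventually_eq (M.observed E t₀ n) _
    (M.clockFiltration_eq E hE.measurable t₀ n) fun t ht ω => ?_, fun s hs => ?_⟩
  · filter_upwards [M.stopped_Z_eventuallyEq t ht ω,
      elapsed_eventuallyEq t₀ n t fun j => hE.pos j ω] with s h1 h2
    rw [observed, observed, h1, h2]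
  · rw [M.clockFiltration_eq]
    exact ⟨∅, @MeasurableSet.empty _ (_), ae_eq_empty.2 hs⟩

lemma measurable_elapsed_FI (hE : M.IsClockFamily E r) (t₀ : unitInterval) (n j : ℕ)
    (t : unitInterval) : Measurable[M.clockFiltration E hE.measurable t₀ n t]
      fun ω => elapsed t₀ n t (fun j => E j ω) j := by
  have h : Measurable[MeasurableSpace.comap (M.observed E t₀ n t) inferInstance]
      fun ω => elapsed t₀ n t (fun j => E j ω) j :=
    ((measurable_pi_apply j).comp measurable_snd).comp (comap_measurable (M.observed E t₀ n t))
  refine h.mono ?_ le_rfl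
  rw [M.clockFiltration_eq]
  exact le_eventuallyMeasurableSpace

lemma measurableSet_le_FI (hE : M.IsClockFamily E r) (t₀ : unitInterval) (n j : ℕ)
    (t : unitInterval) {c : ℝ} (hc : c ≤ cellTime t₀ n j t) :
    MeasurableSet[M.clockFiltration E hE.measurable t₀ n t] {ω | E j ω ≤ c} := by
  have h := (hE.measurable_elapsed_FI t₀ n j t) (measurableSet_Ioc (a := 0) (b := c))
  convert h using 1
  ext ω
  rw [mem_preimage, mem_Ioc, hE.elapsed_pos_iff]
  simp only [mem_ofPred_eq, elapsed]
  constructor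
  · intro h
    rw [if_pos (h.trans hc)]
    exact ⟨h.trans hc, h⟩
  · rintro ⟨h1, h2⟩
    rwa [if_pos h1] at h2

lemma measurable_min_FI (hE : M.IsClockFamily E r) (t₀ : unitInterval) (n j : ℕ)
    (t : unitInterval) : Measurable[M.clockFiltration E hE.measurable t₀ n t]
      fun ω => min (E j ω) (cellTime t₀ n j t) := by
  refine measurable_of_Iic fun c => ?_
  by_cases hc : cellTime t₀ n j t ≤ c
  · have : (fun ω => min (E j ω) (cellTime t₀ n j t)) ⁻¹' Iic c = univ := by
      ext ω
      simp [hc]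
    rw [this]
    exact MeasurableSet.univ
  · have : (fun ω => min (E j ω) (cellTime t₀ n j t)) ⁻¹' Iic c = {ω | E j ω ≤ c} := by
      ext ω
      simp [hc]
    rw [this]
    exact hE.measurableSet_le_FI t₀ n j t (not_le.1 hc).le

/-- The accumulated rate of the clocks is predictable. -/
lemma measurable_min_predictable (hE : M.IsClockFamily E r) (t₀ : unitInterval) (n j : ℕ) :
    Measurable[(M.clockFiltration E hE.measurable t₀ n).predictable]
      fun p : unitInterval × Ω => min (E j p.2) (cellTime t₀ n j p.1) := by
  set ℱ := M.clockFiltration E hE.measurable t₀ n with hℱ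
  refine measurable_of_Ioi fun c => ?_
  rcases lt_or_ge c 0 with hc | hc
  · have : (fun p : unitInterval × Ω => min (E j p.2) (cellTime t₀ n j p.1)) ⁻¹' Ioi c = univ := by
      ext p
      simp [hc.trans (hE.pos j p.2), hc.trans_le (cellTime_nonneg t₀ n j p.1)]
    rw [this]
    exact MeasurableSet.univ
  set a := grid t₀ n j with ha
  set b := grid t₀ n (j + 1) with hb
  rcases lt_or_ge (a + c : ℝ) b with hab | hab
  · set s : unitInterval := ⟨a + c, by have := a.2.1; positivity, hab.le.trans b.2.2⟩ with hs
    have e : (fun p : unitInterval × Ω => min (E j p.2) (cellTime t₀ n j p.1)) ⁻¹' Ioi c =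
        Ioi s ×ˢ {ω | c < E j ω} := by
      ext p
      simp only [mem_preimage, mem_Ioi, lt_min_iff, mem_prod, mem_ofPred_eq, cellTime,
        lt_max_iff, not_lt.2 hc, or_false]
      rw [lt_sub_iff_add_lt, lt_min_iff, ← Subtype.coe_lt_coe]
      change c < E j p.2 ∧ c + (a : ℝ) < p.1 ∧ c + (a : ℝ) < b ↔ (a : ℝ) + c < p.1 ∧ c < E j p.2
      rw [add_comm c]
      tauto
    rw [e]
    refine measurableSet_predictable_Ioi_prod ?_
    have hcs : c ≤ cellTime t₀ n j s := by
      refine le_max_of_le_left ?_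
      rw [le_sub_iff_add_le, le_min_iff]
      change c + (a : ℝ) ≤ a + c ∧ c + (a : ℝ) ≤ b
      constructor <;> linarith
    have h := (hE.measurableSet_le_FI t₀ n j s hcs).compl
    convert h using 1
    ext ω
    simp
  · have : (fun p : unitInterval × Ω => min (E j p.2) (cellTime t₀ n j p.1)) ⁻¹' Ioi c = ∅ := by
      ext p
      have h1 := cellTime_mono t₀ n j (unitInterval.le_one' : p.1 ≤ 1)
      rw [cellTime_one] at h1
      simp only [mem_preimage, mem_Ioi, lt_min_iff, mem_empty_iff_false, iff_false, not_and,
        not_lt]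
      intro _
      linarith
    rw [this]
    exact @MeasurableSet.empty _ (_)

lemma isStronglyPredictable_compensator (hE : M.IsClockFamily E r) (t₀ : unitInterval) (n : ℕ)
    (δ : ℝ) : IsStronglyPredictable (M.clockFiltration E hE.measurable t₀ n)
      fun t ω => δ * clockCompensator t₀ n r (fun j => E j ω) t := by
  refine @Measurable.stronglyMeasurable _ _ (_) _ _ _ _ _ _ ?_
  refine Measurable.const_mul (Measurable.const_mul ?_ r) δ
  exact Finset.measurable_fun_sum _ fun j _ =>
    hE.measurable_min_predictable t₀ n j

lemma isStronglyPredictable_rate (hE : M.IsClockFamily E r) (t₀ : unitInterval) (n : ℕ) :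
    IsStronglyPredictable (M.clockFiltration E hE.measurable t₀ n)
      fun u ω => clockRate t₀ n r (fun j => E j ω) u := by
  set 𝒢 := (M.clockFiltration E hE.measurable t₀ n).predictable with h𝒢
  have hfst : Measurable[𝒢] (Prod.fst : unitInterval × Ω → unitInterval) := by
    refine measurable_of_Ioi fun u => ?_
    have : (Prod.fst : unitInterval × Ω → unitInterval) ⁻¹' Ioi u = Ioi u ×ˢ univ := by
      ext p
      simp
    rw [this]
    exact measurableSet_predictable_Ioi_prod MeasurableSet.univ
  refine @Measurable.stronglyMeasurable _ _ (_) _ _ _ _ _ _ ?_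
  refine Measurable.const_mul ?_ r
  refine Finset.measurable_fun_sum _ fun j _ => ?_
  set B : Set (unitInterval × Ω) := {p | p.1 ∈ Ioc (grid t₀ n j) (grid t₀ n (j + 1)) ∧
    (p.1 : ℝ) - grid t₀ n j ≤ E j p.2} with hB
  have hBm : MeasurableSet[𝒢] B := by
    -- the clock is still running at `u` iff the time spent waiting before `u` is all of `u - a`
    have e : B = (Prod.fst ⁻¹' Ioc (grid t₀ n j) (grid t₀ n (j + 1))) ∩
        {p : unitInterval × Ω | min (E j p.2) (cellTime t₀ n j p.1) =
          (p.1 : ℝ) - grid t₀ n j} := by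
      ext p
      simp only [hB, mem_ofPred_eq, mem_inter_iff, mem_preimage]
      refine and_congr_right fun h => ?_
      have h1 : (grid t₀ n j : ℝ) < p.1 := h.1
      have h2 : (p.1 : ℝ) ≤ grid t₀ n (j + 1) := h.2
      have h3 : cellTime t₀ n j p.1 = (p.1 : ℝ) - grid t₀ n j := by
        rw [cellTime, min_eq_left h2, max_eq_left (by linarith)]
      rw [h3, min_eq_right_iff]
    rw [e]
    refine (hfst measurableSet_Ioc).inter ?_
    exact measurableSet_eq_fun (hE.measurable_min_predictable t₀ n j)
      ((measurable_subtype_coe.comp hfst).sub_const _)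
  have : (fun p : unitInterval × Ω => {u : unitInterval |
      u ∈ Ioc (grid t₀ n j) (grid t₀ n (j + 1)) ∧ (u : ℝ) - grid t₀ n j ≤ E j p.2}.indicator
        (fun _ => (1 : ℝ)) p.1) = B.indicator fun _ => 1 := rfl
  rw [this]
  exact (measurable_const : Measurable[𝒢] fun _ : unitInterval × Ω => (1 : ℝ)).indicator hBm

end IsClockFamily

end Market

namespace Market

variable {Ω : Type*} [mΩ : MeasurableSpace Ω] {μ : Measure Ω} {M : Market Ω μ}

/-! ### The martingale of a clock -/

/-- The compensated indicator of a clock that has been running for time `c`, as a function of its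
waiting time `x`. -/
noncomputable def clockMartingale (r c x : ℝ) : ℝ := (if x ≤ c then 1 else 0) - r * min x c

lemma measurable_clockMartingale (r c : ℝ) : Measurable (clockMartingale r c) := by
  unfold clockMartingale
  exact (Measurable.ite measurableSet_Iic measurable_const measurable_const).sub
    ((measurable_id.min measurable_const).const_mul r)

lemma abs_clockMartingale_le {r c x : ℝ} (hr : 0 ≤ r) (hc : 0 ≤ c) (hx : 0 < x) :
    |clockMartingale r c x| ≤ 1 + r * c := by
  have h1 : |(if x ≤ c then (1 : ℝ) else 0)| ≤ 1 := by split_ifs <;> simp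
  have h2 : |r * min x c| ≤ r * c := by
    rw [abs_of_nonneg (mul_nonneg hr (le_min hx.le hc))]
    exact mul_le_mul_of_nonneg_left (min_le_right _ _) hr
  exact (abs_sub _ _).trans (add_le_add h1 h2)

namespace IsClockFamily

variable {E : ℕ → Ω → ℝ} {r : ℝ} [IsProbabilityMeasure μ]

lemma integrable_clockMartingale (hE : M.IsClockFamily E r) (hr : 0 < r) (j : ℕ) {c : ℝ}
    (hc : 0 ≤ c) : Integrable (fun ω => clockMartingale r c (E j ω)) μ :=
  (integrable_const (1 + r * c)).mono'
    ((measurable_clockMartingale r c).comp (hE.measurable j)).aestronglyMeasurable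
    (ae_of_all _ fun ω => abs_clockMartingale_le hr.le hc (hE.pos j ω))

lemma integral_clockMartingale (hE : M.IsClockFamily E r) (hr : 0 < r) (j : ℕ) {c : ℝ}
    (hc : 0 ≤ c) : ∫ ω, clockMartingale r c (E j ω) ∂μ = 0 := by
  have hm : MeasurableSet {ω | E j ω ≤ c} := hE.measurable j measurableSet_Iic
  have e : ∀ ω, clockMartingale r c (E j ω) =
      {ω | E j ω ≤ c}.indicator (fun _ => (1 : ℝ)) ω - r * min (E j ω) c := fun ω => rfl
  simp only [e]
  rw [integral_sub ((integrable_const (1 : ℝ)).indicator hm)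
    ((hE.integrable_min j hc).const_mul r), integral_const_mul, ← hE.measureReal_le_eq hr j hc,
    integral_indicator_const _ hm]
  simp

/-- On the event that a clock has not yet rung, what has been observed is determined by the other
clocks and the market; so the increments of its martingale average out. -/
lemma setIntegral_clockMartingale_sub (hE : M.IsClockFamily E r) (hr : 0 < r) (t₀ : unitInterval)
    (n j : ℕ) {s t : unitInterval} (hst : s ≤ t) {A : Set Ω}
    (hA : MeasurableSet[MeasurableSpace.comap (M.observed E t₀ n s) inferInstance] A) :
    ∫ ω in A, (clockMartingale r (cellTime t₀ n j t) (E j ω) -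
      clockMartingale r (cellTime t₀ n j s) (E j ω)) ∂μ = 0 := by
  obtain ⟨D, hD, rfl⟩ := hA
  set h : ℝ → ℝ := fun x => clockMartingale r (cellTime t₀ n j t) x -
    clockMartingale r (cellTime t₀ n j s) x with hh
  have hhm : Measurable h :=
    (measurable_clockMartingale _ _).sub (measurable_clockMartingale _ _)
  set R : Ω → (ℝ × (unitInterval → ℝ)) × (ℕ → ℝ) :=
    fun ω => ((M.v ω, fun t => M.Z t ω), fun i => if i = j then 0 else E i ω) with hR
  have hRm : Measurable R := by
    refine (M.v_measurable.prodMk (measurable_pi_lambda _ M.measurable_Z)).prodMk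
      (measurable_pi_lambda _ fun i => ?_)
    by_cases hi : i = j
    · simp only [hi, if_true]
      exact measurable_const
    · simp only [hi, if_false]
      exact hE.measurable i
  set Φ : (ℝ × (unitInterval → ℝ)) × (ℕ → ℝ) → (ℝ × (unitInterval → ℝ)) × (ℕ → ℝ) :=
    fun p => ((p.1.1, fun r => p.1.2 (min r s)), elapsed t₀ n s p.2) with hΦ
  have hΦm : Measurable Φ := by
    refine (measurable_fst.fst.prodMk (measurable_pi_lambda _ fun r =>
      (measurable_pi_apply _).comp measurable_fst.snd)).prodMk
        ((measurable_elapsed t₀ n s).comp measurable_snd)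
  have hΦD : MeasurableSet (Φ ⁻¹' D) := hΦm hD
  have hkey : ∀ ω, (M.observed E t₀ n s ⁻¹' D).indicator (fun ω => h (E j ω)) ω =
      (Φ ⁻¹' D).indicator (fun _ => (1 : ℝ)) (R ω) * h (E j ω) := by
    intro ω
    by_cases hj : E j ω ≤ cellTime t₀ n j s
    · have h0 : h (E j ω) = 0 := by
        have hc := cellTime_mono t₀ n j hst
        simp only [hh, clockMartingale, if_pos hj, if_pos (hj.trans hc), min_eq_left hj,
          min_eq_left (hj.trans hc), sub_self]
      rw [h0, mul_zero, indicator_apply_eq_zero]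
      exact fun _ => h0
    · have h1 : Φ (R ω) = M.observed E t₀ n s ω := by
        simp only [hΦ, hR, observed]
        congr 1
        funext i
        simp only [elapsed]
        by_cases hi : i = j
        · subst hi
          simp only [if_true, hj, if_false, ite_self]
        · simp only [hi, if_false]
      by_cases hω : M.observed E t₀ n s ω ∈ D
      · rw [indicator_of_mem (show ω ∈ M.observed E t₀ n s ⁻¹' D from hω),
          indicator_of_mem (show R ω ∈ Φ ⁻¹' D from (by rw [mem_preimage, h1]; exact hω)), one_mul]
      · rw [indicator_of_notMem (show ω ∉ M.observed E t₀ n s ⁻¹' D from hω),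
          indicator_of_notMem (show R ω ∉ Φ ⁻¹' D from (by rw [mem_preimage, h1]; exact hω)),
          zero_mul]
  have hindm : Measurable ((Φ ⁻¹' D).indicator fun _ => (1 : ℝ)) :=
    measurable_const.indicator hΦD
  have hind := (hE.indep_others j).comp hindm hhm
  have hobs : Measurable (M.observed E t₀ n s) := by
    refine (M.v_measurable.prodMk (measurable_pi_lambda _ fun r => M.measurable_Z _)).prodMk
      ((measurable_elapsed t₀ n s).comp (measurable_pi_lambda _ hE.measurable))
  have h0 : ∫ ω, h (E j ω) ∂μ = 0 := by
    simp only [hh]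
    rw [integral_sub (hE.integrable_clockMartingale hr j (cellTime_nonneg _ _ _ _))
      (hE.integrable_clockMartingale hr j (cellTime_nonneg _ _ _ _)),
      hE.integral_clockMartingale hr j (cellTime_nonneg _ _ _ _),
      hE.integral_clockMartingale hr j (cellTime_nonneg _ _ _ _), sub_zero]
  have hmul : ∫ ω, (Φ ⁻¹' D).indicator (fun _ => (1 : ℝ)) (R ω) * h (E j ω) ∂μ =
      (∫ ω, (Φ ⁻¹' D).indicator (fun _ => (1 : ℝ)) (R ω) ∂μ) * ∫ ω, h (E j ω) ∂μ :=
    hind.integral_fun_mul_eq_mul_integral (hindm.comp hRm).aestronglyMeasurable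
      (hhm.comp (hE.measurable j)).aestronglyMeasurable
  rw [← integral_indicator (hobs hD)]
  exact (integral_congr_ae (ae_of_all _ hkey)).trans (by rw [hmul, h0, mul_zero])

variable [μ.IsComplete]

/-- The number of clocks that have rung, minus the accumulated rate, is a martingale. -/
lemma martingale_sum (hE : M.IsClockFamily E r) (hr : 0 < r) (t₀ : unitInterval) (n : ℕ) :
    Martingale (fun t ω => ∑ j ∈ Finset.range (n + 1),
      clockMartingale r (cellTime t₀ n j t) (E j ω))
      (M.clockFiltration E hE.measurable t₀ n) μ := by
  have hint : ∀ t, Integrable (fun ω => ∑ j ∈ Finset.range (n + 1),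
      clockMartingale r (cellTime t₀ n j t) (E j ω)) μ := fun t =>
    integrable_finsetSum _ fun j _ =>
      hE.integrable_clockMartingale hr j (cellTime_nonneg _ _ _ _)
  have hadapt : StronglyAdapted (M.clockFiltration E hE.measurable t₀ n) (fun t ω =>
      ∑ j ∈ Finset.range (n + 1), clockMartingale r (cellTime t₀ n j t) (E j ω)) := by
    intro t
    refine Measurable.stronglyMeasurable ?_
    refine Finset.measurable_fun_sum _ fun j _ => ?_
    refine Measurable.sub ?_ ((hE.measurable_min_FI t₀ n j t).const_mul r)
    exact Measurable.ite (hE.measurableSet_le_FI t₀ n j t le_rfl) measurable_const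
      measurable_const
  refine ⟨hadapt, fun s t hst => ?_⟩
  refine (ae_eq_condExp_of_forall_setIntegral_eq
    ((M.clockFiltration E hE.measurable t₀ n).le s) (hint t)
    (fun A _ _ => (hint s).integrableOn) (fun A hA _ => ?_)
    (hadapt s).aestronglyMeasurable).symm
  rw [M.clockFiltration_eq] at hA
  obtain ⟨B, hB, hAB⟩ := hA
  rw [setIntegral_congr_set hAB, setIntegral_congr_set hAB, eq_comm, ← sub_eq_zero,
    ← integral_sub (hint t).integrableOn (hint s).integrableOn]
  simp only [← Finset.sum_sub_distrib]
  rw [integral_finsetSum]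
  · exact Finset.sum_eq_zero fun j _ => hE.setIntegral_clockMartingale_sub hr t₀ n j hst hB
  · intro j _
    exact ((hE.integrable_clockMartingale hr j (cellTime_nonneg _ _ _ _)).sub
      (hE.integrable_clockMartingale hr j (cellTime_nonneg _ _ _ _))).integrableOn

end IsClockFamily

/-- A process that agrees almost surely with a martingale at each time is a martingale, if the
filtration contains all null sets. -/
lemma _root_.GlostenMilgrom.UsualConditions.martingale_congr [IsProbabilityMeasure μ]
    {ℱ : Filtration unitInterval mΩ} (hℱ : UsualConditions ℱ μ) {N N' : unitInterval → Ω → ℝ}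
    (hN : Martingale N ℱ μ) (h : ∀ t, N' t =ᵐ[μ] N t) : Martingale N' ℱ μ := by
  refine ⟨fun t => ?_, fun s t hst => ?_⟩
  · have hm : Measurable[ℱ t] (N t) := (hN.1 t).measurable
    refine Measurable.stronglyMeasurable fun B hB => ?_
    have hz : ∀ C : Set Ω, μ C = 0 → MeasurableSet[ℱ t] C := fun C hC =>
      ℱ.mono unitInterval.nonneg' C (hℱ.complete C hC)
    have hne : μ {ω | N' t ω ≠ N t ω} = 0 := h t
    have e : N' t ⁻¹' B = (N t ⁻¹' B \ (N t ⁻¹' B \ N' t ⁻¹' B)) ∪ (N' t ⁻¹' B \ N t ⁻¹' B) := by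
      ext ω
      simp only [mem_union, Set.mem_sdiff]
      tauto
    rw [e]
    refine ((hm hB).diff (hz _ (measure_mono_null ?_ hne))).union
      (hz _ (measure_mono_null ?_ hne)) <;>
    · rintro ω ⟨h1, h2⟩ h3
      simp only [mem_preimage, h3] at h1 h2
      exact h2 h1
  · exact (condExp_congr_ae (h t)).trans ((hN.2 s t hst).trans (h s).symm)

/-! ### The strategy that buys whenever a clock rings -/

/-- The insider buys one unit whenever a clock rings, and never sells. -/
noncomputable def clockStrategy [μ.IsComplete] (M : Market Ω μ) (E : ℕ → Ω → ℝ)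
    (hE : ∀ j, Measurable (E j)) (t₀ : unitInterval) (n : ℕ) : Strategy Ω where
  XB t ω := M.δ * count (alarms t₀ n fun j => E j ω) t
  XS _ _ := 0
  FI := M.clockFiltration E hE t₀ n

lemma jump_zero (s : unitInterval) : jump (fun _ => (0 : ℝ)) s = 0 := by
  have h := jump_count 0 (J := ∅) (by simp) s
  simpa using h

lemma isCompensator_zero [IsProbabilityMeasure μ] (ℱ : Filtration unitInterval mΩ) :
    IsCompensator ℱ μ (fun _ _ => (0 : ℝ)) (fun _ _ => 0) := by
  refine ⟨?_, ae_of_all _ fun ω => ⟨rfl, monotone_const, fun t => continuousWithinAt_const⟩, ?_⟩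
  · exact (measurable_const : Measurable[ℱ.predictable]
      fun _ : unitInterval × Ω => (0 : ℝ)).stronglyMeasurable
  · simp only [sub_zero]
    exact martingale_zero _ _ _

namespace IsClockFamily

variable {E : ℕ → Ω → ℝ} {r : ℝ} [μ.IsComplete]

lemma buyTimes_clockStrategy (hE : M.IsClockFamily E r) (t₀ : unitInterval) (n : ℕ) (ω : Ω) :
    buyTimes (M.clockStrategy E hE.measurable t₀ n) ω = alarms t₀ n fun j => E j ω :=
  jumpTimes_count M.δ_pos.ne' (zero_notMem_alarms t₀ n fun j => hE.pos j ω)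

lemma sellTimes_clockStrategy (hE : M.IsClockFamily E r) (t₀ : unitInterval) (n : ℕ) (ω : Ω) :
    sellTimes (M.clockStrategy E hE.measurable t₀ n) ω = ∅ := by
  have h := jumpTimes_count one_ne_zero (J := ∅) (by simp)
  simpa [sellTimes, clockStrategy, count] using h

variable [IsProbabilityMeasure μ]

lemma martingale_clockStrategy (hE : M.IsClockFamily E r) (hr : 0 < r) (t₀ : unitInterval)
    (n : ℕ) : Martingale (fun t ω => (M.clockStrategy E hE.measurable t₀ n).XB t ω -
      M.δ * clockCompensator t₀ n r (fun j => E j ω) t)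
      (M.clockFiltration E hE.measurable t₀ n) μ := by
  have h := (hE.martingale_sum hr t₀ n).smul M.δ
  convert h using 1
  funext t ω
  simp only [clockStrategy, Pi.smul_apply, smul_eq_mul, clockMartingale, Finset.sum_sub_distrib,
    clockCompensator, ← Finset.mul_sum, count_alarms t₀ n (fun j => hE.pos j ω)]
  ring

lemma isCompensator_clockStrategy (hE : M.IsClockFamily E r) (hr : 0 < r) (t₀ : unitInterval)
    (n : ℕ) : IsCompensator (M.clockFiltration E hE.measurable t₀ n) μ
      (M.clockStrategy E hE.measurable t₀ n).XB
      fun t ω => M.δ * clockCompensator t₀ n r (fun j => E j ω) t := by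
  refine ⟨hE.isStronglyPredictable_compensator t₀ n M.δ, ae_of_all _ fun ω => ⟨?_, ?_, fun t => ?_⟩,
    hE.martingale_clockStrategy hr t₀ n⟩
  · rw [clockCompensator_zero t₀ n r fun j => hE.pos j ω, mul_zero]
  · intro s t hst
    refine mul_le_mul_of_nonneg_left (mul_le_mul_of_nonneg_left ?_ hr.le) M.δ_pos.le
    exact Finset.sum_le_sum fun j _ => min_le_min_left _ (cellTime_mono t₀ n j hst)
  · refine Continuous.continuousWithinAt ?_
    refine continuous_const.mul (continuous_const.mul (continuous_finsetSum _ fun j _ => ?_))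
    exact continuous_const.min (continuous_cellTime t₀ n j)

lemma admissible_clockStrategy (hE : M.IsClockFamily E r) (hr : 0 < r) (t₀ : unitInterval)
    (n : ℕ) : M.Admissible (M.clockStrategy E hE.measurable t₀ n) := by
  have hmart := hE.martingale_clockStrategy hr t₀ n
  have hcomp := hE.isCompensator_clockStrategy hr t₀ n
  have hpre : StronglyAdapted (M.clockFiltration E hE.measurable t₀ n)
      fun t ω => M.δ * clockCompensator t₀ n r (fun j => E j ω) t :=
    hcomp.predictable.stronglyAdapted
  refine ⟨hE.usualConditions t₀ n, ?_, fun t => ?_, fun t => measurable_const, fun ω => ?_,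
    fun ω => ?_, ?_, integrable_zero _ _ _, ?_, ⟨_, isCompensator_zero _, ae_of_all _ fun ω => ?_⟩,
    ae_of_all _ fun ω s => Or.inr (jump_zero s)⟩
  · -- the sigma-algebras of the clocks alone
    have hle : ∀ t, eventuallyMeasurableSpace (MeasurableSpace.comap
        (fun ω => elapsed t₀ n t fun j => E j ω) inferInstance) (ae μ) ≤ mΩ := fun t =>
      eventuallyMeasurableSpace_le_of_isComplete
        ((measurable_elapsed t₀ n t).comp (measurable_pi_lambda _ hE.measurable)).comap_le
    refine ⟨⟨fun t => eventuallyMeasurableSpace (MeasurableSpace.comap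
      (fun ω => elapsed t₀ n t fun j => E j ω) inferInstance) (ae μ), fun s t hst => ?_, hle⟩,
      ?_, fun t => rfl⟩
    · refine eventuallyMeasurableSpace_mono ?_
      have : (fun ω => elapsed t₀ n s fun j => E j ω) =
          elapsed t₀ n s ∘ fun ω => elapsed t₀ n t fun j => E j ω := by
        funext ω
        exact (elapsed_elapsed t₀ n hst _).symm
      rw [this]
      exact ((measurable_elapsed t₀ n s).comp (comap_measurable _)).comap_le
    · refine indep_eventuallyMeasurableSpace ?_
      refine indep_of_indep_of_le_left (indep_of_indep_of_le_right hE.indep_market ?_) ?_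
      · set mkt : Ω → ℝ × ((unitInterval → ℝ) × (unitInterval → ℝ)) :=
          fun ω => (M.v ω, ((fun t => M.ZB t ω), (fun t => M.ZS t ω))) with hmkt
        refine sup_le (measurable_fst.comp (comap_measurable mkt)).comap_le
          (iSup₂_le fun s _ => ?_)
        have : Measurable fun p : ℝ × ((unitInterval → ℝ) × (unitInterval → ℝ)) =>
          p.2.1 s - p.2.2 s := by fun_prop
        exact (this.comp (comap_measurable mkt)).comap_le
      · exact ((measurable_elapsed t₀ n 1).comp
          (comap_measurable fun ω i => E i ω)).comap_le
  · have h := (hmart.1 t).measurable.add (hpre t).measurable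
    have e : (M.clockStrategy E hE.measurable t₀ n).XB t =
        (fun ω => (M.clockStrategy E hE.measurable t₀ n).XB t ω -
          M.δ * clockCompensator t₀ n r (fun j => E j ω) t) +
        fun ω => M.δ * clockCompensator t₀ n r (fun j => E j ω) t := by
      funext ω
      simp
    rw [e]
    exact h
  · exact isPointPath_count M.δ (zero_notMem_alarms t₀ n fun j => hE.pos j ω)
  · have h := isPointPath_count M.δ (J := ∅) (by simp)
    simpa [count, clockStrategy] using h
  · refine (integrable_const (M.δ * (n + 1))).mono' ?_ (ae_of_all _ fun ω => ?_)
    · have h := ((hmart.1 1).measurable.mono (Filtration.le _ 1) le_rfl).add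
        ((hpre 1).measurable.mono (Filtration.le _ 1) le_rfl)
      refine Measurable.aestronglyMeasurable ?_
      convert h using 1
      funext ω
      simp
    · have h0 := count_nonneg (alarms t₀ n fun j => E j ω) 1
      simp only [clockStrategy]
      rw [Real.norm_of_nonneg (mul_nonneg M.δ_pos.le h0),
        count_alarms t₀ n fun j => hE.pos j ω]
      refine mul_le_mul_of_nonneg_left ?_ M.δ_pos.le
      refine (Finset.sum_le_card_nsmul _ _ 1 fun j _ => ?_).trans (by simp)
      split_ifs <;> simp
  · refine ⟨_, hcomp, ae_of_all _ fun ω => ?_⟩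
    have hC : 0 ≤ M.δ * (r * (n + 1)) := mul_nonneg M.δ_pos.le (by positivity)
    refine LipschitzOnWith.absolutelyContinuousOnInterval
      (K := ⟨M.δ * (r * (n + 1)), hC⟩) (LipschitzOnWith.of_dist_le_mul fun x hx y hy => ?_)
    rw [uIcc_of_le zero_le_one] at hx hy
    rw [Real.dist_eq, Real.dist_eq, ← mul_sub, abs_mul, abs_of_pos M.δ_pos]
    have h := lipschitz_clockCompensator t₀ n hr.le (fun j => E j ω)
      (Set.projIcc 0 1 zero_le_one x) (Set.projIcc 0 1 zero_le_one y)
    rw [Set.projIcc_of_mem zero_le_one hx, Set.projIcc_of_mem zero_le_one hy] at h ⊢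
    calc M.δ * _ ≤ M.δ * (r * (n + 1) * |x - y|) := mul_le_mul_of_nonneg_left h M.δ_pos.le
      _ = M.δ * (r * (n + 1)) * |x - y| := by ring
  · exact (LipschitzWith.const (0 : ℝ)).lipschitzOnWith.absolutelyContinuousOnInterval

end IsClockFamily

end Market

/-! ### Clocks do not ring at the times of noise orders -/

/-- An independent random time almost surely is not a jump time of a Poisson process: on a
sufficiently fine grid the cell of the random time contains no jump. -/
lemma IsPoissonProcess.exists_grid_incr_eq_zero {Ω : Type*} [MeasurableSpace Ω] {μ : Measure Ω}
    [IsProbabilityMeasure μ] {N : unitInterval → Ω → ℝ} {β : ℝ} (hβ : 0 ≤ β)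
    (hN : IsPoissonProcess N β μ) {τ : Ω → unitInterval} (hτ : Measurable τ)
    (hind : IndepFun τ (fun ω t => N t ω) μ) :
    ∀ᵐ ω ∂μ, ∃ n, ∀ i < n + 1, τ ω ∈ Ioc (grid 0 n i) (grid 0 n (i + 1)) →
      N (grid 0 n (i + 1)) ω - N (grid 0 n i) ω = 0 := by
  set B : ℕ → ℕ → Set Ω := fun n i => τ ⁻¹' Ioc (grid 0 n i) (grid 0 n (i + 1)) with hB
  have hBm : ∀ n i, MeasurableSet (B n i) := fun n i => hτ measurableSet_Ioc
  set D : ℕ → Set Ω := fun n => ⋃ i ∈ Finset.range (n + 1), B n i ∩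
    {ω | N (grid 0 n (i + 1)) ω - N (grid 0 n i) ω ≠ 0} with hD
  have hDle : ∀ n : ℕ, μ.real (D n) ≤ β * (1 / ((n : ℝ) + 1)) := by
    intro n
    have hstep : ∀ i ∈ Finset.range (n + 1), μ.real (B n i ∩
        {ω | N (grid 0 n (i + 1)) ω - N (grid 0 n i) ω ≠ 0}) ≤
        μ.real (B n i) * (β * (1 / ((n : ℝ) + 1))) := by
      intro i hi
      have hm : grid 0 n i ≤ grid 0 n (i + 1) := grid_mono 0 n i.le_succ
      have hf : Measurable fun x : unitInterval → ℝ => x (grid 0 n (i + 1)) - x (grid 0 n i) := by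
        fun_prop
      have h := (hind.comp measurable_id hf).measure_inter_preimage_eq_mul
        (Ioc (grid 0 n i) (grid 0 n (i + 1))) {0}ᶜ measurableSet_Ioc
        (measurableSet_singleton (0 : ℝ)).compl
      have h' := congrArg ENNReal.toReal h
      rw [ENNReal.toReal_mul] at h'
      refine h'.le.trans (mul_le_mul_of_nonneg_left ?_ measureReal_nonneg)
      exact (hN.measureReal_incr_ne_zero_le hβ hm).trans
        (mul_le_mul_of_nonneg_left (grid_succ_sub 0 (Finset.mem_range.1 hi)) hβ)
    refine (measureReal_biUnion_finset_le _ _).trans ((Finset.sum_le_sum hstep).trans ?_)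
    rw [← Finset.sum_mul]
    refine mul_le_of_le_one_left (by positivity) ?_
    rw [← measureReal_biUnion_finset (fun i _ j _ hij => ?_) fun i _ => hBm n i]
    · exact measureReal_le_one
    · exact ((grid_mono 0 n).pairwise_disjoint_on_Ioc_succ hij).preimage τ
  have hlim : Tendsto (fun n : ℕ => β * (1 / ((n : ℝ) + 1))) atTop (𝓝 0) := by
    simpa using (tendsto_one_div_add_atTop_nhds_zero_nat (𝕜 := ℝ)).const_mul β
  rw [ae_iff]
  refine (measureReal_eq_zero_iff (by finiteness)).1 (le_antisymm (ge_of_tendsto' hlim fun n =>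
    (measureReal_mono ?_ (measure_ne_top μ _)).trans (hDle n)) measureReal_nonneg)
  intro ω hω
  simp only [mem_ofPred_eq, not_exists, not_forall] at hω
  obtain ⟨i, hi, h1, h2⟩ := hω n
  exact mem_biUnion (Finset.mem_range.2 hi) ⟨h1, h2⟩

namespace Market

variable {Ω : Type*} [mΩ : MeasurableSpace Ω] {μ : Measure Ω} {M : Market Ω μ}

/-- If the cell of `s` on some grid contains no jump, then `s` is not a jump time. -/
lemma notMem_of_grid {J : Finset unitInterval} {δ : ℝ} (hδ : δ ≠ 0) {s : unitInterval}
    (hs : 0 < s) (h : ∃ n, ∀ i < n + 1, s ∈ Ioc (grid 0 n i) (grid 0 n (i + 1)) →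
      δ * count J (grid 0 n (i + 1)) / δ - δ * count J (grid 0 n i) / δ = 0) : s ∉ J := by
  intro hsJ
  obtain ⟨n, hn⟩ := h
  obtain ⟨i, hi, h1, h2⟩ := exists_grid_cell hs n
  have h3 := hn i hi ⟨h1, h2⟩
  rw [mul_div_cancel_left₀ _ hδ, mul_div_cancel_left₀ _ hδ] at h3
  exact exists_incr_ne_zero_of_mem hsJ h1 h2 h3

namespace IsClockFamily

variable {E : ℕ → Ω → ℝ} {r : ℝ}

lemma Y_clockStrategy [μ.IsComplete] (hE : M.IsClockFamily E r) (t₀ : unitInterval) (n : ℕ) (y₀ : ℝ)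
    {t : unitInterval} (ht : t ≤ t₀) (ω : Ω) :
    M.Y (M.clockStrategy E hE.measurable t₀ n) y₀ t ω = y₀ + M.Z t ω := by
  have h : (clockStrategy M E hE.measurable t₀ n).XB t ω = 0 := by
    simp only [clockStrategy, count_alarms t₀ n (fun j => hE.pos j ω)]
    rw [Finset.sum_eq_zero, mul_zero]
    intro j _
    rw [cellTime_of_le (ht.trans (le_grid t₀ n j)), if_neg (not_le.2 (hE.pos j ω))]
  have h' : (clockStrategy M E hE.measurable t₀ n).XS t ω = 0 := rfl
  rw [Y, h, h']
  ring

variable [IsProbabilityMeasure μ]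

/-- Almost surely the clocks never ring at the time of a noise order. -/
lemma notMem_noiseTimes (hE : M.IsClockFamily E r) (t₀ : unitInterval) (n : ℕ) :
    ∀ᵐ ω ∂μ, ∀ s ∈ alarms t₀ n fun j => E j ω,
      s ∉ M.noiseBuyTimes ω ∧ s ∉ M.noiseSellTimes ω := by
  have hτx : ∀ j, Measurable fun x : ℕ → ℝ => alarm t₀ n x j := fun j =>
    continuous_projIcc.measurable.comp (measurable_const.add (measurable_pi_apply j))
  have hτ : ∀ j, Measurable fun ω => alarm t₀ n (fun j => E j ω) j := fun j =>
    (hτx j).comp (measurable_pi_lambda _ hE.measurable)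
  have h1 : ∀ j, _ := fun j => M.ZB_poisson.exists_grid_incr_eq_zero M.β_pos.le (hτ j)
    (hE.indep_market.comp (ψ := fun (p : ℝ × ((unitInterval → ℝ) × (unitInterval → ℝ))) t =>
      p.2.1 t / M.δ) (hτx j) (by fun_prop))
  have h2 : ∀ j, _ := fun j => M.ZS_poisson.exists_grid_incr_eq_zero M.β_pos.le (hτ j)
    (hE.indep_market.comp (ψ := fun (p : ℝ × ((unitInterval → ℝ) × (unitInterval → ℝ))) t =>
      p.2.2 t / M.δ) (hτx j) (by fun_prop))
  filter_upwards [ae_all_iff.2 h1, ae_all_iff.2 h2] with ω h1 h2 s hs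
  have hs0 : 0 < s := unitInterval.nonneg'.trans_lt (lt_of_mem_alarms (fun j => hE.pos j ω) hs)
  obtain ⟨j, -, rfl⟩ := Finset.mem_image.1 hs
  refine ⟨notMem_of_grid M.δ_pos.ne' hs0 ?_, notMem_of_grid M.δ_pos.ne' hs0 ?_⟩
  · simpa only [(M.noiseBuyTimes_spec ω).2] using h1 j
  · simpa only [(M.noiseSellTimes_spec ω).2] using h2 j

variable [μ.IsComplete]

lemma kindTimes_clockStrategy (hE : M.IsClockFamily E r) (t₀ : unitInterval) (n : ℕ) :
    ∀ᵐ ω ∂μ, M.kindTimes (M.clockStrategy E hE.measurable t₀ n) .BB ω =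
      (alarms t₀ n fun j => E j ω) ∧ ∀ c, c ≠ OrderKind.BB →
        M.kindTimes (M.clockStrategy E hE.measurable t₀ n) c ω = ∅ := by
  filter_upwards [hE.notMem_noiseTimes t₀ n] with ω h
  refine ⟨?_, fun c hc => ?_⟩
  · rw [kindTimes, hE.buyTimes_clockStrategy, Finset.filter_true_of_mem h]
  · cases c <;> simp only [kindTimes, hE.buyTimes_clockStrategy, hE.sellTimes_clockStrategy,
      Finset.filter_empty] <;> refine Finset.filter_false_of_mem fun s hs => ?_
    · exact absurd rfl hc
    · exact (h s hs).1
    · exact (h s hs).2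

variable (M) in
/-- The intensities of the strategy that buys when a clock rings: all orders arrive alone. -/
noncomputable def _root_.GlostenMilgrom.Market.clockIntensity (E : ℕ → Ω → ℝ) (r : ℝ)
    (t₀ : unitInterval) (n : ℕ) (c : OrderKind) (u : unitInterval) (ω : Ω) : ℝ :=
  match c with
  | .BB => clockRate t₀ n r (fun j => E j ω) u
  | _ => 0

lemma hasIntensities_clockStrategy (hE : M.IsClockFamily E r) (hr : 0 < r) (t₀ : unitInterval)
    (n : ℕ) : M.HasIntensities (M.clockStrategy E hE.measurable t₀ n)
      (clockIntensity E r t₀ n) := by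
  have hS := hE.admissible_clockStrategy hr t₀ n
  have hus := hE.usualConditions t₀ n
  have hzero : ∀ c, c ≠ OrderKind.BB → IsIntensity (M.clockFiltration E hE.measurable t₀ n) μ M.δ
      (M.comp (M.clockStrategy E hE.measurable t₀ n) c) (fun _ _ => 0) := by
    intro c hc
    refine ⟨?_, fun _ _ => le_rfl, ae_of_all _ fun _ => integrable_zero _ _ _, ?_⟩
    · exact (measurable_const : Measurable[(M.clockFiltration E hE.measurable t₀ n).predictable]
        fun _ : unitInterval × Ω => (0 : ℝ)).stronglyMeasurable
    · refine hus.martingale_congr (martingale_zero _ _ _) fun t => ?_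
      filter_upwards [hE.kindTimes_clockStrategy t₀ n] with ω h
      rw [hS.comp_eq, h.2 c hc]
      simp [count]
  intro c
  cases c
  · refine ⟨hE.isStronglyPredictable_rate t₀ n, fun u ω => ?_, ae_of_all _ fun ω =>
      integrable_clockRate t₀ n r _, ?_⟩
    · exact mul_nonneg hr.le (Finset.sum_nonneg fun j _ =>
        indicator_nonneg (fun _ _ => zero_le_one) _)
    · refine hus.martingale_congr (hE.martingale_clockStrategy hr t₀ n) fun t => ?_
      filter_upwards [hE.kindTimes_clockStrategy t₀ n] with ω h
      rw [hS.comp_eq, h.1]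
      have := integral_clockRate t₀ n r (fun j => hE.pos j ω) t
      simp only [clockIntensity, this]
      rfl
  all_goals exact hzero _ (by simp)

/-! ### Almost optimal strategies -/

/-- The expected terminal shortfall of the strategy that tries to buy `n + 1` units: the shortfall
after buying all of them, plus a penalty for the clocks that do not ring in time. -/
lemma integral_shortfall_clockStrategy_le (hE : M.IsClockFamily E r) (hr : 0 < r)
    (t₀ : unitInterval) (n : ℕ) (m k₀ : ℤ) :
    ∫ ω, M.shortfall m (M.Y (M.clockStrategy E hE.measurable t₀ n) (M.δ * k₀) 1 ω) 1 ∂μ ≤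
      ∫ ω, max (M.δ * (m - 1) - M.δ * k₀ - M.Z 1 ω - M.δ * (n + 1)) 0 ∂μ +
        M.δ * ((n + 1) * Real.exp (-(r * ((1 - t₀) / (n + 1))))) := by
  have hS := hE.admissible_clockStrategy hr t₀ n
  set S := M.clockStrategy E hE.measurable t₀ n with hSdef
  have hδ := M.δ_pos
  have hcell : ∀ j ∈ Finset.range (n + 1), cellTime t₀ n j 1 = (1 - t₀) / ((n : ℝ) + 1) := by
    intro j hj
    have hj' := Finset.mem_range.1 hj
    have hn : (n : ℝ) + 1 ≠ 0 := by positivity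
    rw [cellTime_one, coe_grid t₀ (by omega), coe_grid t₀ (by omega)]
    push_cast
    field_simp
    ring
  have hsum : ∀ ω, ∑ j ∈ Finset.range (n + 1),
      {ω | (1 - t₀) / ((n : ℝ) + 1) < E j ω}.indicator (fun _ => (1 : ℝ)) ω =
      (n + 1) - count (alarms t₀ n fun j => E j ω) 1 := by
    intro ω
    have h1 : ((n : ℝ) + 1) = ∑ j ∈ Finset.range (n + 1), (1 : ℝ) := by simp
    rw [h1, count_alarms t₀ n (fun j => hE.pos j ω), ← Finset.sum_sub_distrib, ← h1]
    refine Finset.sum_congr rfl fun j hj => ?_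
    rw [hcell j hj]
    simp only [indicator_apply, mem_ofPred_eq]
    by_cases h : E j ω ≤ (1 - t₀) / ((n : ℝ) + 1)
    · rw [if_neg (not_lt.2 h), if_pos h]
      ring
    · rw [if_pos (not_le.1 h), if_neg h]
      ring
  have hmeas : ∀ j, MeasurableSet {ω | (1 - t₀) / ((n : ℝ) + 1) < E j ω} := fun j =>
    hE.measurable j measurableSet_Ioi
  have hle : ∀ ω, M.shortfall m (M.Y S (M.δ * k₀) 1 ω) 1 ≤
      max (M.δ * (m - 1) - M.δ * k₀ - M.Z 1 ω - M.δ * (n + 1)) 0 + M.δ *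
        ∑ j ∈ Finset.range (n + 1),
          {ω | (1 - t₀) / ((n : ℝ) + 1) < E j ω}.indicator (fun _ => (1 : ℝ)) ω := by
    intro ω
    have h0 : 0 ≤ ∑ j ∈ Finset.range (n + 1),
        {ω | (1 - t₀) / ((n : ℝ) + 1) < E j ω}.indicator (fun _ => (1 : ℝ)) ω :=
      Finset.sum_nonneg fun j _ => indicator_nonneg (fun _ _ => zero_le_one) _
    have hY : M.Y S (M.δ * k₀) 1 ω = M.δ * k₀ + M.Z 1 ω +
        M.δ * count (alarms t₀ n fun j => E j ω) 1 := by
      have h1 : S.XB 1 ω = M.δ * count (alarms t₀ n fun j => E j ω) 1 := rfl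
      have h2 : S.XS 1 ω = 0 := rfl
      rw [Y, h1, h2, sub_zero]
    rw [M.shortfall_one, hY]
    refine max_le ?_ (add_nonneg (le_max_right _ _) (mul_nonneg hδ.le h0))
    rw [hsum]
    refine le_trans (le_of_eq ?_) (add_le_add_left (le_max_left _ _) _)
    ring
  have hi1 : Integrable (fun ω => M.shortfall m (M.Y S (M.δ * k₀) 1 ω) 1) μ :=
    integrable_shortfall_comp m 1 (hS.measurable_Y _ 1) (hS.integrable_Y _ 1)
  have hi2 : Integrable (fun ω => max (M.δ * (m - 1) - M.δ * k₀ - M.Z 1 ω - M.δ * (n + 1)) 0)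
      μ := by
    have h := (((integrable_const (M.δ * (m - 1) - M.δ * k₀)).fun_sub (M.integrable_Z 1)).fun_sub
      (integrable_const (M.δ * ((n : ℝ) + 1)))).pos_part
    exact h
  have hi3 : ∀ j, Integrable
      ({ω | (1 - t₀) / ((n : ℝ) + 1) < E j ω}.indicator (fun _ => (1 : ℝ))) μ := fun j =>
    (integrable_const (1 : ℝ)).indicator (hmeas j)
  have hi4 := (integrable_finsetSum (Finset.range (n + 1)) fun j _ => hi3 j).const_mul M.δ
  refine (integral_mono hi1 (hi2.add hi4) hle).trans ?_
  simp only [Pi.add_apply]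
  rw [integral_add hi2 hi4, integral_const_mul, integral_finsetSum _ fun j _ => hi3 j]
  refine add_le_add le_rfl (mul_le_mul_of_nonneg_left (le_of_eq ?_) hδ.le)
  have h1t : 0 ≤ (1 - t₀) / ((n : ℝ) + 1) := div_nonneg (sub_nonneg.2 t₀.2.2) (by positivity)
  rw [Finset.sum_congr rfl fun j _ => by
    rw [integral_indicator_const _ (hmeas j), hE.measureReal_lt j h1t, smul_eq_mul, mul_one]]
  rw [Finset.sum_const, Finset.card_range, nsmul_eq_mul]
  push_cast
  rfl

end IsClockFamily

/-- There are strategies, with intensities, that do not trade before `t₀`, never sell, and almost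
surely push the terminal demand above the threshold up to a small expected shortfall. -/
lemma exists_small_shortfall [IsProbabilityMeasure μ] [μ.IsComplete] (M : Market Ω μ)
    (hclock : ∀ r : ℝ, 0 < r → ∃ E : ℕ → Ω → ℝ, M.IsClockFamily E r) {t₀ : unitInterval}
    (ht₀ : t₀ < 1) (m k₀ : ℤ) {ε : ℝ} (hε : 0 < ε) :
    ∃ (S : Strategy Ω) (θ : OrderKind → unitInterval → Ω → ℝ), M.Admissible S ∧
      M.HasIntensities S θ ∧ (∀ y₀, ∀ t ≤ t₀, ∀ ω, M.Y S y₀ t ω = y₀ + M.Z t ω) ∧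
      (∀ ω, sellTimes S ω = ∅) ∧
      ∫ ω, M.shortfall m (M.Y S (M.δ * k₀) 1 ω) 1 ∂μ < ε := by
  have hδ := M.δ_pos
  have ht : (0 : ℝ) < 1 - t₀ := sub_pos.2 (Subtype.coe_lt_coe.2 ht₀)
  have hl1 : Tendsto (fun n : ℕ =>
      ∫ ω, max (M.δ * (m - 1) - M.δ * k₀ - M.Z 1 ω - M.δ * ((n : ℝ) + 1)) 0 ∂μ) atTop
      (𝓝 (∫ _, (0 : ℝ) ∂μ)) := by
    have hi := (integrable_const (M.δ * (m - 1) - M.δ * k₀)).fun_sub (M.integrable_Z 1)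
    refine tendsto_integral_of_dominated_convergence
      (fun ω => |M.δ * (m - 1) - M.δ * k₀ - M.Z 1 ω|) (fun n => ?_) hi.abs
      (fun n => ae_of_all _ fun ω => ?_) (ae_of_all _ fun ω => ?_)
    · exact ((((M.measurable_Z 1).const_sub _).sub_const _).max
        measurable_const).aestronglyMeasurable
    · rw [Real.norm_of_nonneg (le_max_right _ _)]
      refine max_le ?_ (abs_nonneg _)
      have : 0 ≤ M.δ * ((n : ℝ) + 1) := by positivity
      linarith [le_abs_self (M.δ * (m - 1) - M.δ * k₀ - M.Z 1 ω)]
    · have h1 : Tendsto (fun n : ℕ => M.δ * ((n : ℝ) + 1)) atTop atTop :=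
        (tendsto_atTop_add_const_right _ _ tendsto_natCast_atTop_atTop).const_mul_atTop hδ
      refine tendsto_const_nhds.congr' ?_
      filter_upwards [h1.eventually_ge_atTop (M.δ * (m - 1) - M.δ * k₀ - M.Z 1 ω)] with n hn
      rw [max_eq_right (by linarith)]
  rw [integral_zero] at hl1
  have hl2 : Tendsto (fun n : ℕ => M.δ * (((n : ℝ) + 1) * Real.exp (-((n : ℝ) + 1)))) atTop
      (𝓝 0) := by
    have h1 := (Real.tendsto_pow_mul_exp_neg_atTop_nhds_zero 1).comp
      (tendsto_atTop_add_const_right _ (1 : ℝ) (tendsto_natCast_atTop_atTop (R := ℝ)))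
    simpa [Function.comp_def] using h1.const_mul M.δ
  have hl := hl1.add hl2
  rw [add_zero] at hl
  obtain ⟨n, hn⟩ := (hl.eventually (gt_mem_nhds hε)).exists
  -- the rate is chosen so large that every clock is likely to ring during its cell
  set r : ℝ := ((n : ℝ) + 1) ^ 2 / (1 - t₀) with hr
  have hr0 : 0 < r := by positivity
  obtain ⟨E, hE⟩ := hclock r hr0
  refine ⟨M.clockStrategy E hE.measurable t₀ n, clockIntensity E r t₀ n,
    hE.admissible_clockStrategy hr0 t₀ n, hE.hasIntensities_clockStrategy hr0 t₀ n,
    fun y₀ t ht' ω => hE.Y_clockStrategy t₀ n y₀ ht' ω, hE.sellTimes_clockStrategy t₀ n, ?_⟩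
  refine (hE.integral_shortfall_clockStrategy_le hr0 t₀ n m k₀).trans_lt ?_
  have e : r * ((1 - t₀) / ((n : ℝ) + 1)) = (n : ℝ) + 1 := by
    rw [hr]
    field_simp
  rw [e]
  exact hn

end Market

namespace Market

variable {Ω : Type*} [mΩ : MeasurableSpace Ω] {μ : Measure Ω} {M : Market Ω μ} {S : Strategy Ω}

/-! ### The high type -/

/-- Noise orders alone bring the demand to every lattice point with positive probability, also
jointly with the fundamental value `1`. -/
lemma measure_state_ne_zero [IsProbabilityMeasure μ] (M : Market Ω μ) {t : unitInterval}
    {k₀ k : ℤ} (hk : t = 0 → k₀ = k)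
    (hY : ∀ ω, M.Y S (M.δ * k₀) t ω = M.δ * k₀ + M.Z t ω) :
    μ (M.state S (M.δ * k₀) 1 (M.δ * k) t) ≠ 0 := by
  have e : M.state S (M.δ * k₀) 1 (M.δ * k) t =
      {ω | M.v ω = 1} ∩ {ω | M.Z t ω = M.δ * ((k - k₀ : ℤ) : ℝ)} := by
    ext ω
    simp only [state, mem_ofPred_eq, mem_inter_iff, hY]
    push_cast
    constructor
    · rintro ⟨h1, h2⟩
      exact ⟨h2, by linarith⟩
    · rintro ⟨h1, h2⟩
      exact ⟨by linarith, h1⟩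
  have hZ : μ {ω | M.Z t ω = M.δ * ((k - k₀ : ℤ) : ℝ)} ≠ 0 := by
    rcases eq_or_lt_of_le (unitInterval.nonneg' : 0 ≤ t) with h | h
    · have : {ω | M.Z t ω = M.δ * ((k - k₀ : ℤ) : ℝ)} = univ := by
        ext ω
        rw [← h]
        simp [M.Z_zero, hk h.symm]
      rw [this, measure_univ]
      exact one_ne_zero
    · have := M.measure_Z_sub_eq_pos h (k - k₀)
      simp only [M.Z_zero, sub_zero] at this
      exact this.ne'
  have hind := (Indep_iff _ _ μ).1 (indep_of_indep_of_le_right (M.indep_v_history t)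
    (M.history_Z_le t)) {ω | M.v ω = 1} {ω | M.Z t ω = M.δ * ((k - k₀ : ℤ) : ℝ)}
    ⟨{1}, measurableSet_singleton 1, rfl⟩
    (measurable_history M.Z le_rfl (measurableSet_singleton _))
  rw [e, hind]
  exact mul_ne_zero M.measure_v_eq_one_ne_zero hZ

lemma sellLoss_eq_zero {S : Strategy Ω} (hS : ∀ ω, sellTimes S ω = ∅) (m : ℤ) (y₀ : ℝ)
    (t₀ : unitInterval) (ω : Ω) : M.sellLoss S m y₀ t₀ ω = 0 := by
  simp [sellLoss, orderSum, hS ω]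

/-- For the high type, the optimal strategies are those whose expected profit attains the expected
shortfall, since other strategies come arbitrarily close to it. -/
lemma Admissible.isOptimal_one_iff [IsProbabilityMeasure μ] [μ.IsComplete]
    (hclock : ∀ r : ℝ, 0 < r → ∃ E : ℕ → Ω → ℝ, M.IsClockFamily E r) (m : ℤ)
    (hS : M.Admissible S) :
    M.IsOptimal (M.pz (M.δ * m)) 1 S ↔ M.HighCondition (M.δ * m) S := by
  rw [← hS.expectedProfit_one_eq_iff m]
  constructor
  · rintro ⟨-, hopt⟩
    refine le_antisymm (hS.expectedProfit_one_le m) (le_of_forall_pos_sub_le fun ε hε => ?_)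
    have hpos := M.measureReal_v_eq_one_pos
    obtain ⟨S', θ, hS', -, -, hsell, hsmall⟩ := M.exists_small_shortfall hclock
      (t₀ := 0) zero_lt_one m 0 (mul_pos hε hpos)
    refine le_trans ?_ (hopt S' hS')
    rw [Int.cast_zero, mul_zero] at hsmall
    have hle : ∫ ω in {ω | M.v ω = 1}, M.shortfall m (M.Y S' 0 1 ω) 1 ∂μ ≤
        ∫ ω, M.shortfall m (M.Y S' 0 1 ω) 1 ∂μ :=
      setIntegral_le_integral (integrable_shortfall_comp m 1 (hS'.measurable_Y 0 1)
        (hS'.integrable_Y 0 1)) (ae_of_all _ fun _ => M.shortfall_nonneg _ _ _)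
    rw [hS'.expectedProfit_one]
    simp only [sellLoss_eq_zero hsell, integral_zero, add_zero]
    refine sub_le_sub_left ?_ _
    rw [inv_mul_le_iff₀ hpos, mul_comm]
    exact (hle.trans_lt hsmall).le
  · intro h
    exact ⟨hS, fun S' hS' => h ▸ hS'.expectedProfit_one_le m⟩

/-- The expected shortfall is the value function of the high type. -/
lemma isValueFunction_one [IsProbabilityMeasure μ] [μ.IsComplete] (M : Market Ω μ)
    (hclock : ∀ r : ℝ, 0 < r → ∃ E : ℕ → Ω → ℝ, M.IsClockFamily E r) (m : ℤ) :
    M.IsValueFunction (M.pz (M.δ * m)) 1 (M.H m) := by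
  refine fun k => ⟨fun k₀ t ht hk => ⟨?_, fun b hb => ?_⟩, ?_⟩
  · rintro J ⟨S, θ, hS, hθ, hpos, rfl⟩
    rw [M.H_eq_shortfall]
    exact hS.remainingProfit_one_le hθ m k₀ k t hpos
  · rw [M.H_eq_shortfall]
    refine le_of_forall_pos_sub_le fun ε hε => ?_
    -- the probability of the state is the same for all strategies that do not trade before `t`
    set q : ℝ := μ.real ({ω | M.δ * (k₀ : ℝ) + M.Z t ω = M.δ * k ∧ M.v ω = 1}) with hq
    have hstate : ∀ S : Strategy Ω, (∀ ω, M.Y S (M.δ * k₀) t ω = M.δ * k₀ + M.Z t ω) →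
        M.state S (M.δ * k₀) 1 (M.δ * k) t =
          {ω | M.δ * (k₀ : ℝ) + M.Z t ω = M.δ * k ∧ M.v ω = 1} := by
      intro S hS
      ext ω
      simp only [state, mem_ofPred_eq, hS]
    obtain ⟨S₁, -, -, -, hY₁, -, -⟩ := M.exists_small_shortfall hclock ht m k₀ one_pos
    have hq0 : 0 < q := by
      rw [hq, ← hstate S₁ (hY₁ _ t le_rfl)]
      exact ENNReal.toReal_pos (M.measure_state_ne_zero hk (hY₁ _ t le_rfl)) (by finiteness)
    obtain ⟨S, θ, hS, hθ, hY, hsell, hsmall⟩ := M.exists_small_shortfall hclock ht m k₀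
      (mul_pos hε hq0)
    have hne := M.measure_state_ne_zero hk (hY (M.δ * k₀) t le_rfl)
    refine le_trans ?_ (hb ⟨S, θ, hS, hθ, hne, rfl⟩)
    have hle : ∫ ω in M.state S (M.δ * k₀) 1 (M.δ * k) t,
        M.shortfall m (M.Y S (M.δ * k₀) 1 ω) 1 ∂μ ≤
        ∫ ω, M.shortfall m (M.Y S (M.δ * k₀) 1 ω) 1 ∂μ :=
      setIntegral_le_integral (integrable_shortfall_comp m 1 (hS.measurable_Y _ 1)
        (hS.integrable_Y _ 1)) (ae_of_all _ fun _ => M.shortfall_nonneg _ _ _)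
    rw [hS.remainingProfit_one hθ m k₀ k t hne]
    simp only [sellLoss_eq_zero hsell, integral_zero, add_zero]
    refine sub_le_sub_left ?_ _
    rw [hstate S (hY _ t le_rfl)] at hle ⊢
    rw [← hq, inv_mul_le_iff₀ hq0, mul_comm q]
    exact (hle.trans_lt hsmall).le
  · have e : M.H m k = M.shortfall m (M.δ * k) := funext fun t => M.H_eq_shortfall m k t
    rw [e]
    exact ((M.continuous_shortfall_time m _).tendsto 1).mono_left nhdsWithin_le_nhds

end Market

/-! ### Reflection: the low type as a high type -/

/-- The kind of an order after buying and selling have been exchanged. -/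
def OrderKind.reflect : OrderKind → OrderKind
  | .BB => .SS
  | .BT => .ST
  | .BS => .SB
  | .SS => .BB
  | .ST => .BT
  | .SB => .BS

lemma OrderKind.reflect_reflect (c : OrderKind) : c.reflect.reflect = c := by
  cases c <;> rfl

/-- The strategy in which buying and selling are exchanged. -/
def Strategy.reflect {Ω : Type*} [mΩ : MeasurableSpace Ω] (S : Strategy Ω) : Strategy Ω where
  XB := S.XS
  XS := S.XB
  FI := S.FI

namespace Market

variable {Ω : Type*} [mΩ : MeasurableSpace Ω] {μ : Measure Ω}

/-- The market in which buying and selling are exchanged and the fundamental value is `1 - v`. -/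
def reflect [IsProbabilityMeasure μ] (M : Market Ω μ) : Market Ω μ where
  δ := M.δ
  β := M.β
  v ω := 1 - M.v ω
  ZB := M.ZS
  ZS := M.ZB
  δ_pos := M.δ_pos
  β_pos := M.β_pos
  v_measurable := M.v_measurable.const_sub 1
  v_values ω := by
    rcases M.v_values ω with h | h <;> simp [h]
  v_random := by
    have e : {ω | 1 - M.v ω = 0} = {ω | M.v ω = 0}ᶜ := by
      ext ω
      simp only [mem_ofPred_eq, mem_compl_iff]
      rcases M.v_values ω with h | h <;> simp [h]
    have hm : MeasurableSet {ω | M.v ω = 0} := M.v_measurable (measurableSet_singleton 0)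
    rw [e, prob_compl_eq_one_sub hm]
    exact ⟨tsub_pos_of_lt M.v_random.2, ENNReal.sub_lt_self ENNReal.one_ne_top one_ne_zero
      M.v_random.1.ne'⟩
  ZB_poisson := M.ZS_poisson
  ZS_poisson := M.ZB_poisson
  noise_indep := M.noise_indep.symm
  v_indep := M.v_indep.comp (φ := fun x => 1 - x) (measurable_id.const_sub 1) measurable_swap

variable [IsProbabilityMeasure μ] {M : Market Ω μ} {S : Strategy Ω}

lemma reflect_reflect (M : Market Ω μ) : M.reflect.reflect = M := by
  cases M
  simp only [reflect, sub_sub_cancel]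

lemma reflect_Z (M : Market Ω μ) (t : unitInterval) (ω : Ω) : M.reflect.Z t ω = -M.Z t ω := by
  simp only [Z, reflect, neg_sub]

lemma reflect_Y (M : Market Ω μ) (S : Strategy Ω) (y₀ : ℝ) (t : unitInterval) (ω : Ω) :
    M.reflect.Y S.reflect (-y₀) t ω = -M.Y S y₀ t ω := by
  simp only [Y, reflect_Z, Strategy.reflect]
  ring

lemma Admissible.reflect (hS : M.Admissible S) : M.reflect.Admissible S.reflect := by
  have hv : MeasurableSpace.comap M.reflect.v inferInstance =
      MeasurableSpace.comap M.v inferInstance := by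
    refine le_antisymm ?_ ?_
    · exact ((comap_measurable M.v).const_sub 1).comap_le
    · have : M.v = fun ω => 1 - M.reflect.v ω := by
        funext ω
        simp [Market.reflect]
      conv_lhs => rw [this]
      exact ((comap_measurable M.reflect.v).const_sub 1).comap_le
  have hZ : ∀ t, history M.reflect.Z t = history M.Z t := by
    intro t
    refine iSup_congr fun s => iSup_congr fun _ => le_antisymm ?_ ?_
    · have : M.reflect.Z s = fun ω => -M.Z s ω := funext fun ω => M.reflect_Z s ω
      rw [this]
      exact (comap_measurable (M.Z s)).neg.comap_le
    · have : M.Z s = fun ω => -M.reflect.Z s ω := by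
        funext ω
        rw [reflect_Z, neg_neg]
      conv_lhs => rw [this]
      exact (comap_measurable (M.reflect.Z s)).neg.comap_le
  obtain ⟨ℋ, hℋ, hFI⟩ := hS.information
  refine ⟨hS.usual, ⟨ℋ, ?_, fun t => ?_⟩, hS.sell_adapted, hS.buy_adapted, hS.sell_path,
    hS.buy_path, hS.sell_integrable, hS.buy_integrable, hS.sell_compensator, hS.buy_compensator,
    hS.no_opposite.mono fun ω h s => (h s).symm⟩
  · rw [hv, hZ]
    exact hℋ
  · rw [hv, hZ]
    exact hFI t

lemma admissible_reflect_iff : M.reflect.Admissible S.reflect ↔ M.Admissible S := by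
  refine ⟨fun h => ?_, Admissible.reflect⟩
  have := h.reflect
  rwa [reflect_reflect] at this

lemma reflect_comp (M : Market Ω μ) (S : Strategy Ω) (c : OrderKind) :
    M.reflect.comp S.reflect c.reflect = M.comp S c := by
  funext t ω
  simp only [comp]
  refine finsum_congr fun s => ?_
  cases c <;> simp only [compJump, OrderKind.reflect, reflect, Strategy.reflect, and_comm] <;> congr

lemma Admissible.reflect_Yleft (hS : M.Admissible S) (y₀ : ℝ) (t : unitInterval) (ω : Ω) :
    M.reflect.Yleft S.reflect (-y₀) t ω = -M.Yleft S y₀ t ω := by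
  have e : (fun s => M.reflect.Y S.reflect (-y₀) s ω) = fun s => -M.Y S y₀ s ω :=
    funext fun s => M.reflect_Y S y₀ s ω
  rcases eq_or_lt_of_le (unitInterval.nonneg' : 0 ≤ t) with h | h
  · rw [← h, Yleft, Yleft, e, leftLim_zero, leftLim_zero]
  · rw [Yleft, e]
    refine leftLim_eq_of_eventually h ?_
    filter_upwards [(hS.Yleft_eq y₀ h ω).1] with s hs
    rw [hs]

/-- Two pricing rules correspond to each other under reflection if, on the lattice, the price of the
reflected asset is one minus the price of the asset. -/
def ReflectedPrices (M : Market Ω μ) (p p' : ℝ → unitInterval → ℝ) : Prop :=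
  ∀ (k : ℤ) (t : unitInterval), p' (-(M.δ * k)) t = 1 - p (M.δ * k) t

variable {p p' : ℝ → unitInterval → ℝ}

lemma ReflectedPrices.symm (hp : M.ReflectedPrices p p') : M.reflect.ReflectedPrices p' p := by
  intro k t
  have h := hp (-k) t
  change p (-(M.δ * k)) t = 1 - p' (M.δ * k) t
  push_cast at h
  rw [mul_neg, neg_neg] at h
  rw [h]
  ring

lemma ReflectedPrices.unitGain (hp : M.ReflectedPrices p p') (x : ℝ) (c : OrderKind) (k : ℤ)
    (u : unitInterval) : M.reflect.unitGain p' (1 - x) c.reflect (-(M.δ * k)) u =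
      M.unitGain p x c (M.δ * k) u := by
  have h0 := hp k u
  have h1 := hp (k + 1) u
  have h2 := hp (k + 2) u
  have h3 := hp (k - 1) u
  have h4 := hp (k - 2) u
  have e1 : M.δ * ((k + 1 : ℤ) : ℝ) = M.δ * k + M.δ := by push_cast; ring
  have e2 : M.δ * ((k + 2 : ℤ) : ℝ) = M.δ * k + 2 * M.δ := by push_cast; ring
  have e3 : M.δ * ((k - 1 : ℤ) : ℝ) = M.δ * k - M.δ := by push_cast; ring
  have e4 : M.δ * ((k - 2 : ℤ) : ℝ) = M.δ * k - 2 * M.δ := by push_cast; ring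
  rw [e1, neg_add'] at h1
  rw [e2, neg_add'] at h2
  rw [e3, neg_sub', sub_neg_eq_add] at h3
  rw [e4, neg_sub', sub_neg_eq_add] at h4
  have hδ : M.reflect.δ = M.δ := rfl
  cases c <;> simp only [Market.unitGain, OrderKind.reflect, hδ, h0, h1, h2, h3, h4] <;> ring

lemma Admissible.reflect_gainFrom (hS : M.Admissible S) (hp : M.ReflectedPrices p p')
    (c : OrderKind) (ω : Ω) :
    M.reflect.gainFrom p' S.reflect c.reflect ω = M.gainFrom p S c ω := by
  simp only [gainFrom, jumpIntegral, reflect_comp]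
  refine finsum_congr fun s => ?_
  rcases eq_or_lt_of_le (unitInterval.nonneg' : 0 ≤ s) with h | h
  · simp [← h, jump, leftLim_zero]
  · have h1 := hS.reflect_Yleft 0 s ω
    rw [neg_zero] at h1
    obtain ⟨k, hk⟩ := hS.exists_int_Yleft 0 h ω
    rw [Int.cast_zero, mul_zero] at hk
    rw [h1, hk]
    congr 1
    exact hp.unitGain (M.v ω) c k s

lemma Admissible.reflect_expectedProfit (hS : M.Admissible S) (hp : M.ReflectedPrices p p')
    (x : ℝ) : M.reflect.expectedProfit p' (1 - x) S.reflect = M.expectedProfit p x S := by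
  have e : {ω | M.reflect.v ω = 1 - x} = {ω | M.v ω = x} := by
    ext ω
    simp [Market.reflect]
  have e' : M.reflect.profit p' S.reflect = M.profit p S := by
    funext ω
    have h := hS.reflect_gainFrom hp (ω := ω)
    have h1 := h .BB
    have h2 := h .BT
    have h3 := h .BS
    have h4 := h .SS
    have h5 := h .ST
    have h6 := h .SB
    simp only [OrderKind.reflect] at h1 h2 h3 h4 h5 h6
    rw [profit, profit, h1, h2, h3, h4, h5, h6]
    ring
  rw [expectedProfit, e, e', expectedProfit]

lemma isOptimal_reflect_iff (hp : M.ReflectedPrices p p') (x : ℝ) :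
    M.reflect.IsOptimal p' (1 - x) S.reflect ↔ M.IsOptimal p x S := by
  rw [IsOptimal, IsOptimal, admissible_reflect_iff]
  refine and_congr_right fun hS => ?_
  rw [hS.reflect_expectedProfit hp]
  constructor
  · intro h T hT
    rw [← hT.reflect_expectedProfit hp]
    exact h _ hT.reflect
  · intro h T hT
    have hT' : M.Admissible T.reflect := admissible_reflect_iff.1 hT
    have := hT'.reflect_expectedProfit hp x
    change M.reflect.expectedProfit p' (1 - x) T = _ at this
    rw [this]
    exact h _ hT'

lemma Admissible.reflect_highCondition_iff (hS : M.Admissible S) (m : ℤ) :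
    M.reflect.HighCondition (M.δ * ((1 - m : ℤ) : ℝ)) S.reflect ↔ M.LowCondition (M.δ * m) S := by
  have key : ∀ ω, ((M.reflect.v ω = 1 → M.δ * ((1 - m : ℤ) : ℝ) - M.reflect.δ ≤
      M.reflect.Y S.reflect 0 1 ω ∧ ∀ t, M.reflect.comp S.reflect .SS t ω = 0 ∧
        M.reflect.comp S.reflect .ST t ω = 0 ∧ M.reflect.comp S.reflect .SB t ω = 0) ↔
      (M.v ω = 0 → M.Y S 0 1 ω < M.δ * m + M.δ ∧
        ∀ t, M.comp S .BB t ω = 0 ∧ M.comp S .BT t ω = 0 ∧ M.comp S .BS t ω = 0)) := by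
    intro ω
    have hv : M.reflect.v ω = 1 ↔ M.v ω = 0 := by simp [Market.reflect]
    have hY := M.reflect_Y S 0 1 ω
    rw [neg_zero] at hY
    obtain ⟨k, hk⟩ := hS.exists_int_Y 0 1 ω
    rw [Int.cast_zero, mul_zero] at hk
    have hY' : M.δ * ((1 - m : ℤ) : ℝ) - M.reflect.δ ≤ M.reflect.Y S.reflect 0 1 ω ↔
        M.Y S 0 1 ω < M.δ * m + M.δ := by
      rw [hY, hk]
      change M.δ * ((1 - m : ℤ) : ℝ) - M.δ ≤ _ ↔ _
      have e1 : M.δ * ((1 - m : ℤ) : ℝ) - M.δ = M.δ * ((-m : ℤ) : ℝ) := by push_cast; ring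
      have e2 : -(M.δ * (k : ℝ)) = M.δ * ((-k : ℤ) : ℝ) := by push_cast; ring
      have e3 : M.δ * (m : ℝ) + M.δ = M.δ * ((m + 1 : ℤ) : ℝ) := by push_cast; ring
      rw [e1, e2, e3, mul_le_mul_iff_right₀ M.δ_pos, mul_lt_mul_iff_right₀ M.δ_pos, Int.cast_le,
        Int.cast_lt]
      omega
    have h1 := M.reflect_comp S .BB
    have h2 := M.reflect_comp S .BT
    have h3 := M.reflect_comp S .BS
    simp only [OrderKind.reflect] at h1 h2 h3
    rw [hv, hY', h1, h2, h3]
  exact eventually_congr (ae_of_all _ key)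

lemma HasIntensities.reflect {θ : OrderKind → unitInterval → Ω → ℝ} (hθ : M.HasIntensities S θ) :
    M.reflect.HasIntensities S.reflect fun c => θ c.reflect := by
  intro c
  have h := M.reflect_comp S c.reflect
  rw [OrderKind.reflect_reflect] at h
  rw [h]
  exact hθ c.reflect

lemma reflect_state (M : Market Ω μ) (S : Strategy Ω) (y₀ x y : ℝ) (t : unitInterval) :
    M.reflect.state S.reflect (-y₀) (1 - x) (-y) t = M.state S y₀ x y t := by
  ext ω
  simp only [state, reflect_Y, mem_ofPred_eq, neg_inj]
  simp [reflect]

lemma Admissible.reflect_remainingProfit (hS : M.Admissible S) (hp : M.ReflectedPrices p p')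
    (θ : OrderKind → unitInterval → Ω → ℝ) (k₀ : ℤ) (x y : ℝ) (t : unitInterval) :
    M.reflect.remainingProfit p' S.reflect (fun c => θ c.reflect) (-(M.δ * k₀)) (1 - x) (-y) t =
      M.remainingProfit p S θ (M.δ * k₀) x y t := by
  have key : ∀ c ω, ∫ u in Ioc t 1, M.reflect.unitGain p' (1 - x) c.reflect
      (M.reflect.Yleft S.reflect (-(M.δ * k₀)) u ω) u * θ c u ω =
      ∫ u in Ioc t 1, M.unitGain p x c (M.Yleft S (M.δ * k₀) u ω) u * θ c u ω := by
    intro c ω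
    refine setIntegral_congr_fun measurableSet_Ioc fun u hu => ?_
    obtain ⟨k, hk⟩ := hS.exists_int_Yleft k₀ (unitInterval.nonneg'.trans_lt hu.1) ω
    simp only [hS.reflect_Yleft, hk, hp.unitGain]
  have h1 := fun ω => key .BB ω
  have h2 := fun ω => key .BT ω
  have h3 := fun ω => key .BS ω
  have h4 := fun ω => key .SS ω
  have h5 := fun ω => key .ST ω
  have h6 := fun ω => key .SB ω
  simp only [OrderKind.reflect] at h1 h2 h3 h4 h5 h6
  simp only [remainingProfit, reflect_state, OrderKind.reflect, h1, h2, h3, h4, h5, h6]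
  congr 1
  refine integral_congr_ae (ae_of_all _ fun ω => ?_)
  ring

lemma remainingProfits_subset_reflect (hp : M.ReflectedPrices p p') (k₀ : ℤ) (x y : ℝ)
    (t : unitInterval) : M.remainingProfits p (M.δ * k₀) x y t ⊆
      M.reflect.remainingProfits p' (-(M.δ * k₀)) (1 - x) (-y) t := by
  rintro J ⟨S, θ, hS, hθ, hpos, rfl⟩
  refine ⟨S.reflect, fun c => θ c.reflect, hS.reflect, hθ.reflect, ?_,
    (hS.reflect_remainingProfit hp θ k₀ x y t).symm⟩
  rwa [reflect_state]

lemma remainingProfits_reflect (hp : M.ReflectedPrices p p') (k₀ : ℤ) (x y : ℝ)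
    (t : unitInterval) : M.reflect.remainingProfits p' (-(M.δ * k₀)) (1 - x) (-y) t =
      M.remainingProfits p (M.δ * k₀) x y t := by
  refine Subset.antisymm ?_ (M.remainingProfits_subset_reflect hp k₀ x y t)
  have h := M.reflect.remainingProfits_subset_reflect hp.symm (-k₀) (1 - x) (-y) t
  have e : M.reflect.δ * ((-k₀ : ℤ) : ℝ) = -(M.δ * k₀) := by
    change M.δ * ((-k₀ : ℤ) : ℝ) = _
    push_cast
    ring
  rwa [reflect_reflect, e, neg_neg, neg_neg, sub_sub_cancel] at h

/-- The reflection of the pricing rule `p^z` is the pricing rule with the reflected threshold. -/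
lemma reflectedPrices_pz (M : Market Ω μ) (m : ℤ) :
    M.ReflectedPrices (M.pz (M.δ * m)) (M.reflect.pz (M.δ * ((1 - m : ℤ) : ℝ))) := by
  intro k t
  have h : ∀ ω, P (M.δ * ((1 - m : ℤ) : ℝ))
      (-(M.δ * k) + (M.reflect.Z 1 ω - M.reflect.Z t ω)) =
      1 - P (M.δ * m) (M.δ * k + (M.Z 1 ω - M.Z t ω)) := by
    intro ω
    obtain ⟨j, hj⟩ := M.exists_int_Z_sub t 1 ω
    have e1 : -(M.δ * k) + (M.reflect.Z 1 ω - M.reflect.Z t ω) =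
        M.δ * ((-(k + j) : ℤ) : ℝ) := by
      rw [reflect_Z, reflect_Z]
      push_cast
      linarith
    have e2 : M.δ * k + (M.Z 1 ω - M.Z t ω) = M.δ * ((k + j : ℤ) : ℝ) := by
      rw [hj]
      push_cast
      ring
    rw [e1, e2, M.P_lattice, M.P_lattice]
    by_cases h : k + j < m
    · rw [if_neg (by omega), if_pos h, sub_zero]
    · rw [if_pos (by omega), if_neg h, sub_self]
  rw [pz, pz, integral_congr_ae (ae_of_all _ h), integral_sub (integrable_const 1)
    (M.integrable_P _ _ _)]
  simp

lemma signedSum_neg (m n : ℤ) (α : ℤ → ℝ) :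
    signedSum (-n) (-m) (fun j => α (-j)) = signedSum m n α := by
  have key : ∀ a b : ℤ, ∑ j ∈ Finset.Icc (-b) (-a), α (-j) = ∑ j ∈ Finset.Icc a b, α j := by
    intro a b
    refine Finset.sum_nbij' (fun j => -j) (fun j => -j) ?_ ?_ ?_ ?_ ?_ <;>
      simp only [Finset.mem_Icc, neg_neg, implies_true] <;> intros <;> omega
  simp only [signedSum, key, neg_le_neg_iff]

/-- The function `L` is the reflection of the function `H`. -/
lemma L_eq_reflect_H (M : Market Ω μ) (m k : ℤ) (t : unitInterval) :
    M.L m k t = M.reflect.H (1 - m) (-k) t := by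
  have hp := M.reflectedPrices_pz m
  have hδ : M.reflect.δ = M.δ := rfl
  have hβ : M.reflect.β = M.β := rfl
  rw [L, H, hδ, hβ]
  congr 1
  · have h := signedSum_neg m k (fun j => P (M.δ * m) (M.δ * j - M.δ))
    rw [← h, show (1 - m - 1 : ℤ) = -m by ring]
    congr 2
    funext j
    have e1 : M.δ * ((-j : ℤ) : ℝ) - M.δ = M.δ * ((-j - 1 : ℤ) : ℝ) := by push_cast; ring
    have e2 : M.δ * (j : ℝ) + M.δ = M.δ * ((j + 1 : ℤ) : ℝ) := by push_cast; ring
    rw [e1, e2, M.P_lattice, M.P_lattice]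
    by_cases h : -j - 1 < m
    · rw [if_pos h, if_neg (by omega), sub_self]
    · rw [if_neg h, if_pos (by omega), sub_zero]
  · congr 2
    funext u
    have h1 := hp k u
    have h2 := hp (k - 1) u
    have e1 : M.δ * ((-k : ℤ) : ℝ) = -(M.δ * k) := by push_cast; ring
    have e2 : -(M.δ * ((k - 1 : ℤ) : ℝ)) = -(M.δ * k) + M.δ := by push_cast; ring
    have e3 : M.δ * ((k - 1 : ℤ) : ℝ) = M.δ * k - M.δ := by push_cast; ring
    rw [e2, e3] at h2
    rw [e1, h1, h2]
    ring

end Market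

namespace Market

variable {Ω : Type*} [mΩ : MeasurableSpace Ω] {μ : Measure Ω} [IsProbabilityMeasure μ]
  {M : Market Ω μ} {S : Strategy Ω}

/-! ### The low type -/

lemma Admissible.isOptimal_zero_iff [μ.IsComplete]
    (hclock : ∀ r : ℝ, 0 < r → ∃ E : ℕ → Ω → ℝ, M.reflect.IsClockFamily E r) (m : ℤ)
    (hS : M.Admissible S) :
    M.IsOptimal (M.pz (M.δ * m)) 0 S ↔ M.LowCondition (M.δ * m) S := by
  rw [← isOptimal_reflect_iff (M.reflectedPrices_pz m) 0, sub_zero,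
    ← hS.reflect_highCondition_iff m]
  exact hS.reflect.isOptimal_one_iff hclock (1 - m)

lemma isValueFunction_zero [μ.IsComplete] (M : Market Ω μ)
    (hclock : ∀ r : ℝ, 0 < r → ∃ E : ℕ → Ω → ℝ, M.reflect.IsClockFamily E r) (m : ℤ) :
    M.IsValueFunction (M.pz (M.δ * m)) 0 (M.L m) := by
  intro k
  obtain ⟨hlub, hlim⟩ := M.reflect.isValueFunction_one hclock (1 - m) (-k)
  have hL : M.L m k = M.reflect.H (1 - m) (-k) := funext fun t => M.L_eq_reflect_H m k t
  have e : ∀ j : ℤ, M.reflect.δ * ((-j : ℤ) : ℝ) = -(M.δ * j) := fun j => by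
    change M.δ * ((-j : ℤ) : ℝ) = _
    push_cast
    ring
  refine ⟨fun k₀ t ht hk => ?_, ?_⟩
  · have h := hlub (-k₀) t ht fun h0 => congrArg _ (hk h0)
    have h' := M.remainingProfits_reflect (M.reflectedPrices_pz m) k₀ 0 (M.δ * k) t
    rw [sub_zero] at h'
    rw [e, e] at h
    rw [hL, ← h']
    exact h
  · rw [hL]
    exact hlim

lemma Admissible.remainingProfit_zero_eq (hS : M.Admissible S)
    {θ : OrderKind → unitInterval → Ω → ℝ} (hθ : M.HasIntensities S θ) (m k : ℤ)
    (t : unitInterval) (hpos : μ (M.state S 0 0 (M.δ * k) t) ≠ 0)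
    (hL : M.LowCondition (M.δ * m) S) :
    M.remainingProfit (M.pz (M.δ * m)) S θ 0 0 (M.δ * k) t = M.L m k t := by
  have e : M.reflect.δ * ((-k : ℤ) : ℝ) = -(M.δ * k) := by
    change M.δ * ((-k : ℤ) : ℝ) = _
    push_cast
    ring
  have hstate := M.reflect_state S 0 0 (M.δ * k) t
  have hprofit := hS.reflect_remainingProfit (M.reflectedPrices_pz m) θ 0 0 (M.δ * k) t
  simp only [Int.cast_zero, mul_zero, neg_zero, sub_zero] at hstate hprofit
  rw [← hprofit, M.L_eq_reflect_H, M.reflect.H_eq_shortfall, ← e]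
  refine hS.reflect.remainingProfit_one_eq hθ.reflect (1 - m) (-k) t ?_
    ((hS.reflect_highCondition_iff m).2 hL)
  rwa [e, hstate]

end Market

end GlostenMilgrom

/-! ### Optimal strategies and value functions of both types -/

open GlostenMilgrom in
theorem mainTheorem5 {Ω : Type*} [MeasurableSpace Ω] (μ : Measure Ω) [IsProbabilityMeasure μ]
    [μ.IsComplete] (M : Market Ω μ)
    (U : Ω → ℝ) (hU : Measurable U) (hU_law : HasLaw U (volume.restrict (Set.Icc (0 : ℝ) 1)) μ)
    (hU_indep : IndepFun U
      (fun ω => (M.v ω, ((fun t => M.ZB t ω), (fun t => M.ZS t ω)))) μ)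
    (m : ℤ) :
    (∀ S : Strategy Ω, M.Admissible S →
      (M.IsOptimal (M.pz (M.δ * m)) 1 S ↔ M.HighCondition (M.δ * m) S)) ∧
    (∀ S : Strategy Ω, M.Admissible S →
      (M.IsOptimal (M.pz (M.δ * m)) 0 S ↔ M.LowCondition (M.δ * m) S)) ∧
    M.IsValueFunction (M.pz (M.δ * m)) 1 (M.H m) ∧
    M.IsValueFunction (M.pz (M.δ * m)) 0 (M.L m) ∧
    (∀ (S : Strategy Ω) (θ : OrderKind → unitInterval → Ω → ℝ),
      M.Admissible S → M.HasIntensities S θ →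
      ∀ (k : ℤ) (t : unitInterval), t < 1 →
        (M.HighCondition (M.δ * m) S → μ (M.state S 0 1 (M.δ * k) t) ≠ 0 →
          M.remainingProfit (M.pz (M.δ * m)) S θ 0 1 (M.δ * k) t = M.H m k t) ∧
        (M.LowCondition (M.δ * m) S → μ (M.state S 0 0 (M.δ * k) t) ≠ 0 →
          M.remainingProfit (M.pz (M.δ * m)) S θ 0 0 (M.δ * k) t = M.L m k t)) := by
  have hclock : ∀ r : ℝ, 0 < r → ∃ E : ℕ → Ω → ℝ, M.IsClockFamily E r :=
    fun r hr => M.exists_isClockFamily hU hU_law hU_indep hr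
  have hclock' : ∀ r : ℝ, 0 < r → ∃ E : ℕ → Ω → ℝ, M.reflect.IsClockFamily E r := by
    have hmeas : Measurable
        fun q : ℝ × (unitInterval → ℝ) × (unitInterval → ℝ) => (1 - q.1, (q.2.2, q.2.1)) := by
      fun_prop
    exact fun r hr => M.reflect.exists_isClockFamily hU hU_law (hU_indep.comp measurable_id hmeas) hr
  refine ⟨fun S hS => hS.isOptimal_one_iff hclock m, fun S hS => hS.isOptimal_zero_iff hclock' m,
    M.isValueFunction_one hclock m, M.isValueFunction_zero hclock' m,
    fun S θ hS hθ k t _ => ⟨fun hH hpos => ?_, fun hL hpos => ?_⟩⟩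
  · rw [M.H_eq_shortfall]
    exact hS.remainingProfit_one_eq hθ m k t hpos hH
  · exact hS.remainingProfit_zero_eq hθ m k t hpos hL
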